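/- Theorem 3. Let $G$ be a finite-dimensional (smooth, Hausdorff) real Lie group with Lie algebra $\mathfrak g$. Let $g$ be a left-invariant Riemannian metric and $p$ a left-invariant two-form on $G$, given by a positive definite symmetric bilinear form and a skew bilinear form on $\mathfrak g$ (denoted by the same letters). Let $\Gamma^A{}_{BC}$ be the Christoffel symbols of $g$ and $Q^A{}_{BC}=\tfrac32 g^{AD}\partial_{[D}p_{BC]}$. Let $M^{2+1}$ be Minkowski space with Cartesian coordinates $(x,y,t)$, metric $\eta=\mathrm{diag}(1,1,-1)$ and volume tensor $\epsilon$, let $v=(v_x,v_y,v_t)$ be a constant covector on $M^{2+1}$, and let $\lambda\in\mathbb R$ be a coupling constant which is small in the sense that there is a $k>0$ with $$\tfrac1k\,(|E|^2+|H|^2)\ \le\ |E|^2+|H|^2+2\lambda v_t\,p(H,E)\ \le\ k\,(|E|^2+|H|^2)\qquad\text{for all } E,H\in\mathfrak g,$$ where $|\cdot|$ is the norm of $g$ (for $\lambda=0$, the case without torsion, this holds trivially). A smooth map $\Psi:M^{2+1}\to G$ is a torsion wave map if in local coordinates $\psi^A$ on $G$ $$\eta^{\mu\nu}\partial_\mu\partial_\nu\psi^A+(\Gamma^A{}_{BC}+Q^A{}_{BC})(\psi)\,\partial_\mu\psi^B\,\partial_\nu\psi^C\,(\eta^{\mu\nu}+\lambda\,\epsilon^{\mu\nu\sigma}v_\sigma)=0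 .$$ Let $L\in\mathfrak g$, $t_0\in\mathbb R$, and let $\Sigma$ be $\mathbb R$ or a circle $\mathbb R/P\mathbb Z$, $P>0$. Let smooth initial data be given: a map $\hat\Phi:\Sigma\to G$ and a field $\hat\Theta$ of tangent vectors, $\hat\Theta(x)\in T_{\hat\Phi(x)}G$. If $\Sigma=\mathbb R$, assume that the data have compact support, i.e. that outside some compact interval $\hat\Phi$ is constant on each of the two ends and $\hat\Theta=0$. Then there is exactly one smooth map $\Psi$, defined for all $(x,y,t)$ with $x\in\Sigma$ and $y,t\in\mathbb R$ (i.e. $P$-periodic in $x$ if $\Sigma=\mathbb R/P\mathbb Z$), with values in $G$, which is left-translation equivariant, $$\Psi(x,y+s,t)=\exp(sL)\,\Psi(x,y,t)\quad\text{for all } s\in\mathbb R,\qquad\text{equivalently}\quad \Psi(x,y,t)=\exp(yL)\,\Phi(x,t),$$ is a torsion wave map, and satisfies $\Phi(x,t_0)=\hat\Phi(x)$ and $\partial_t\Phi(x,t_0)=\hat\Theta(x)$ for all $x\in\Sigma$, where $\Phi(x,t)=\Psi(x,0,t)$. -/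

import Mathlib

open scoped Manifold ContDiff

noncomputable section

namespace LieWaveMap

section Group

variable {E : Type*} [NormedAddCommGroup E] [NormedSpace ℝ E]
variable {G : Type*} [TopologicalSpace G] [ChartedSpace E G] [Group G]

/-! ### One-parameter subgroups -/

/-- Left-invariant vector fields on a Lie group are complete: there is a global integral curve
through the identity. -/
theorem exists_expCurve [FiniteDimensional ℝ E] [LieGroup 𝓘(ℝ, E) ∞ G] [T2Space G]
    (L : GroupLieAlgebra 𝓘(ℝ, E) G) :
    ∃ γ : ℝ → G, γ 0 = 1 ∧
      IsMIntegralCurve (I := 𝓘(ℝ, E)) γ (fun h => mulInvariantVectorField L h) := by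
  have : CompleteSpace E := FiniteDimensional.complete ℝ E
  have h3 : LieGroup 𝓘(ℝ, E) (minSmoothness ℝ 3) G := by
    rw [minSmoothness_of_isRCLikeNormedField]; infer_instance
  have h1 : IsManifold 𝓘(ℝ, E) 1 G := IsManifold.of_le (n := ∞) (by simp)
  have hv : ContMDiff 𝓘(ℝ, E) 𝓘(ℝ, E).tangent 1
      (fun h : G => (⟨h, mulInvariantVectorField L h⟩ : TangentBundle 𝓘(ℝ, E) G)) := by
    refine (contMDiff_mulInvariantVectorField L).of_le ?_
    rw [minSmoothness_of_isRCLikeNormedField]; norm_num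
  have md : ∀ a b : G, MDifferentiableAt 𝓘(ℝ, E) 𝓘(ℝ, E) (fun x : G => a * x) b := fun a b =>
    (contMDiff_mul_left (I := 𝓘(ℝ, E)) (n := ∞) (a := a)).mdifferentiableAt (by simp)
  obtain ⟨γ, hγ0, hγ⟩ :=
    exists_isMIntegralCurveAt_of_contMDiffAt_boundaryless 0 (hv.contMDiffAt (x := 1))
  obtain ⟨ε, hε, hγ⟩ := isMIntegralCurveAt_iff'.mp hγ
  rw [Real.ball_eq_Ioo, zero_sub, zero_add] at hγ
  refine exists_isMIntegralCurve_of_isMIntegralCurveOn hv hε (fun x => ?_) 1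
  refine ⟨fun t => x * γ t, by simp [hγ0], fun t ht => ?_⟩
  have key := (md x (γ t)).hasMFDerivAt.comp_hasMFDerivWithinAt t (hγ t ht)
  have e : mfderiv 𝓘(ℝ, E) 𝓘(ℝ, E) (fun y : G => x * y) (γ t)
      (mulInvariantVectorField L (γ t)) = mulInvariantVectorField L (x * γ t) := by
    simp only [mulInvariantVectorField]
    have hc : (fun y : G => x * γ t * y) = (fun y => x * y) ∘ (fun y => γ t * y) := by
      ext y; simp [mul_assoc]
    rw [hc, mfderiv_comp (I' := 𝓘(ℝ, E)) (1 : G) (md _ _) (md _ _)]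
    have hz : ∀ z, z = γ t → ∀ w : E, (mfderiv 𝓘(ℝ, E) 𝓘(ℝ, E) (fun y : G => x * y) z w : E) =
        mfderiv 𝓘(ℝ, E) 𝓘(ℝ, E) (fun y : G => x * y) (γ t) w := by
      rintro _ rfl _; rfl
    exact (hz _ (mul_one _) _).symm
  have e' : (mfderiv 𝓘(ℝ, E) 𝓘(ℝ, E) (fun y : G => x * y) (γ t)).comp
      ((1 : ℝ →L[ℝ] ℝ).smulRight (mulInvariantVectorField L (γ t))) =
      (1 : ℝ →L[ℝ] ℝ).smulRight (mulInvariantVectorField L (x * γ t) : E) := by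
    rw [← e]
    refine ContinuousLinearMap.ext fun c => ?_
    exact ((mfderiv 𝓘(ℝ, E) 𝓘(ℝ, E) (fun y : G => x * y) (γ t)).map_smul _ _)
  exact e' ▸ key

/-- `lieExp L s` is `exp (s L)`: the value at time `s` of the integral curve through the identity
of the left-invariant vector field generated by the Lie algebra element `L`. -/
def lieExp [FiniteDimensional ℝ E] [LieGroup 𝓘(ℝ, E) ∞ G] [T2Space G]
    (L : GroupLieAlgebra 𝓘(ℝ, E) G) : ℝ → G :=
  Classical.choose (exists_expCurve L)

/-! ### Left-invariant tensors and their coordinate expressions -/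

/-- The left-invariant tensor field of type `(0,2)` on `G` that equals `B` at the identity:
`(u, w) ↦ B (dL u) (dL w)` for `u, w` tangent at `h`, where `dL` is the differential at `h` of left
multiplication by `h⁻¹`. -/
def leftInvariantForm (B : LinearMap.BilinForm ℝ (GroupLieAlgebra 𝓘(ℝ, E) G)) (h : G)
    (u w : TangentSpace 𝓘(ℝ, E) h) : ℝ :=
  B (mfderiv 𝓘(ℝ, E) 𝓘(ℝ, E) (fun x : G => h⁻¹ * x) h u : E)
    (mfderiv 𝓘(ℝ, E) 𝓘(ℝ, E) (fun x : G => h⁻¹ * x) h w : E)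

/-- The components of the left-invariant tensor field generated by `B` in the chart of `G` at `q`:
the value at the point with coordinates `y`, on the vectors with components `u` and `w`. -/
def coordForm (B : LinearMap.BilinForm ℝ (GroupLieAlgebra 𝓘(ℝ, E) G)) (q : G)
    (y u w : E) : ℝ :=
  leftInvariantForm B ((extChartAt 𝓘(ℝ, E) q).symm y)
    (mfderiv 𝓘(ℝ, E) 𝓘(ℝ, E) (extChartAt 𝓘(ℝ, E) q).symm y u)
    (mfderiv 𝓘(ℝ, E) 𝓘(ℝ, E) (extChartAt 𝓘(ℝ, E) q).symm y w)

/-- The partial derivative `∂_z` at `y` of the components `B(u, w)` in the chart at `q`. -/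
def coordFormDeriv (B : LinearMap.BilinForm ℝ (GroupLieAlgebra 𝓘(ℝ, E) G)) (q : G)
    (y z u w : E) : ℝ :=
  fderiv ℝ (fun y' => coordForm B q y' u w) y z

/-- Raising an index: the vector `a` with `b(a, z) = f(z)` for all `z`
(unique when `b` is a positive definite bilinear form). -/
def raise (b : E → E → ℝ) (f : E → ℝ) : E :=
  Classical.epsilon fun a => ∀ z, b a z = f z

/-- The Christoffel symbols `Γ^A_{BC} u^B w^C` of the left-invariant metric `g` in the chart at
`q`, at the point with coordinates `y`:
`Γ^A_{BC} = 1/2 g^{AD} (∂_B g_{CD} + ∂_C g_{BD} - ∂_D g_{BC})`. -/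
def christoffel (g : LinearMap.BilinForm ℝ (GroupLieAlgebra 𝓘(ℝ, E) G)) (q : G)
    (y u w : E) : E :=
  raise (coordForm g q y) fun z =>
    1 / 2 * (coordFormDeriv g q y u w z + coordFormDeriv g q y w u z - coordFormDeriv g q y z u w)

/-- The torsion `Q^A_{BC} u^B w^C` with torsion potential the left-invariant two-form `p`:
`Q^A_{BC} = 3/2 g^{AD} ∂_{[D} p_{BC]} = 1/2 g^{AD} (∂_D p_{BC} + ∂_B p_{CD} + ∂_C p_{DB})`. -/
def torsion (g p : LinearMap.BilinForm ℝ (GroupLieAlgebra 𝓘(ℝ, E) G)) (q : G)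
    (y u w : E) : E :=
  raise (coordForm g q y) fun z =>
    1 / 2 * (coordFormDeriv p q y z u w + coordFormDeriv p q y u w z + coordFormDeriv p q y w z u)

/-- The connection coefficients with torsion, `Γ + Q`. -/
def torsionConnection (g p : LinearMap.BilinForm ℝ (GroupLieAlgebra 𝓘(ℝ, E) G)) (q : G)
    (y u w : E) : E :=
  christoffel g q y u w + torsion g p q y u w

end Group

/-! ### Minkowski space with Cartesian coordinates `(x, y, t)` -/

/-- The coordinate vectors `∂_x, ∂_y, ∂_t`. -/
def coordVec : Fin 3 → ℝ × ℝ × ℝ := ![(1, 0, 0), (0, 1, 0), (0, 0, 1)]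

/-- The (inverse) Minkowski metric `η = diag(1, 1, -1)` in the coordinates `(x, y, t)`. -/
def minkowski : Matrix (Fin 3) (Fin 3) ℝ := Matrix.diagonal ![1, 1, -1]

/-- The totally antisymmetric volume tensor, normalized by `ε^{xyt} = 1`. -/
def volTensor (i j k : Fin 3) : ℝ :=
  ((j : ℝ) - (i : ℝ)) * ((k : ℝ) - (i : ℝ)) * ((k : ℝ) - (j : ℝ)) / 2

/-- The partial derivative `∂_μ`. -/
def partialD {F : Type*} [NormedAddCommGroup F] [NormedSpace ℝ F] (μ : Fin 3)
    (f : ℝ × ℝ × ℝ → F) (m : ℝ × ℝ × ℝ) : F :=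
  fderiv ℝ f m (coordVec μ)

/-! ### Wave maps -/

section WaveMap

variable {E : Type*} [NormedAddCommGroup E] [NormedSpace ℝ E]
variable {G : Type*} [TopologicalSpace G] [ChartedSpace E G] [Group G]

/-- The torsion wave map equation
`η^{μν} ∂_μ ∂_ν ψ^A + (Γ + Q)^A_{BC}(ψ) ∂_μ ψ^B ∂_ν ψ^C (η^{μν} + λ ε^{μνσ} v_σ) = 0`
for a map `Ψ` from Minkowski space to `G`, written at each point `m` in the chart of `G` at `Ψ m`
(the left-hand side transforms as a vector, so that the choice of the chart is irrelevant). -/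
def IsTorsionWaveMap (g p : LinearMap.BilinForm ℝ (GroupLieAlgebra 𝓘(ℝ, E) G)) (lam : ℝ)
    (v : Fin 3 → ℝ) (Ψ : ℝ × ℝ × ℝ → G) : Prop :=
  ∀ m : ℝ × ℝ × ℝ,
    let ψ : ℝ × ℝ × ℝ → E := fun m' => extChartAt 𝓘(ℝ, E) (Ψ m) (Ψ m')
    (∑ μ, ∑ ν, minkowski μ ν • partialD μ (partialD ν ψ) m) +
      (∑ μ, ∑ ν, (minkowski μ ν + lam * ∑ σ, volTensor μ ν σ * v σ) •
        torsionConnection g p (Ψ m) (ψ m) (partialD μ ψ m) (partialD ν ψ m)) = 0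

/-- Left-translation equivariance: `Ψ(x, y + s, t) = exp(s L) Ψ(x, y, t)`. -/
def LeftEquivariant [FiniteDimensional ℝ E] [LieGroup 𝓘(ℝ, E) ∞ G] [T2Space G]
    (L : GroupLieAlgebra 𝓘(ℝ, E) G) (Ψ : ℝ × ℝ × ℝ → G) : Prop :=
  ∀ x y t s : ℝ, Ψ (x, y + s, t) = lieExp L s * Ψ (x, y, t)

/-- Initial data on `ℝ` are a map `D` into `TG`: the base point of `D x` is the initial position
and its fibre component is the initial velocity. They have compact support if, outside a compact
interval, the position is constant on each of the two ends and the velocity vanishes. -/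
def CompactSupportData (D : ℝ → TangentBundle 𝓘(ℝ, E) G) : Prop :=
  ∃ (r : ℝ) (a b : G), (∀ x < -r, D x = ⟨a, 0⟩) ∧ (∀ x > r, D x = ⟨b, 0⟩)

/-- `Ψ` is a smooth global left-translation equivariant torsion wave map which at `t = t₀`
(on the line `y = 0`) has the position and the velocity prescribed by `D`. -/
structure IsGlobalSolution [FiniteDimensional ℝ E] [LieGroup 𝓘(ℝ, E) ∞ G] [T2Space G]
    (g p : LinearMap.BilinForm ℝ (GroupLieAlgebra 𝓘(ℝ, E) G)) (lam : ℝ) (v : Fin 3 → ℝ)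
    (L : GroupLieAlgebra 𝓘(ℝ, E) G) (t₀ : ℝ) (D : ℝ → TangentBundle 𝓘(ℝ, E) G)
    (Ψ : ℝ × ℝ × ℝ → G) : Prop where
  smooth : ContMDiff 𝓘(ℝ, ℝ × ℝ × ℝ) 𝓘(ℝ, E) ∞ Ψ
  equivariant : LeftEquivariant L Ψ
  waveMap : IsTorsionWaveMap g p lam v Ψ
  initial : ∀ x : ℝ,
    (⟨Ψ (x, 0, t₀), mfderiv 𝓘(ℝ, ℝ) 𝓘(ℝ, E) (fun t : ℝ => Ψ (x, 0, t)) t₀ (1 : ℝ)⟩ :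
      TangentBundle 𝓘(ℝ, E) G) = D x

end WaveMap

end LieWaveMap

end

/-! A map into `G` is encoded by its left logarithmic derivative `Ψ⁻¹ dΨ` (`logD`), whose components
t, x, y take values in the Lie algebra. In the left-invariant frame g and p have constant
coefficients, so the wave map equation becomes ∂_t t = ∂_x x + ∂_y y + quadratic terms
(`isTorsionWaveMap_iff`), and the Maurer–Cartan equation gives the integrability conditions.
Equivariance makes the components independent of the coordinate y. Hence t + x, t - x and y satisfy
a diagonal semilinear hyperbolic system in one space dimension with speeds ±1 and 0 and the
quadratic right-hand side `FrameData.nonlin`.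

For a globally Lipschitz right-hand side, integration along characteristics is a Volterra equation
on each triangle of dependence, solved by Picard iteration (`existsUnique_volterra`). All triangles
are rescaled to a fixed one, and the implicit function theorem in its space of continuous functions
gives smoothness (`contDiff_mildSol`). Truncation and a continuity argument then reduce global
existence to an a priori bound (`exists_solution_of_bound`).

The bound has two stages. The energy density e and the flux f satisfy ∂_t e = ∂_x f, and the
smallness of the coupling makes e + f nonnegative and lets e - f control |y|² + |t - x|². So the
flux through the right edge of a triangle is at most the energy of its base. On that edge y obeys
the linear equation y' = -[t - x, y], and the integral of |t - x|² there is controlled by the flux;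
this bounds y at the tip (`orbit_component_le`). Next, in the evolution of |t + x|² and |t - x|² the
terms built from t and x alone cancel (`force_add`, `force_sub`), so once y is bounded the growth is
at most quadratic, and a maximum principle gives an exponential bound (`char_component_le`).
Negative times are handled by the reflection u(m) ↦ -u(-m).

To return to the group, families of curves with prescribed logarithmic derivative are constructed
globally (`exists_logD_time_eq`) and are determined by one value (`eqOn_of_logD_eq`). Integrating t
in time from the initial curve gives a map whose remaining components satisfy the same linear
equations in time as those of the reduced solution, hence agree with them
(`existsUnique_globalSolution`). Periodicity in the circle case is a consequence of uniqueness
(`IsGlobalSolution.translate`). -/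

open scoped Manifold ContDiff

noncomputable section

namespace LieWaveMap

open Set Filter Topology

section

/-! ### Composition operators on spaces of continuous functions -/

section Nemytskii

universe u v

variable {K : Type*} [TopologicalSpace K] [CompactSpace K]

/-- The pointwise application of a continuous family of linear maps. -/
def pointwiseApply {F F' : Type*} [NormedAddCommGroup F] [NormedSpace ℝ F]
    [NormedAddCommGroup F'] [NormedSpace ℝ F'] :
    C(K, F →L[ℝ] F') →L[ℝ] C(K, F) →L[ℝ] C(K, F') :=
  LinearMap.mkContinuous₂
    (LinearMap.mk₂ ℝ (fun (M : C(K, F →L[ℝ] F')) (h : C(K, F)) =>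
        (⟨fun z => M z (h z), by fun_prop⟩ : C(K, F')))
      (fun _ _ _ => by ext; simp) (fun _ _ _ => by ext; simp)
      (fun _ _ _ => by ext; simp) (fun _ _ _ => by ext; simp)) 1 (fun M h => by
    rw [ContinuousMap.norm_le _ (by positivity)]
    intro z
    rw [one_mul]
    exact ((M z).le_opNorm _).trans
      (mul_le_mul (M.norm_coe_le_norm z) (h.norm_coe_le_norm z) (norm_nonneg _)
        ((norm_nonneg _).trans (M.norm_coe_le_norm z))))

@[simp]
theorem pointwiseApply_apply {F F' : Type*} [NormedAddCommGroup F] [NormedSpace ℝ F]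
    [NormedAddCommGroup F'] [NormedSpace ℝ F'] (M : C(K, F →L[ℝ] F')) (h : C(K, F)) (z : K) :
    pointwiseApply M h z = M z (h z) := rfl

/-- The mean value inequality is applied on the segment from `U z` to `W z` for each `z`. The
modulus is uniform in `z` because V ↦ `f'` ∘ V is continuous in the supremum norm, `K` being
compact; no compactness in `F` is needed. -/
theorem hasFDerivAt_postcomp {F F' : Type*} [NormedAddCommGroup F] [NormedSpace ℝ F]
    [NormedAddCommGroup F'] [NormedSpace ℝ F'] (f : C(F, F')) (f' : C(F, F →L[ℝ] F'))
    (hf : ∀ x, HasFDerivAt f (f' x) x) (U : C(K, F)) :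
    HasFDerivAt (fun U : C(K, F) => f.comp U) (pointwiseApply (f'.comp U)) U := by
  rw [hasFDerivAt_iff_isLittleO, Asymptotics.isLittleO_iff]
  intro ε hε
  have hc : Continuous fun U : C(K, F) => f'.comp U := ContinuousMap.continuous_postcomp f'
  obtain ⟨δ, hδ, h⟩ := (Metric.continuousAt_iff (f := fun U : C(K, F) => f'.comp U) (a := U)).1
    hc.continuousAt ε hε
  filter_upwards [Metric.ball_mem_nhds U hδ] with W hW
  rw [ContinuousMap.norm_le _ (by positivity)]
  intro z
  have key : ∀ y ∈ segment ℝ (U z) (W z), ‖f' y - f' (U z)‖ ≤ ε := by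
    intro y hy
    rw [segment_eq_image'] at hy
    obtain ⟨s, hs, rfl⟩ := hy
    have hd : dist (U + s • (W - U)) U < δ := by
      rw [dist_eq_norm, add_sub_cancel_left, norm_smul, Real.norm_of_nonneg hs.1]
      rw [Metric.mem_ball, dist_eq_norm] at hW
      exact (mul_le_of_le_one_left (norm_nonneg _) hs.2).trans_lt hW
    have h2 : dist (f' (U z + s • (W z - U z))) (f' (U z)) ≤ ε :=
      (ContinuousMap.dist_apply_le_dist z).trans (h hd).le
    rwa [dist_eq_norm] at h2
  have := (convex_segment (𝕜 := ℝ) (U z) (W z)).norm_image_sub_le_of_norm_hasFDerivWithin_le'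
    (f := f) (f' := fun y => f' y) (fun y _ => (hf y).hasFDerivWithinAt) key
    (left_mem_segment ℝ _ _) (right_mem_segment ℝ _ _)
  exact this.trans (mul_le_mul_of_nonneg_left ((W - U).norm_coe_le_norm z) hε.le)

/-- The derivative of a composition operator is again one, with `fderiv ℝ f` in place of `f`,
followed by the bounded operator `pointwiseApply`; this drives the induction. The target lives in
universe `max u v` so that `F →L[ℝ] F'` stays in the range of the induction hypothesis. -/
theorem contDiff_postcomp_nat {F : Type u} [NormedAddCommGroup F] [NormedSpace ℝ F] (n : ℕ) :
    ∀ {F' : Type (max u v)} [NormedAddCommGroup F'] [NormedSpace ℝ F'] (f : C(F, F')),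
      ContDiff ℝ n f → ContDiff ℝ n (fun U : C(K, F) => f.comp U) := by
  induction n with
  | zero =>
    intro F' _ _ f _
    exact contDiff_zero.2 (ContinuousMap.continuous_postcomp f)
  | succ n ih =>
    intro F' _ _ f hf
    have h1 : ContDiff ℝ ((n : ℕ∞ω) + 1) f := by exact_mod_cast hf
    obtain ⟨hd, -, hf'⟩ := contDiff_succ_iff_fderiv.1 h1
    let f' : C(F, F →L[ℝ] F') := ⟨fderiv ℝ f, hf'.continuous⟩
    have H := fun U : C(K, F) => hasFDerivAt_postcomp f f' (fun x => (hd x).hasFDerivAt) U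
    have : ContDiff ℝ ((n : ℕ∞ω) + 1) (fun U : C(K, F) => f.comp U) := by
      refine contDiff_succ_iff_fderiv.2 ⟨fun U => (H U).differentiableAt, by simp, ?_⟩
      have e : fderiv ℝ (fun U : C(K, F) => f.comp U) = fun U => pointwiseApply (f'.comp U) := by
        ext1 U; exact (H U).fderiv
      rw [e]
      exact pointwiseApply.contDiff.comp (ih f' hf')
    exact_mod_cast this

theorem contDiff_postcomp {F : Type u} [NormedAddCommGroup F] [NormedSpace ℝ F]
    {F' : Type (max u v)} [NormedAddCommGroup F'] [NormedSpace ℝ F'] (f : C(F, F'))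
    (hf : ContDiff ℝ ∞ f) : ContDiff ℝ ∞ (fun U : C(K, F) => f.comp U) :=
  contDiff_infty.2 fun n => contDiff_postcomp_nat.{u, v} n f (contDiff_infty.1 hf n)

end Nemytskii

/-! ### Integration along characteristics of the unit triangle -/

section Characteristics

/-- The triangle with base `[-1, 1] × {0}` and tip `(0, 1)`. -/
abbrev Tri : Type := {z : ℝ × ℝ // 0 ≤ z.2 ∧ |z.1| ≤ 1 - z.2}

instance : CompactSpace Tri := by
  refine isCompact_iff_compactSpace.1 (Metric.isCompact_of_isClosed_isBounded ?_ ?_)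
  · exact (isClosed_le continuous_const continuous_snd).inter
      (isClosed_le continuous_fst.abs (continuous_const.sub continuous_snd))
  · refine (Metric.isBounded_Icc ((-1, 0) : ℝ × ℝ) (1, 1)).subset ?_
    rintro ⟨a, b⟩ ⟨h1, h2⟩
    have := abs_le.1 h2
    have := abs_nonneg a
    exact ⟨⟨by simp only at *; linarith, h1⟩, ⟨by simp only at *; linarith, by simp only at *; linarith⟩⟩

theorem Tri.snd_le_one (z : Tri) : z.1.2 ≤ 1 := by
  have := z.2.2; have := abs_nonneg z.1.1; linarith

/-- The tip of the unit triangle. -/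
def tip : Tri := ⟨(0, 1), by norm_num⟩

/-- The point at time `s * z.2` on the characteristic of speed `-c` through `z`. -/
def charPt (c : ℝ) (hc : |c| ≤ 1) (z : Tri) (s : unitInterval) : Tri :=
  ⟨(z.1.1 + c * z.1.2 * (1 - s), z.1.2 * s), mul_nonneg z.2.1 s.2.1, by
    have h1 := z.2.2
    have h2 := z.2.1
    have h3 : |c * z.1.2 * (1 - s)| ≤ z.1.2 * (1 - s) := by
      rw [abs_mul, abs_mul, abs_of_nonneg h2, abs_of_nonneg (sub_nonneg.2 s.2.2)]
      exact mul_le_mul_of_nonneg_right (mul_le_of_le_one_left h2 hc) (sub_nonneg.2 s.2.2)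
    have h4 := abs_add_le z.1.1 (c * z.1.2 * (1 - s))
    dsimp only
    linarith⟩

theorem continuous_charPt (c : ℝ) (hc : |c| ≤ 1) :
    Continuous fun q : Tri × unitInterval => charPt c hc q.1 q.2 := by
  unfold charPt
  fun_prop

variable {ι : Type*} {E : Type*} [NormedAddCommGroup E]
variable (c : ι → ℝ) (hc : ∀ i, |c i| ≤ 1)

theorem continuous_charIntegrand (w : C(Tri, ι → E)) (i : ι) :
    Continuous fun q : Tri × ℝ => w (charPt (c i) (hc i) q.1 (projIcc 0 1 zero_le_one q.2)) i := by
  have h1 : Continuous fun q : Tri × ℝ =>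
      charPt (c i) (hc i) q.1 (projIcc (0 : ℝ) 1 zero_le_one q.2) :=
    (continuous_charPt (c i) (hc i)).comp
      (g := fun q : Tri × unitInterval => charPt (c i) (hc i) q.1 q.2)
      (f := fun q : Tri × ℝ => (q.1, projIcc (0 : ℝ) 1 zero_le_one q.2))
      (continuous_fst.prodMk ((continuous_projIcc (h := zero_le_one)).comp continuous_snd))
  exact (continuous_apply i).comp (w.continuous.comp h1)

theorem intervalIntegrable_charIntegrand (w : C(Tri, ι → E)) (i : ι) (z : Tri) (a b : ℝ) :
    IntervalIntegrable (fun s => w (charPt (c i) (hc i) z (projIcc 0 1 zero_le_one s)) i)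
      MeasureTheory.volume a b :=
  ((continuous_charIntegrand c hc w i).comp (Continuous.prodMk_right z)).intervalIntegrable a b

variable [Fintype ι] [NormedSpace ℝ E]

/-- Integration along the characteristics, as a function on the triangle. -/
def charIntegralFun (w : C(Tri, ι → E)) : C(Tri, ι → E) where
  toFun z i := z.1.2 • ∫ s in (0 : ℝ)..1, w (charPt (c i) (hc i) z (projIcc 0 1 zero_le_one s)) i
  continuous_toFun := by
    refine continuous_pi fun i => (by fun_prop : Continuous fun z : Tri => z.1.2).smul ?_
    exact intervalIntegral.continuous_parametric_intervalIntegral_of_continuous'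
      (continuous_charIntegrand c hc w i) 0 1

/-- The point with parameter `s` on a characteristic has height `z.1.2 * s`, so each integration
gains one power of the height and a factor 1/(n+1). This is the source of the factorial in the
Picard iteration. -/
theorem norm_charIntegralFun_le {w : C(Tri, ι → E)} {C : ℝ} (hC : 0 ≤ C) {n : ℕ}
    (h : ∀ z, ‖w z‖ ≤ C * z.1.2 ^ n) (z : Tri) :
    ‖charIntegralFun c hc w z‖ ≤ C / (n + 1) * z.1.2 ^ (n + 1) := by
  have hz := z.2.1
  refine (pi_norm_le_iff_of_nonneg (by positivity)).2 fun i => ?_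
  have h1 : ‖∫ s in (0 : ℝ)..1, w (charPt (c i) (hc i) z (projIcc 0 1 zero_le_one s)) i‖ ≤
      ∫ s in (0 : ℝ)..1, C * z.1.2 ^ n * s ^ n := by
    refine intervalIntegral.norm_integral_le_of_norm_le zero_le_one
      (Filter.Eventually.of_forall fun s hs => ?_) (Continuous.intervalIntegrable (by fun_prop) _ _)
    refine (norm_le_pi_norm _ i).trans ((h _).trans (le_of_eq ?_))
    rw [projIcc_of_mem zero_le_one (Ioc_subset_Icc_self hs)]
    simp only [charPt]
    rw [mul_pow]; ring
  rw [intervalIntegral.integral_const_mul, integral_pow] at h1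
  change ‖z.1.2 • ∫ s in (0 : ℝ)..1,
    w (charPt (c i) (hc i) z (projIcc 0 1 zero_le_one s)) i‖ ≤ _
  rw [norm_smul, Real.norm_of_nonneg hz]
  calc _ ≤ z.1.2 * (C * z.1.2 ^ n * ((1 ^ (n + 1) - 0 ^ (n + 1)) / (n + 1))) :=
        mul_le_mul_of_nonneg_left h1 hz
    _ = _ := by rw [one_pow, zero_pow n.succ_ne_zero]; ring

/-- Integration along the characteristics, as an operator. -/
def charIntegral : C(Tri, ι → E) →L[ℝ] C(Tri, ι → E) :=
  LinearMap.mkContinuous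
    { toFun := charIntegralFun c hc
      map_add' := fun w w' => by
        ext z i
        simp only [charIntegralFun, ContinuousMap.coe_mk, ContinuousMap.add_apply, Pi.add_apply]
        rw [intervalIntegral.integral_add (intervalIntegrable_charIntegrand c hc w i z 0 1)
          (intervalIntegrable_charIntegrand c hc w' i z 0 1), smul_add]
      map_smul' := fun r w => by
        ext z i
        simp only [charIntegralFun, ContinuousMap.coe_mk, ContinuousMap.smul_apply, Pi.smul_apply,
          RingHom.id_apply]
        rw [intervalIntegral.integral_smul, smul_comm] } 1 (fun w => by
    rw [one_mul, ContinuousMap.norm_le _ (norm_nonneg _)]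
    intro z
    refine (norm_charIntegralFun_le c hc (norm_nonneg w) (n := 0)
      (fun z => by simpa using w.norm_coe_le_norm z) z).trans ?_
    simpa using mul_le_of_le_one_right (norm_nonneg w) z.snd_le_one)

theorem charIntegral_apply (w : C(Tri, ι → E)) (z : Tri) (i : ι) :
    charIntegral c hc w z i =
      z.1.2 • ∫ s in (0 : ℝ)..1, w (charPt (c i) (hc i) z (projIcc 0 1 zero_le_one s)) i := rfl

theorem norm_charIntegral_le {w : C(Tri, ι → E)} {C : ℝ} (hC : 0 ≤ C) {n : ℕ}
    (h : ∀ z, ‖w z‖ ≤ C * z.1.2 ^ n) (z : Tri) :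
    ‖charIntegral c hc w z‖ ≤ C / (n + 1) * z.1.2 ^ (n + 1) :=
  norm_charIntegralFun_le c hc hC h z

/-- Nonlinear Volterra equations along the characteristics are uniquely solvable. -/
theorem existsUnique_volterra [CompleteSpace E] (N : C(Tri, ι → E) → C(Tri, ι → E)) {l : ℝ}
    (hl : 0 ≤ l) (hN : ∀ U U' z, ‖N U z - N U' z‖ ≤ l * ‖U z - U' z‖) (W : C(Tri, ι → E)) (T : ℝ) :
    ∃! U, U = W + T • charIntegral c hc (N U) := by
  set Φ : C(Tri, ι → E) → C(Tri, ι → E) := fun U => W + T • charIntegral c hc (N U) with hΦ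
  -- The n-th iterate has Lipschitz constant (|T| l)ⁿ/n!, so some iterate is a contraction for every
  -- `T`, with no restriction to short times.
  have step : ∀ (n : ℕ) (U U' : C(Tri, ι → E)) (z : Tri),
      ‖Φ^[n] U z - Φ^[n] U' z‖ ≤ (‖U - U'‖ * (|T| * l) ^ n / n.factorial) * z.1.2 ^ n := by
    intro n
    induction n with
    | zero => intro U U' z; simpa using (U - U').norm_coe_le_norm z
    | succ n ih =>
      intro U U' z
      rw [Function.iterate_succ_apply', Function.iterate_succ_apply']
      have e : Φ (Φ^[n] U) z - Φ (Φ^[n] U') z =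
          T • charIntegral c hc (N (Φ^[n] U) - N (Φ^[n] U')) z := by
        rw [map_sub]
        simp only [hΦ, ContinuousMap.add_apply, ContinuousMap.smul_apply, ContinuousMap.sub_apply,
          smul_sub]
        abel
      rw [e, norm_smul, Real.norm_eq_abs]
      have h1 := norm_charIntegral_le c hc
        (w := N (Φ^[n] U) - N (Φ^[n] U'))
        (C := l * (‖U - U'‖ * (|T| * l) ^ n / n.factorial)) (by positivity) (n := n) (fun z => by
          rw [mul_assoc]
          exact (hN _ _ z).trans (mul_le_mul_of_nonneg_left (ih U U' z) hl)) z
      refine (mul_le_mul_of_nonneg_left h1 (abs_nonneg T)).trans (le_of_eq ?_)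
      rw [Nat.factorial_succ]
      push_cast
      rw [pow_succ (|T| * l)]
      field_simp
  have hn : ∃ n : ℕ, (|T| * l) ^ n / n.factorial < 1 :=
    ((FloorSemiring.tendsto_pow_div_factorial_atTop (|T| * l)).eventually
      (gt_mem_nhds one_pos)).exists
  obtain ⟨n, hn⟩ := hn
  have hpos : 0 ≤ (|T| * l) ^ n / n.factorial := by positivity
  have hcontr : ContractingWith ⟨(|T| * l) ^ n / n.factorial, hpos⟩ (Φ^[n]) := by
    refine ⟨by exact_mod_cast hn, LipschitzWith.of_dist_le_mul fun U U' => ?_⟩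
    rw [dist_eq_norm, dist_eq_norm, ContinuousMap.norm_le _ (by positivity)]
    intro z
    refine (step n U U' z).trans ?_
    have h1 : z.1.2 ^ n ≤ 1 := pow_le_one₀ z.2.1 z.snd_le_one
    refine (mul_le_of_le_one_right (by positivity) h1).trans (le_of_eq ?_)
    change _ = (|T| * l) ^ n / n.factorial * ‖U - U'‖
    ring
  -- The unique fixed point of an iterate is fixed by `Φ`, and a fixed point of `Φ` is fixed by its
  -- iterates.
  refine ⟨ContractingWith.fixedPoint (Φ^[n]) hcontr,
    (hcontr.isFixedPt_fixedPoint_iterate).symm, fun U hU => ?_⟩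
  have hU' : Function.IsFixedPt Φ U := hU.symm
  exact hcontr.fixedPoint_unique (hU'.iterate n)

/-- The linear Volterra operator `1 - T J M` is invertible. -/
theorem isInvertible_volterra [CompleteSpace E] (M : C(Tri, (ι → E) →L[ℝ] (ι → E))) (T : ℝ) :
    (ContinuousLinearMap.id ℝ _ - T • (charIntegral c hc).comp (pointwiseApply M)).IsInvertible := by
  have key := fun W => existsUnique_volterra c hc (fun U => pointwiseApply M U) (norm_nonneg M)
    (fun U U' z => by
      rw [pointwiseApply_apply, pointwiseApply_apply, ← map_sub]
      exact ((M z).le_opNorm _).trans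
        (mul_le_mul_of_nonneg_right (M.norm_coe_le_norm z) (norm_nonneg _))) W T
  set A : C(Tri, ι → E) →L[ℝ] C(Tri, ι → E) :=
    ContinuousLinearMap.id ℝ _ - T • (charIntegral c hc).comp (pointwiseApply M)
  have hA : ∀ U W, A U = W ↔ U = W + T • charIntegral c hc (pointwiseApply M U) := by
    intro U W
    exact sub_eq_iff_eq_add
  have hinj : A.ker = ⊥ := by
    rw [LinearMap.ker_eq_bot]
    intro U U' h
    exact (key (A U')).unique ((hA _ _).1 h) ((hA _ _).1 rfl)
  have hsurj : A.range = ⊤ := by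
    rw [LinearMap.range_eq_top]
    intro W
    obtain ⟨U, hU, -⟩ := key W
    exact ⟨U, (hA _ _).2 hU⟩
  exact ⟨ContinuousLinearEquiv.ofBijective A hinj hsurj, by ext1 U; rfl⟩

end Characteristics

end

section

/-! ### Semilinear hyperbolic systems in one space dimension -/

section Semilinear

/-- The affine image of the unit triangle with tip `p` and base on the line `t = 0`. -/
def Tri.aff (p : ℝ × ℝ) (z : Tri) : ℝ × ℝ := (p.1 + p.2 * z.1.1, p.2 * z.1.2)

theorem Tri.aff_tip (p : ℝ × ℝ) : Tri.aff p tip = p := by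
  ext <;> simp [Tri.aff, tip]

theorem Tri.continuous_aff (p : ℝ × ℝ) : Continuous (Tri.aff p) := by
  unfold Tri.aff; fun_prop

/-- The homothety of the unit triangle onto the triangle with tip `z`. -/
def Tri.sub (z z' : Tri) : Tri :=
  ⟨(z.1.1 + z.1.2 * z'.1.1, z.1.2 * z'.1.2), mul_nonneg z.2.1 z'.2.1, by
    have h1 := z.2.2
    have h2 := z.2.1
    have h3 : |z.1.2 * z'.1.1| ≤ z.1.2 * (1 - z'.1.2) := by
      rw [abs_mul, abs_of_nonneg h2]
      exact mul_le_mul_of_nonneg_left z'.2.2 h2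
    have h4 := abs_add_le z.1.1 (z.1.2 * z'.1.1)
    dsimp only
    linarith⟩

theorem Tri.aff_sub (p : ℝ × ℝ) (z z' : Tri) :
    Tri.aff p (Tri.sub z z') = Tri.aff (Tri.aff p z) z' := by
  ext <;> simp only [Tri.aff, Tri.sub] <;> ring

theorem Tri.continuous_sub (z : Tri) : Continuous (Tri.sub z) := by
  unfold Tri.sub; fun_prop

theorem Tri.sub_tip (z : Tri) : Tri.sub z tip = z := by
  ext <;> simp [Tri.sub, tip]

theorem Tri.sub_charPt (c : ℝ) (hc : |c| ≤ 1) (z z' : Tri) (s : unitInterval) :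
    Tri.sub z (charPt c hc z' s) = charPt c hc (Tri.sub z z') s := by
  ext <;> simp only [charPt, Tri.sub] <;> ring

theorem Tri.abs_aff_le {p : ℝ × ℝ} {r : ℝ} (h : |p.1| + |p.2| ≤ r) (z : Tri) :
    |(Tri.aff p z).1| + |(Tri.aff p z).2| ≤ r := by
  have h1 := z.2.2
  have h2 := z.2.1
  simp only [Tri.aff]
  have h3 := abs_add_le p.1 (p.2 * z.1.1)
  rw [abs_mul] at h3
  rw [abs_mul, abs_of_nonneg h2]
  nlinarith [abs_nonneg p.2]

variable {ι : Type} {E : Type*} [NormedAddCommGroup E]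

/-- The points on the base line to which the characteristics lead. -/
def feet (c : ι → ℝ) (p : ℝ × ℝ) : C(Tri, ι → ℝ) :=
  p.1 • ⟨fun _ _ => 1, by fun_prop⟩ + p.2 • ⟨fun z i => z.1.1 + c i * z.1.2, by fun_prop⟩

theorem feet_apply (c : ι → ℝ) (p : ℝ × ℝ) (z : Tri) (i : ι) :
    feet c p z i = p.1 + p.2 * (z.1.1 + c i * z.1.2) := by
  simp [feet]

variable [Fintype ι] [NormedSpace ℝ E]

/-- The diagonal semilinear system `(∂_t - c_i ∂_x) u_i = N_i(u)` at the point `m`. -/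
def SolvesAt (c : ι → ℝ) (N : (ι → E) → ι → E) (u : ℝ × ℝ → ι → E) (m : ℝ × ℝ) : Prop :=
  ∀ i, fderiv ℝ u m (-c i, 1) i = N (u m) i

theorem contDiff_feet (c : ι → ℝ) : ContDiff ℝ ∞ (feet c) := by
  unfold feet
  fun_prop

/-- The contribution of the initial data to the mild form of the system. -/
def transported (a : C(ℝ, ι → E)) : C(ι → ℝ, ι → E) := ⟨fun r i => a (r i) i, by fun_prop⟩

variable (c : ι → ℝ) (hc : ∀ i, |c i| ≤ 1)

/-- The mild form of the system, on the triangle with tip `p`. -/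
def MildSol (N : C(ι → E, ι → E)) (a : C(ℝ, ι → E)) (p : ℝ × ℝ) (U : C(Tri, ι → E)) : Prop :=
  U = (transported a).comp (feet c p) + p.2 • charIntegral c hc (N.comp U)

/-- Homotheties map characteristics to characteristics, so restricting a mild solution to a smaller
triangle and rescaling again gives a mild solution. With uniqueness, the solutions on different
triangles become values of a single function of the tip. -/
theorem MildSol.sub {N : C(ι → E, ι → E)} {a : C(ℝ, ι → E)} {p : ℝ × ℝ} {U : C(Tri, ι → E)}
    (h : MildSol c hc N a p U) (z : Tri) :
    MildSol c hc N a (Tri.aff p z) (U.comp ⟨Tri.sub z, Tri.continuous_sub z⟩) := by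
  ext z' i
  have h1 := congrArg (fun W : C(Tri, ι → E) => W (Tri.sub z z') i) h
  simp only [ContinuousMap.add_apply, ContinuousMap.smul_apply, Pi.add_apply, Pi.smul_apply,
    ContinuousMap.comp_apply, charIntegral_apply, transported, ContinuousMap.coe_mk, feet_apply]
    at h1 ⊢
  rw [h1]
  simp only [Tri.sub_charPt]
  congr 1
  · refine congrArg (fun r => a r i) ?_
    simp only [Tri.aff, Tri.sub]
    ring
  · rw [smul_smul, smul_smul]
    congr 1
    simp only [Tri.aff, Tri.sub]
    ring

theorem existsUnique_mildSol [CompleteSpace E] {N : C(ι → E, ι → E)} {l : NNReal}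
    (hl : LipschitzWith l N) (a : C(ℝ, ι → E)) (p : ℝ × ℝ) : ∃! U, MildSol c hc N a p U :=
  existsUnique_volterra c hc (fun U => N.comp U) l.2
    (fun U U' z => by simpa [dist_eq_norm] using hl.dist_le_mul (U z) (U' z)) _ _

/-- A classical solution on a triangle is a mild solution. -/
theorem mildSol_of_solvesAt {N : C(ι → E, ι → E)} [CompleteSpace E] {u : ℝ × ℝ → ι → E}
    (hu : ContDiff ℝ ∞ u) {a : C(ℝ, ι → E)} (ha : ∀ x, u (x, 0) = a x) {p : ℝ × ℝ}
    (h : ∀ z, SolvesAt c N u (Tri.aff p z)) :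
    MildSol c hc N a p ⟨fun z => u (Tri.aff p z), hu.continuous.comp (Tri.continuous_aff p)⟩ := by
  ext z i
  simp only [ContinuousMap.add_apply, ContinuousMap.smul_apply, Pi.add_apply, Pi.smul_apply,
    ContinuousMap.comp_apply, charIntegral_apply, transported, ContinuousMap.coe_mk, feet_apply]
  -- `g` runs along the characteristic of the i-th component from its foot on the base to the given
  -- point; the mild equation is the fundamental theorem of calculus along it.
  set g : ℝ → ℝ × ℝ := fun s =>
    (p.1 + p.2 * (z.1.1 + c i * z.1.2 * (1 - s)), p.2 * (z.1.2 * s)) with hg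
  have hgd : ∀ s, HasDerivAt g ((p.2 * z.1.2) • ((-c i, 1) : ℝ × ℝ)) s := by
    intro s
    have h1 : HasDerivAt (fun s : ℝ => p.1 + p.2 * (z.1.1 + c i * z.1.2 * (1 - s)))
        (p.2 * (c i * z.1.2 * (-1))) s :=
      (((((hasDerivAt_id s).const_sub 1).const_mul (c i * z.1.2)).const_add z.1.1).const_mul
        p.2).const_add p.1
    have h2 : HasDerivAt (fun s : ℝ => p.2 * (z.1.2 * s)) (p.2 * (z.1.2 * 1)) s :=
      (((hasDerivAt_id s).const_mul z.1.2).const_mul p.2)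
    convert h1.prodMk h2 using 1
    ext
    · simp; ring
    · simp
  have hud : ∀ s, HasDerivAt (fun s => u (g s) i)
      (fderiv ℝ u (g s) ((p.2 * z.1.2) • ((-c i, 1) : ℝ × ℝ)) i) s := fun s =>
    hasDerivAt_pi.1 (((hu.differentiable (by simp)) (g s)).hasFDerivAt.comp_hasDerivAt s (hgd s)) i
  have hval : ∀ s (hs : s ∈ Icc (0 : ℝ) 1),
      g s = Tri.aff p (charPt (c i) (hc i) z (projIcc 0 1 zero_le_one s)) := by
    intro s hs
    rw [projIcc_of_mem zero_le_one hs]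
    rfl
  have hint := intervalIntegral.integral_eq_sub_of_hasDerivAt (a := 0) (b := 1)
    (fun s _ => hud s) (by
      refine Continuous.intervalIntegrable ?_ _ _
      have h1 : Continuous (fderiv ℝ u) := hu.continuous_fderiv (by simp)
      have h2 : Continuous g := by fun_prop
      fun_prop)
  have e : ∫ s in (0 : ℝ)..1, fderiv ℝ u (g s) ((p.2 * z.1.2) • ((-c i, 1) : ℝ × ℝ)) i =
      ∫ s in (0 : ℝ)..1, (p.2 * z.1.2) •
        N (u (Tri.aff p (charPt (c i) (hc i) z (projIcc 0 1 zero_le_one s)))) i := by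
    refine intervalIntegral.integral_congr fun s hs => ?_
    rw [uIcc_of_le zero_le_one] at hs
    simp only [map_smul, Pi.smul_apply]
    rw [hval s hs, h _ i]
  rw [e, intervalIntegral.integral_smul] at hint
  rw [smul_smul, hint]
  have e0 : g 0 = (p.1 + p.2 * (z.1.1 + c i * z.1.2), 0) := by simp [hg]
  have e1 : g 1 = Tri.aff p z := by simp [hg, Tri.aff]
  rw [e0, e1, ha]
  abel

/-- The solution of a globally Lipschitz system depends smoothly on the triangle. -/
theorem contDiff_mildSol {E : Type*} [NormedAddCommGroup E] [NormedSpace ℝ E] [CompleteSpace E]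
    {N : C(ι → E, ι → E)} {l : NNReal}
    (hl : LipschitzWith l N) (hN : ContDiff ℝ ∞ N) {a : C(ℝ, ι → E)} (ha : ContDiff ℝ ∞ a)
    {S : ℝ × ℝ → C(Tri, ι → E)} (hS : ∀ p, MildSol c hc N a p (S p)) : ContDiff ℝ ∞ S := by
  refine contDiff_iff_contDiffAt.2 fun p => ?_
  -- Mild solutions are the zeros of `f` in its second argument. Its partial derivative there is a
  -- linear Volterra operator, hence invertible, so the implicit function theorem applies at every
  -- `p`, including `p.2 = 0` and negative times.
  set f : (ℝ × ℝ) × C(Tri, ι → E) → C(Tri, ι → E) := fun q =>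
    q.2 - ((transported a).comp (feet c q.1) + q.1.2 • charIntegral c hc (N.comp q.2)) with hf
  have ht : ContDiff ℝ ∞ (transported a) := by
    refine contDiff_pi.2 fun i => ?_
    exact ContDiff.comp (g := fun x => a x i) (contDiff_pi.1 ha i)
      (by fun_prop : ContDiff ℝ ∞ fun r : ι → ℝ => r i)
  have hW : ContDiff ℝ ∞ fun p => (transported a).comp (feet c p) :=
    (contDiff_postcomp (K := Tri) (transported a) ht).comp (contDiff_feet c)
  have hNc : ContDiff ℝ ∞ fun U : C(Tri, ι → E) => N.comp U := contDiff_postcomp N hN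
  have hfs : ContDiff ℝ ∞ f := by
    refine contDiff_snd.sub ((hW.comp contDiff_fst).add
      ((contDiff_snd.comp contDiff_fst).smul ?_))
    exact (charIntegral (E := E) c hc).contDiff.comp (hNc.comp (contDiff_snd (E := ℝ × ℝ)))
  let N' : C(ι → E, (ι → E) →L[ℝ] (ι → E)) :=
    ⟨fderiv ℝ N, hN.continuous_fderiv (by simp)⟩
  have hfat : ContDiffAt ℝ ∞ f (p, S p) := hfs.contDiffAt
  have hinv : (fderiv ℝ f (p, S p) ∘L .inr ℝ (ℝ × ℝ) (C(Tri, ι → E))).IsInvertible := by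
    have h1 : HasFDerivAt (fun U => f (p, U))
        (fderiv ℝ f (p, S p) ∘L .inr ℝ (ℝ × ℝ) (C(Tri, ι → E))) (S p) :=
      ((hfs.differentiable (by simp)) (p, S p)).hasFDerivAt.comp (S p)
        (hasFDerivAt_prodMk_right p (S p))
    have h2 : HasFDerivAt (fun U => f (p, U)) (ContinuousLinearMap.id ℝ _ -
        p.2 • (charIntegral c hc).comp (pointwiseApply (N'.comp (S p)))) (S p) := by
      have h3 : HasFDerivAt (fun U : C(Tri, ι → E) => charIntegral c hc (N.comp U))
          ((charIntegral c hc).comp (pointwiseApply (N'.comp (S p)))) (S p) :=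
        HasFDerivAt.comp (g := charIntegral c hc) (S p)
          (charIntegral (E := E) c hc).hasFDerivAt (hasFDerivAt_postcomp N N'
          (fun x => ((hN.differentiable (by simp)) x).hasFDerivAt) (S p))
      exact (hasFDerivAt_id (S p)).sub ((h3.const_smul p.2).const_add
        ((transported a).comp (feet c p)))
    rw [h1.unique h2]
    exact isInvertible_volterra c hc _ _
  have hzero : f (p, S p) = 0 := sub_eq_zero.2 (hS p)
  -- The implicit function consists of mild solutions, so global uniqueness identifies it with `S`
  -- near `p`.
  refine (hfat.contDiffAt_implicitFunction (by simp) hinv).congr_of_eventuallyEq ?_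
  filter_upwards [hfat.eventually_apply_implicitFunction (by simp) hinv] with q hq
  rw [hzero] at hq
  exact (existsUnique_mildSol c hc hl a q).unique (hS q) (sub_eq_zero.1 hq)

/-- Globally Lipschitz smooth systems have global smooth solutions. -/
theorem exists_solution_of_lipschitz {E : Type*} [NormedAddCommGroup E] [NormedSpace ℝ E]
    [CompleteSpace E] (c : ι → ℝ) (hc : ∀ i, |c i| ≤ 1) {N : (ι → E) → ι → E} {l : NNReal}
    (hl : LipschitzWith l N) (hN : ContDiff ℝ ∞ N) {a : ℝ → ι → E} (ha : ContDiff ℝ ∞ a) :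
    ∃ u : ℝ × ℝ → ι → E, ContDiff ℝ ∞ u ∧ (∀ x, u (x, 0) = a x) ∧ ∀ m, SolvesAt c N u m := by
  let N₀ : C(ι → E, ι → E) := ⟨N, hN.continuous⟩
  let a₀ : C(ℝ, ι → E) := ⟨a, ha.continuous⟩
  choose S hS hSu using existsUnique_mildSol c hc (N := N₀) hl a₀
  have hSc : ContDiff ℝ ∞ S := contDiff_mildSol c hc hl hN ha hS
  -- The solution at `p` is the value at the tip of the mild solution on the triangle with tip `p`;
  -- evaluation is linear and continuous, so `u` inherits the smoothness of `S`.
  set u : ℝ × ℝ → ι → E := fun p => S p tip with hu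
  have hus : ContDiff ℝ ∞ u := 
    (ContinuousMap.evalCLM (M := ι → E) ℝ tip).contDiff.comp hSc
  have hSz : ∀ p z, S p z = u (Tri.aff p z) := by
    intro p z
    have := hSu _ _ ((hS p).sub c hc z)
    simp only [hu]
    rw [← this]
    simp [Tri.sub_tip]
  have heq : ∀ p i, u p i = a (p.1 + p.2 * c i) i +
      p.2 • ∫ s in (0 : ℝ)..1, N (u (p.1 + p.2 * (c i * (1 - s)), p.2 * s)) i := by
    intro p i
    have h1 := congrArg (fun W : C(Tri, ι → E) => W tip i) (hS p)
    simp only [ContinuousMap.add_apply, ContinuousMap.smul_apply, Pi.add_apply, Pi.smul_apply,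
      ContinuousMap.comp_apply, charIntegral_apply, transported, ContinuousMap.coe_mk,
      feet_apply] at h1
    simp only [hu]
    rw [h1]
    congr 1
    · simp [tip, a₀]
    · congr 1
      simp only [tip, one_smul]
      refine intervalIntegral.integral_congr fun s hs => ?_
      rw [uIcc_of_le zero_le_one] at hs
      simp only [projIcc_of_mem zero_le_one hs]
      change N (S p _) i = _
      rw [hSz]
      simp [Tri.aff, charPt, tip, hu]
  refine ⟨u, hus, fun x => ?_, fun m i => ?_⟩
  · ext i
    rw [heq]; simp
  -- `X` is the foot of the characteristic through `m`. On this line the mild equation is an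
  -- ordinary integral equation in time, which is then differentiated.
  · set X := m.1 + c i * m.2
    have hline : ∀ T : ℝ, HasDerivAt (fun T : ℝ => ((X - c i * T, T) : ℝ × ℝ)) (-c i, 1) T := by
      intro T
      refine HasDerivAt.prodMk ?_ (hasDerivAt_id T)
      simpa using ((hasDerivAt_id T).const_mul (c i)).const_sub X
    have hm : (X - c i * m.2, m.2) = m := by ext <;> simp [X]
    have h1 : HasDerivAt (fun T => u (X - c i * T, T) i) (fderiv ℝ u m (-c i, 1) i) m.2 := by
      have := HasFDerivAt.comp_hasDerivAt (f := fun T : ℝ => ((X - c i * T, T) : ℝ × ℝ)) m.2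
        ((hus.differentiable (by simp)) (X - c i * m.2, m.2)).hasFDerivAt (hline m.2)
      rw [hm] at this
      exact hasDerivAt_pi.1 this i
    have hcont : Continuous fun r : ℝ => N (u (X - c i * r, r)) i := by
      have := hus.continuous
      have := hN.continuous
      fun_prop
    have e : (fun T => u (X - c i * T, T) i) =
        fun T => a X i + ∫ r in (0 : ℝ)..T, N (u (X - c i * r, r)) i := by
      ext1 T
      rw [heq]
      congr 1
      · refine congrArg (fun r => a r i) ?_
        simp only
        ring
      · have := intervalIntegral.smul_integral_comp_mul_left (a := 0) (b := 1)
          (fun r => N (u (X - c i * r, r)) i) T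
        rw [mul_zero, mul_one] at this
        rw [← this]
        congr 1
        refine intervalIntegral.integral_congr fun s _ => ?_
        refine congrArg (fun r => N (u (r, T * s)) i) ?_
        ring
    rw [e] at h1
    have h2 := (hcont.integral_hasStrictDerivAt 0 m.2).hasDerivAt.const_add (a X i)
    have := h1.unique h2
    rwa [hm] at this

end Semilinear

end

/-! ### Truncation, uniqueness, and global existence from an a priori bound -/

section

section Truncation

variable {V : Type*} [NormedAddCommGroup V] [NormedSpace ℝ V] [FiniteDimensional ℝ V]

/-- A smooth map between finite-dimensional spaces agrees on a given ball with a globally Lipschitz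
smooth map. -/
theorem exists_lipschitz_truncation {W : Type*} [NormedAddCommGroup W] [NormedSpace ℝ W]
    {N : V → W} (hN : ContDiff ℝ ∞ N) (R : ℝ) :
    ∃ (N' : V → W) (l : NNReal), ContDiff ℝ ∞ N' ∧ LipschitzWith l N' ∧
      ∀ x, ‖x‖ ≤ R → N' x = N x := by
  let χ : ContDiffBump (0 : V) := ⟨max R 1, max R 1 + 1, by positivity, by linarith⟩
  have h1 : ContDiff ℝ ∞ fun x => χ x • N x := χ.contDiff.smul hN
  have h2 : HasCompactSupport fun x => χ x • N x := χ.hasCompactSupport.smul_right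
  obtain ⟨l, hl⟩ := h1.lipschitzWith_of_hasCompactSupport h2 (by simp)
  refine ⟨_, l, h1, hl, fun x hx => ?_⟩
  rw [χ.one_of_mem_closedBall, one_smul]
  rw [mem_closedBall_zero_iff]
  exact hx.trans (le_max_left _ _)

end Truncation

section Semilinear

variable {ι : Type} {E : Type*} [NormedAddCommGroup E] [NormedSpace ℝ E]
variable {c : ι → ℝ}

theorem SolvesAt.congr {N N' : (ι → E) → ι → E} {u : ℝ × ℝ → ι → E} {m : ℝ × ℝ}
    (h : SolvesAt c N u m) (e : N' (u m) = N (u m)) : SolvesAt c N' u m := fun i => by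
  rw [e, h i]

variable [Fintype ι] [FiniteDimensional ℝ E]

/-- Solutions of smooth semilinear systems are determined by their initial data. -/
theorem solution_unique (hc : ∀ i, |c i| ≤ 1) {N : (ι → E) → ι → E} (hN : ContDiff ℝ ∞ N)
    {u u' : ℝ × ℝ → ι → E} (hu : ContDiff ℝ ∞ u) (hu' : ContDiff ℝ ∞ u')
    (h0 : ∀ x, u (x, 0) = u' (x, 0)) {p : ℝ × ℝ} (h : ∀ z, SolvesAt c N u (Tri.aff p z))
    (h' : ∀ z, SolvesAt c N u' (Tri.aff p z)) : u p = u' p := by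
  have : CompleteSpace E := FiniteDimensional.complete ℝ E
  let U : C(Tri, ι → E) := ⟨fun z => u (Tri.aff p z), hu.continuous.comp (Tri.continuous_aff p)⟩
  let U' : C(Tri, ι → E) := ⟨fun z => u' (Tri.aff p z), hu'.continuous.comp (Tri.continuous_aff p)⟩
  -- Truncating beyond the range of both solutions makes them mild solutions of one and the same
  -- globally Lipschitz system.
  obtain ⟨N', l, hN', hl, hNN⟩ := exists_lipschitz_truncation hN (max ‖U‖ ‖U'‖)
  let N₀ : C(ι → E, ι → E) := ⟨N', hN'.continuous⟩
  let a : C(ℝ, ι → E) := ⟨fun x => u (x, 0), by have := hu.continuous; fun_prop⟩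
  have h1 : MildSol c hc N₀ a p U := mildSol_of_solvesAt c hc hu (fun _ => rfl) fun z =>
    (h z).congr (hNN _ ((U.norm_coe_le_norm z).trans (le_max_left _ _)))
  have h2 : MildSol c hc N₀ a p U' := mildSol_of_solvesAt c hc hu' (fun x => (h0 x).symm) fun z =>
    (h' z).congr (hNN _ ((U'.norm_coe_le_norm z).trans (le_max_right _ _)))
  have h3 := congrArg (fun W : C(Tri, ι → E) => W tip)
    ((existsUnique_mildSol c hc (N := N₀) hl a p).unique h1 h2)
  simpa [U, U', Tri.aff_tip] using h3

/-- The truncation of the unit triangle at height `τ`. -/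
def Tri.cut (τ : unitInterval) (z : Tri) : Tri :=
  ⟨(z.1.1, min z.1.2 τ), le_min z.2.1 τ.2.1, z.2.2.trans (by
    have := min_le_left z.1.2 (τ : ℝ)
    dsimp only; linarith)⟩

/-- A continuous function on the unit triangle which on each truncated triangle is bounded by `M`
as soon as it is bounded by a larger constant `R`, is bounded by `M`. -/
theorem norm_le_of_bootstrap {V : Type*} [NormedAddCommGroup V] (U : C(Tri, V)) {M R : ℝ}
    (hMR : M < R) (h0 : ∀ z, ‖U (Tri.cut 0 z)‖ ≤ M)
    (hstep : ∀ τ, (∀ z, ‖U (Tri.cut τ z)‖ ≤ R) → ∀ z, ‖U (Tri.cut τ z)‖ ≤ M) (z : Tri) :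
    ‖U z‖ ≤ M := by
  have hM : 0 ≤ M := (norm_nonneg _).trans (h0 tip)
  let r : C(unitInterval × Tri, Tri) := ⟨fun q => Tri.cut q.1 q.2, by unfold Tri.cut; fun_prop⟩
  set h : unitInterval → ℝ := fun τ => ‖U.comp (r.curry τ)‖ with hh
  have hcont : Continuous h :=
    continuous_norm.comp ((ContinuousMap.continuous_postcomp U).comp r.curry.continuous)
  have hM' : ∀ τ, h τ ≤ M ↔ ∀ z, ‖U (Tri.cut τ z)‖ ≤ M := fun τ =>
    ContinuousMap.norm_le _ hM
  have hR' : ∀ τ, h τ ≤ R ↔ ∀ z, ‖U (Tri.cut τ z)‖ ≤ R := fun τ =>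
    ContinuousMap.norm_le _ (hM.trans hMR.le)
  -- The gap between `M` and `R` makes this set both closed and open in the unit interval; it
  -- contains 0, so it contains 1.
  have e : {τ | h τ ≤ M} = {τ | h τ < R} := by
    ext τ
    exact ⟨fun H => lt_of_le_of_lt H hMR, fun H => (hM' τ).2 (hstep τ ((hR' τ).1 (le_of_lt H)))⟩
  have hclopen : IsClopen {τ | h τ ≤ M} :=
    ⟨isClosed_le hcont continuous_const, e ▸ isOpen_lt hcont continuous_const⟩
  have huniv := hclopen.eq_univ ⟨0, (hM' 0).2 h0⟩
  have h1 : (1 : unitInterval) ∈ {τ | h τ ≤ M} := huniv ▸ mem_univ _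
  have h2 := (hM' 1).1 h1 z
  have e1 : Tri.cut 1 z = z := by
    ext
    · rfl
    · exact min_eq_left z.snd_le_one
  rwa [e1] at h2

/-- A smooth semilinear system has a global smooth solution if its solutions satisfy an a priori
bound on the triangles of dependence. -/
theorem exists_solution_of_bound (hc : ∀ i, |c i| ≤ 1) {N : (ι → E) → ι → E}
    (hN : ContDiff ℝ ∞ N) {a : ℝ → ι → E} (ha : ContDiff ℝ ∞ a)
    (hM : ∀ r : ℝ, ∃ M : ℝ, ∀ u : ℝ × ℝ → ι → E, ContDiff ℝ ∞ u → (∀ x, u (x, 0) = a x) →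
      ∀ p : ℝ × ℝ, |p.1| + |p.2| ≤ r → (∀ z, SolvesAt c N u (Tri.aff p z)) → ‖u p‖ ≤ M) :
    ∃ u : ℝ × ℝ → ι → E, ContDiff ℝ ∞ u ∧ (∀ x, u (x, 0) = a x) ∧ ∀ m, SolvesAt c N u m := by
  have : CompleteSpace E := FiniteDimensional.complete ℝ E
  have hloc : ∀ r : ℝ, ∃ u : ℝ × ℝ → ι → E, ContDiff ℝ ∞ u ∧ (∀ x, u (x, 0) = a x) ∧
      ∀ p : ℝ × ℝ, |p.1| + |p.2| ≤ r → SolvesAt c N u p := by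
    intro r
    obtain ⟨M, hM⟩ := hM r
    obtain ⟨M₀, hM₀⟩ := (isCompact_Icc (a := -r) (b := r)).exists_bound_of_continuousOn
      ha.continuous.continuousOn
    set M₁ := max M M₀
    -- The margin 1 is what the bootstrap needs: below `M₁ + 1` the truncated and original systems
    -- agree, so the a priori bound applies and improves the estimate to `M₁`.
    obtain ⟨N', l, hN', hl, hNN⟩ := exists_lipschitz_truncation hN (M₁ + 1)
    obtain ⟨u, hu, hu0, hus⟩ := exists_solution_of_lipschitz c hc hl hN' ha
    refine ⟨u, hu, hu0, fun p hp => ?_⟩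
    let U : C(Tri, ι → E) := ⟨fun z => u (Tri.aff p z), hu.continuous.comp (Tri.continuous_aff p)⟩
    have key := norm_le_of_bootstrap U (M := M₁) (R := M₁ + 1) (by linarith) (fun z => by
      have e : Tri.aff p (Tri.cut 0 z) = (p.1 + p.2 * z.1.1, 0) := by
        ext
        · rfl
        · simp [Tri.aff, Tri.cut, z.2.1]
      change ‖u (Tri.aff p (Tri.cut 0 z))‖ ≤ M₁
      have := Tri.abs_aff_le hp (Tri.cut 0 z)
      rw [e] at this ⊢
      rw [hu0]
      refine (hM₀ _ ?_).trans (le_max_right _ _)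
      exact abs_le.1 (by simpa using this)) (fun τ hτ z => by
      refine (hM u hu hu0 (Tri.aff p (Tri.cut τ z)) (Tri.abs_aff_le hp _) fun z' => ?_).trans
        (le_max_left _ _)
      rw [← Tri.aff_sub]
      -- The triangle of dependence of a point below height `τ` stays below `τ`, where the
      -- untruncated system is known to hold.
      have e : Tri.sub (Tri.cut τ z) z' = Tri.cut τ (Tri.sub (Tri.cut τ z) z') := by
        ext
        · rfl
        · refine (min_eq_left ?_).symm
          refine (mul_le_of_le_one_right (Tri.cut τ z).2.1 z'.snd_le_one).trans ?_
          exact min_le_right _ _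
      rw [e]
      exact (hus _).congr (hNN _ (hτ _)).symm)
    have hp1 := key tip
    simp only [U, ContinuousMap.coe_mk, Tri.aff_tip] at hp1
    exact (hus p).congr (hNN _ (by linarith)).symm
  choose U hU hU0 hUs using hloc
  have huniq : ∀ p r r', |p.1| + |p.2| ≤ r → |p.1| + |p.2| ≤ r' → U r p = U r' p :=
    fun p r r' h h' => solution_unique hc hN (hU r) (hU r') (fun x => by rw [hU0, hU0])
      (fun z => hUs r _ (Tri.abs_aff_le h z)) (fun z => hUs r' _ (Tri.abs_aff_le h' z))
  -- The local solutions agree wherever both solve the system. Enlarging the radius by 1 gives a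
  -- fixed solution that coincides with `u` in a whole neighbourhood of a point.
  set u : ℝ × ℝ → ι → E := fun p => U (|p.1| + |p.2|) p with hu
  have hev : ∀ p : ℝ × ℝ, u =ᶠ[𝓝 p] U (|p.1| + |p.2| + 1) := by
    intro p
    have hcont : Continuous fun q : ℝ × ℝ => |q.1| + |q.2| := by fun_prop
    filter_upwards [hcont.continuousAt.eventually (gt_mem_nhds (lt_add_one (|p.1| + |p.2|)))]
      with q hq
    exact huniq q _ _ le_rfl hq.le
  refine ⟨u, contDiff_iff_contDiffAt.2 fun p => (hU _).contDiffAt.congr_of_eventuallyEq (hev p),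
    fun x => hU0 _ x, fun m i => ?_⟩
  rw [(hev m).fderiv_eq, (hev m).eq_of_nhds]
  exact hUs _ m (by linarith) i

end Semilinear

end

section

/-! ### The reduced system in a left-invariant frame -/

/-- A finite-dimensional Lie algebra with a scalar product `g`, a two-form `p`, and the coupling
parameters of the torsion wave map equation. -/
structure FrameData (E : Type*) [NormedAddCommGroup E] [NormedSpace ℝ E] where
  br : E →L[ℝ] E →L[ℝ] E
  g : E →L[ℝ] E →L[ℝ] ℝ
  p : E →L[ℝ] E →L[ℝ] ℝ
  lam : ℝ
  v : Fin 3 → ℝ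
  br_self : ∀ u, br u u = 0
  jacobi : ∀ a b c, br (br a b) c + br (br b c) a + br (br c a) b = 0
  g_symm : ∀ a b, g a b = g b a
  g_pos : ∀ a, a ≠ 0 → 0 < g a a
  p_self : ∀ a, p a a = 0
  small : ∃ k : ℝ, 0 < k ∧ ∀ e h, 1 / k * (g e e + g h h) ≤ g e e + g h h + 2 * lam * v 2 * p h e

namespace FrameData

variable {E : Type*} [NormedAddCommGroup E] [NormedSpace ℝ E] (A : FrameData E)

theorem br_symm (a b : E) : A.br a b = -A.br b a := by
  have := A.br_self (a + b)
  simp only [map_add, add_apply, A.br_self, zero_add, add_zero] at this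
  exact eq_neg_of_add_eq_zero_left (by rw [add_comm]; exact this)

theorem p_symm (a b : E) : A.p a b = -A.p b a := by
  have := A.p_self (a + b)
  simp only [map_add, add_apply, A.p_self, zero_add, add_zero] at this
  linarith

/-- Minus the exterior derivative of the left-invariant two-form `p`. -/
def dp (u w : E) : E →L[ℝ] ℝ :=
  -(A.p.flip w).comp (A.br u) + A.p (A.br u w) + (A.p.flip u).comp (A.br w)

theorem dp_apply (u w z : E) :
    A.dp u w z = A.p (A.br z u) w + A.p (A.br u w) z + A.p (A.br w z) u := by
  simp [dp, A.br_symm u z]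

/-- The force term of the reduced wave map equation, as a covector. -/
def force (t x y : E) : E →L[ℝ] ℝ :=
  (A.g t).comp (A.br t) - (A.g x).comp (A.br x) - (A.g y).comp (A.br y) -
    A.lam • (A.v 2 • A.dp x y + A.v 0 • A.dp y t + A.v 1 • A.dp t x)

theorem force_apply (t x y z : E) : A.force t x y z =
    A.g t (A.br t z) - A.g x (A.br x z) - A.g y (A.br y z) -
      A.lam * (A.v 2 * A.dp x y z + A.v 0 * A.dp y t z + A.v 1 * A.dp t x z) := rfl

/-- The energy density. -/
def energy (t x y : E) : ℝ :=
  1 / 2 * (A.g t t + A.g x x + A.g y y) - A.lam * A.v 2 * A.p x y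

/-- The energy flux. -/
def flux (t x y : E) : ℝ := A.g t x - A.lam * A.v 2 * A.p t y

/-- This is ∂_t e = ∂_x f with the evolution equations substituted: `a` and `b` stand for ∂_x t and
∂_x x, and `s` for the source. Tested against t, the force loses its `v 0` and `v 1` terms because
`dp` is alternating. Its `v 2` term combines with the derivatives of the term p(x, y) in the energy.
-/
theorem energy_identity (t x y s a b : E) (hs : A.g t s = A.force t x y t) :
    A.g t (b + s) + A.g x (a - A.br t x) + A.g y (-A.br t y) -
        A.lam * A.v 2 * (A.p (a - A.br t x) y + A.p x (-A.br t y)) =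
      A.g a x + A.g t b - A.lam * A.v 2 * (A.p a y + A.p t (-A.br x y)) := by
  simp only [map_add, map_sub, map_neg, sub_apply, hs, force_apply, dp_apply,
    A.br_self, map_zero, zero_apply]
  rw [A.br_symm y t, A.br_symm x t, A.p_symm (A.br x y) t, A.g_symm a x]
  simp only [map_neg, neg_apply]
  rw [A.p_symm (A.br t y) x]
  ring

/-- This is the form in which the smallness condition applies, with y and t - x as its arguments: on
the right edge of a triangle the flux dominates a multiple of |y|² + |t - x|². -/
theorem energy_sub_flux (t x y : E) : A.energy t x y - A.flux t x y =
    1 / 2 * (A.g y y + A.g (t - x) (t - x) + 2 * A.lam * A.v 2 * A.p (t - x) y) := by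
  simp only [energy, flux, map_sub, sub_apply, A.g_symm x t]
  ring

theorem energy_add_flux (t x y : E) : A.energy t x y + A.flux t x y =
    1 / 2 * (A.g y y + A.g (t + x) (t + x) + 2 * A.lam * A.v 2 * A.p (-(t + x)) y) := by
  simp only [energy, flux, map_add, map_neg, add_apply,
    neg_apply, A.g_symm x t]
  ring

/-- The null structure of the system: for the component t + x the contributions of t and x alone
cancel against the bracket term, and `dp t x` vanishes on t + x. Every surviving term contains y,
which the energy estimate bounds. -/
theorem force_add (t x y : E) : A.force t x y (t + x) - A.g (t + x) (A.br t x) =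
    -A.g y (A.br y (t + x)) -
      A.lam * (A.v 2 * A.dp x y (t + x) + A.v 0 * A.dp y t (t + x)) := by
  have : A.dp t x (t + x) = 0 := by
    simp only [dp_apply, map_add, A.br_self]
    rw [A.br_symm x t]
    simp only [map_neg, neg_apply, map_zero, zero_apply, zero_add, add_zero]
    ring
  rw [force_apply, this]
  simp only [map_add, add_apply, A.br_self]
  rw [A.br_symm x t]
  simp only [map_neg, map_zero]
  ring

theorem force_sub (t x y : E) : A.force t x y (t - x) + A.g (t - x) (A.br t x) =
    -A.g y (A.br y (t - x)) -
      A.lam * (A.v 2 * A.dp x y (t - x) + A.v 0 * A.dp y t (t - x)) := by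
  have : A.dp t x (t - x) = 0 := by
    simp only [dp_apply, map_sub, A.br_self]
    rw [A.br_symm x t]
    simp only [map_neg, neg_apply, map_zero, zero_apply]
    ring
  rw [force_apply, this]
  simp only [map_sub, sub_apply, A.br_self]
  rw [A.br_symm x t]
  simp only [map_neg, map_zero]
  ring

theorem g_self_nonneg (a : E) : 0 ≤ A.g a a := by
  rcases eq_or_ne a 0 with rfl | h
  · simp
  · exact (A.g_pos a h).le

theorem norm_dp_le (u w z : E) : |A.dp u w z| ≤ 3 * ‖A.p‖ * ‖A.br‖ * ‖u‖ * ‖w‖ * ‖z‖ := by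
  have h : ∀ a b c : E, |A.p (A.br a b) c| ≤ ‖A.p‖ * ‖A.br‖ * ‖a‖ * ‖b‖ * ‖c‖ := fun a b c => by
    refine (A.p.le_opNorm₂ _ _).trans ?_
    calc _ ≤ ‖A.p‖ * (‖A.br‖ * ‖a‖ * ‖b‖) * ‖c‖ := by gcongr; exact A.br.le_opNorm₂ _ _
      _ = _ := by ring
  rw [dp_apply]
  have h1 := h z u w
  have h2 := h u w z
  have h3 := h w z u
  refine (abs_add_three _ _ _).trans ?_
  linarith [mul_comm ‖z‖ ‖u‖]

/-- The time component of the frame in terms of the characteristic components. -/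
def tPart (u : Fin 3 → E) : E := (1 / 2 : ℝ) • (u 0 + u 1)

/-- The space component of the frame in terms of the characteristic components. -/
def xPart (u : Fin 3 → E) : E := (1 / 2 : ℝ) • (u 0 - u 1)

theorem tPart_add_xPart (u : Fin 3 → E) : tPart u + xPart u = u 0 := by
  simp only [tPart, xPart]; module

theorem tPart_sub_xPart (u : Fin 3 → E) : tPart u - xPart u = u 1 := by
  simp only [tPart, xPart]; module

/-- The characteristic speeds of the reduced system. -/
def speed : Fin 3 → ℝ := ![1, -1, 0]

theorem abs_speed_le (i : Fin 3) : |speed i| ≤ 1 := by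
  fin_cases i <;> simp [speed]

theorem contDiff_force {M : Type*} [NormedAddCommGroup M] [NormedSpace ℝ M] {t x y : M → E}
    (ht : ContDiff ℝ ∞ t) (hx : ContDiff ℝ ∞ x) (hy : ContDiff ℝ ∞ y) :
    ContDiff ℝ ∞ fun m => A.force (t m) (x m) (y m) := by
  unfold force dp
  fun_prop

theorem force_neg (t x y : E) : A.force (-t) (-x) (-y) = A.force t x y := by
  ext z
  simp only [force_apply, dp_apply, map_neg, neg_apply, neg_neg]

theorem eq_of_g_eq {a b : E} (h : ∀ z, A.g a z = A.g b z) : a = b := by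
  by_contra hne
  have := A.g_pos (a - b) (sub_ne_zero.2 hne)
  rw [map_sub A.g, sub_apply, h, sub_self] at this
  exact this.false

variable [FiniteDimensional ℝ E]

/-- Positivity makes a ↦ g(a, ·) injective, and equality of dimensions makes it an isomorphism onto
the dual. -/
theorem exists_sharp : ∃ e : (E →L[ℝ] ℝ) →L[ℝ] E, ∀ f z, A.g (e f) z = f z := by
  have hinj : Function.Injective A.g := by
    rw [injective_iff_map_eq_zero]
    intro a ha
    by_contra h
    have := A.g_pos a h
    rw [ha] at this
    simp at this
  have hdim : Module.finrank ℝ E = Module.finrank ℝ (E →L[ℝ] ℝ) := by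
    rw [← (LinearMap.toContinuousLinearMap (E := E) (F' := ℝ) (𝕜 := ℝ)).finrank_eq]
    exact Subspace.dual_finrank_eq.symm
  let e := LinearEquiv.ofInjectiveOfFinrankEq A.g.toLinearMap hinj hdim
  refine ⟨LinearMap.toContinuousLinearMap e.symm.toLinearMap, fun f z => ?_⟩
  have : A.g.toLinearMap (e.symm f) = f := e.apply_symm_apply f
  exact congrArg (fun l : E →L[ℝ] ℝ => l z) this

/-- The vector corresponding to a covector. -/
def sharp : (E →L[ℝ] ℝ) →L[ℝ] E := Classical.choose A.exists_sharp

theorem g_sharp (f : E →L[ℝ] ℝ) (z : E) : A.g (A.sharp f) z = f z :=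
  Classical.choose_spec A.exists_sharp f z

/-- The right-hand side of the reduced wave map equation `∂_t A_t - ∂_x A_x = source`. -/
def source (t x y : E) : E := A.sharp (A.force t x y)

theorem g_source (t x y z : E) : A.g z (A.source t x y) = A.force t x y z := by
  rw [A.g_symm]; exact A.g_sharp _ _

/-- The constant is the reciprocal of the minimum of g(a, a) on the unit sphere. The zero space has
an empty sphere and is treated apart. -/
theorem exists_norm_sq_le : ∃ C : ℝ, 0 < C ∧ ∀ a, ‖a‖ ^ 2 ≤ C * A.g a a := by
  have hcont : Continuous fun a => A.g a a := by fun_prop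
  rcases subsingleton_or_nontrivial E with hE | hE
  · exact ⟨1, one_pos, fun a => by simp [Subsingleton.elim a 0]⟩
  have : ProperSpace E := FiniteDimensional.proper ℝ E
  obtain ⟨b, hb, hmin⟩ := (isCompact_sphere (0 : E) 1).exists_isMinOn
    (NormedSpace.sphere_nonempty.2 zero_le_one) hcont.continuousOn
  have hb0 : b ≠ 0 := by
    rintro rfl
    simp at hb
  have hpos := A.g_pos b hb0
  refine ⟨1 / A.g b b, by positivity, fun a => ?_⟩
  rcases eq_or_ne a 0 with rfl | ha
  · simp
  have hn : ‖a‖ ≠ 0 := norm_ne_zero_iff.2 ha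
  have h1 : A.g b b ≤ A.g (‖a‖⁻¹ • a) (‖a‖⁻¹ • a) := hmin (by simp [norm_smul, hn])
  simp only [map_smul, smul_apply, smul_eq_mul] at h1
  rw [div_mul_eq_mul_div, one_mul, le_div_iff₀ hpos]
  calc _ ≤ ‖a‖ ^ 2 * (‖a‖⁻¹ * (‖a‖⁻¹ * A.g a a)) := by gcongr
    _ = _ := by field_simp

/-- The nonlinearity of the reduced system for `(A_t + A_x, A_t - A_x, A_y)`. -/
def nonlin (u : Fin 3 → E) : Fin 3 → E :=
  ![A.source (tPart u) (xPart u) (u 2) - A.br (tPart u) (xPart u),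
    A.source (tPart u) (xPart u) (u 2) + A.br (tPart u) (xPart u),
    -A.br (tPart u) (u 2)]

theorem contDiff_nonlin : ContDiff ℝ ∞ A.nonlin := by
  have ht : ContDiff ℝ ∞ (tPart (E := E)) := by unfold tPart; fun_prop
  have hx : ContDiff ℝ ∞ (xPart (E := E)) := by unfold xPart; fun_prop
  have hy : ContDiff ℝ ∞ fun u : Fin 3 → E => u 2 := by fun_prop
  have hs : ContDiff ℝ ∞ fun u : Fin 3 → E => A.source (tPart u) (xPart u) (u 2) :=
    A.sharp.contDiff.comp (A.contDiff_force ht hx hy)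
  refine contDiff_pi.2 fun i => ?_
  fin_cases i <;> simp [nonlin] <;> fun_prop

/-- The nonlinearity is quadratic, hence even, so u(m) ↦ -u(-m) maps solutions to solutions and
exchanges future and past. -/
theorem nonlin_neg (u : Fin 3 → E) : A.nonlin (-u) = A.nonlin u := by
  have h1 : tPart (-u) = -tPart u := by simp only [tPart, Pi.neg_apply]; module
  have h2 : xPart (-u) = -xPart u := by simp only [xPart, Pi.neg_apply]; module
  have h3 : A.source (-tPart u) (-xPart u) (-u 2) = A.source (tPart u) (xPart u) (u 2) := by
    rw [source, force_neg]; rfl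
  simp only [nonlin, h1, h2, Pi.neg_apply, h3, map_neg, neg_apply, neg_neg]

end FrameData

end

section

/-! ### A priori bounds on triangles -/

/-- The closed triangle with tip `p` and base on the line `t = 0`. -/
def cone (p : ℝ × ℝ) : Set (ℝ × ℝ) := {m | 0 ≤ m.2 ∧ |m.1 - p.1| ≤ p.2 - m.2}

theorem convex_cone (p : ℝ × ℝ) : Convex ℝ (cone p) := by
  intro m hm m' hm' a b ha hb hab
  refine ⟨?_, ?_⟩
  · simp only [Prod.snd_add, Prod.smul_snd, smul_eq_mul]
    have := hm.1; have := hm'.1; positivity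
  · simp only [Prod.snd_add, Prod.smul_snd, Prod.fst_add, Prod.smul_fst, smul_eq_mul]
    have e : a * m.1 + b * m'.1 - p.1 = a * (m.1 - p.1) + b * (m'.1 - p.1) := by
      linear_combination p.1 * hab
    have e' : p.2 - (a * m.2 + b * m'.2) = a * (p.2 - m.2) + b * (p.2 - m'.2) := by
      linear_combination (-p.2) * hab
    rw [e, e']
    refine (abs_add_le _ _).trans ?_
    rw [abs_mul, abs_mul, abs_of_nonneg ha, abs_of_nonneg hb]
    gcongr
    · exact hm.2
    · exact hm'.2

theorem isClosed_cone (p : ℝ × ℝ) : IsClosed (cone p) :=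
  IsClosed.inter (s₁ := {m : ℝ × ℝ | 0 ≤ m.2}) (s₂ := {m | |m.1 - p.1| ≤ p.2 - m.2})
    (isClosed_le (by fun_prop) (by fun_prop)) (isClosed_le (by fun_prop) (by fun_prop))

theorem snd_le_of_mem_cone {p m : ℝ × ℝ} (h : m ∈ cone p) : m.2 ≤ p.2 := by
  have := h.2; have := abs_nonneg (m.1 - p.1); linarith

theorem isCompact_cone (p : ℝ × ℝ) : IsCompact (cone p) := by
  refine Metric.isCompact_of_isClosed_isBounded (isClosed_cone p) ?_
  refine (Metric.isBounded_Icc ((p.1 - p.2, 0) : ℝ × ℝ) (p.1 + p.2, p.2)).subset ?_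
  intro m hm
  have h1 := abs_le.1 hm.2
  have h2 := hm.1
  have h3 := snd_le_of_mem_cone hm
  exact ⟨⟨by dsimp only; linarith, h2⟩, ⟨by dsimp only; linarith, h3⟩⟩

theorem uniqueDiffOn_cone {p : ℝ × ℝ} (hp : 0 < p.2) : UniqueDiffOn ℝ (cone p) := by
  refine uniqueDiffOn_convex (convex_cone p) ⟨(p.1, p.2 / 2), ?_⟩
  rw [mem_interior]
  refine ⟨{m | 0 < m.2 ∧ |m.1 - p.1| < p.2 - m.2}, fun m hm => ⟨hm.1.le, hm.2.le⟩,
    IsOpen.inter (s := {m : ℝ × ℝ | 0 < m.2}) (t := {m | |m.1 - p.1| < p.2 - m.2})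
      (isOpen_lt (by fun_prop) (by fun_prop)) (isOpen_lt (by fun_prop) (by fun_prop)), ?_⟩
  constructor
  · dsimp only; linarith
  · simp only [sub_self, abs_zero]; linarith

theorem cone_subset {p m : ℝ × ℝ} (h : m ∈ cone p) : cone m ⊆ cone p := by
  intro q hq
  refine ⟨hq.1, ?_⟩
  have h1 := h.2
  have h2 := hq.2
  have h3 := abs_add_le (q.1 - m.1) (m.1 - p.1)
  rw [sub_add_sub_cancel] at h3
  linarith

theorem self_mem_cone {p : ℝ × ℝ} (hp : 0 ≤ p.2) : p ∈ cone p := ⟨hp, by simp⟩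

theorem abs_le_of_mem_cone {p m : ℝ × ℝ} {r : ℝ} (hp : |p.1| + |p.2| ≤ r) (h : m ∈ cone p) :
    |m.1| + |m.2| ≤ r := by
  have h1 := h.2
  have h2 := h.1
  have h3 := abs_add_le (m.1 - p.1) p.1
  rw [sub_add_cancel] at h3
  rw [abs_of_nonneg h2]
  have := le_abs_self p.2
  linarith

/-- The right edge of a triangle. -/
theorem right_mem_cone {p : ℝ × ℝ} {s : ℝ} (hs : s ∈ Icc 0 p.2) : (p.1 + (p.2 - s), s) ∈ cone p := by
  refine ⟨hs.1, ?_⟩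
  rw [add_sub_cancel_left, abs_of_nonneg (sub_nonneg.2 hs.2)]

/-- The left edge of a triangle. -/
theorem left_mem_cone {p : ℝ × ℝ} {s : ℝ} (hs : s ∈ Icc 0 p.2) : (p.1 - (p.2 - s), s) ∈ cone p := by
  refine ⟨hs.1, ?_⟩
  rw [sub_sub_cancel_left, abs_neg, abs_of_nonneg (sub_nonneg.2 hs.2)]

/-- The vertical segment below a point of a triangle. -/
theorem vertical_mem_cone {p m : ℝ × ℝ} (h : m ∈ cone p) {s : ℝ} (hs : s ∈ Icc 0 m.2) :
    (m.1, s) ∈ cone p := ⟨hs.1, by have := h.2; have := hs.2; dsimp only; linarith⟩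

theorem mem_cone_iff_aff {p : ℝ × ℝ} (hp : 0 < p.2) {m : ℝ × ℝ} (hm : m ∈ cone p) :
    ∃ z : Tri, m = Tri.aff p z := by
  refine ⟨⟨((m.1 - p.1) / p.2, m.2 / p.2), div_nonneg hm.1 hp.le, ?_⟩, ?_⟩
  · dsimp only
    rw [abs_div, abs_of_pos hp, div_le_iff₀ hp, sub_mul, div_mul_cancel₀ _ hp.ne', one_mul]
    exact hm.2
  · ext
    · simp only [Tri.aff]; field_simp; ring
    · simp only [Tri.aff]; field_simp

/-- The system is known only on the closed triangle. Convexity and nonempty interior still determine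
full derivatives at its boundary, so equations holding on the triangle may be differentiated there.
-/
theorem fderiv_eq_zero_of_eqOn_cone {F : Type*} [NormedAddCommGroup F] [NormedSpace ℝ F]
    {H : ℝ × ℝ → F} {p : ℝ × ℝ} (hp : 0 < p.2) (h0 : ∀ m ∈ cone p, H m = 0) {m : ℝ × ℝ}
    (hm : m ∈ cone p) (hd : DifferentiableAt ℝ H m) : fderiv ℝ H m = 0 := by
  have h1 := hd.hasFDerivAt.hasFDerivWithinAt (s := cone p)
  have h2 : HasFDerivWithinAt H (0 : ℝ × ℝ →L[ℝ] F) (cone p) m :=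
    (hasFDerivWithinAt_const (0 : F) m (cone p)).congr h0 (h0 m hm)
  exact (uniqueDiffOn_cone hp m hm).eq h1 h2

theorem fderiv_bilin_apply {E F G M : Type*} [NormedAddCommGroup E] [NormedSpace ℝ E]
    [NormedAddCommGroup F] [NormedSpace ℝ F] [NormedAddCommGroup G] [NormedSpace ℝ G]
    [NormedAddCommGroup M] [NormedSpace ℝ M] (B : E →L[ℝ] F →L[ℝ] G) {f : M → E} {h : M → F}
    {m : M} (hf : DifferentiableAt ℝ f m) (hh : DifferentiableAt ℝ h m) (d : M) :
    fderiv ℝ (fun m => B (f m) (h m)) m d = B (fderiv ℝ f m d) (h m) + B (f m) (fderiv ℝ h m d) := by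
  rw [B.fderiv_of_bilinear hf hh]
  simp [add_comm]

theorem fderiv_fderiv_apply {F M : Type*} [NormedAddCommGroup F] [NormedSpace ℝ F]
    [NormedAddCommGroup M] [NormedSpace ℝ M] {y : M → F} {m : M} (hy : ContDiffAt ℝ ∞ y m)
    (d d' : M) : fderiv ℝ (fun m => fderiv ℝ y m d) m d' = fderiv ℝ (fderiv ℝ y) m d' d := by
  have h : DifferentiableAt ℝ (fderiv ℝ y) m :=
    (hy.fderiv_right (m := ∞) (by simp)).differentiableAt (by simp)
  rw [fderiv_clm_apply h (differentiableAt_const d)]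
  simp

theorem fderiv_fderiv_symm {F M : Type*} [NormedAddCommGroup F] [NormedSpace ℝ F]
    [NormedAddCommGroup M] [NormedSpace ℝ M] {y : M → F} {m : M} (hy : ContDiffAt ℝ ∞ y m)
    (d d' : M) : fderiv ℝ (fderiv ℝ y) m d d' = fderiv ℝ (fderiv ℝ y) m d' d :=
  (hy.isSymmSndFDerivAt (by simpa using WithTop.coe_le_coe.2 (le_top : (2 : ℕ∞) ≤ ⊤))) d d'

namespace FrameData

variable {E : Type*} [NormedAddCommGroup E] [NormedSpace ℝ E] (A : FrameData E)

theorem fderiv_energy {t x y : ℝ × ℝ → E} {m : ℝ × ℝ} (ht : DifferentiableAt ℝ t m)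
    (hx : DifferentiableAt ℝ x m) (hy : DifferentiableAt ℝ y m) (d : ℝ × ℝ) :
    fderiv ℝ (fun m => A.energy (t m) (x m) (y m)) m d =
      A.g (t m) (fderiv ℝ t m d) + A.g (x m) (fderiv ℝ x m d) + A.g (y m) (fderiv ℝ y m d) -
        A.lam * A.v 2 * (A.p (fderiv ℝ x m d) (y m) + A.p (x m) (fderiv ℝ y m d)) := by
  have h1 : DifferentiableAt ℝ (fun m => A.g (t m) (t m)) m := by fun_prop
  have h2 : DifferentiableAt ℝ (fun m => A.g (x m) (x m)) m := by fun_prop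
  have h3 : DifferentiableAt ℝ (fun m => A.g (y m) (y m)) m := by fun_prop
  have h4 : DifferentiableAt ℝ (fun m => A.p (x m) (y m)) m := by fun_prop
  unfold energy
  rw [fderiv_fun_sub (by fun_prop) (by fun_prop), fderiv_const_mul (by fun_prop),
    fderiv_const_mul h4, fderiv_fun_add (by fun_prop) h3, fderiv_fun_add h1 h2]
  simp only [sub_apply, add_apply, smul_apply, smul_eq_mul]
  rw [fderiv_bilin_apply A.g ht ht, fderiv_bilin_apply A.g hx hx, fderiv_bilin_apply A.g hy hy,
    fderiv_bilin_apply A.p hx hy, A.g_symm (fderiv ℝ t m d), A.g_symm (fderiv ℝ x m d),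
    A.g_symm (fderiv ℝ y m d)]
  ring

theorem fderiv_flux {t x y : ℝ × ℝ → E} {m : ℝ × ℝ} (ht : DifferentiableAt ℝ t m)
    (hx : DifferentiableAt ℝ x m) (hy : DifferentiableAt ℝ y m) (d : ℝ × ℝ) :
    fderiv ℝ (fun m => A.flux (t m) (x m) (y m)) m d =
      A.g (fderiv ℝ t m d) (x m) + A.g (t m) (fderiv ℝ x m d) -
        A.lam * A.v 2 * (A.p (fderiv ℝ t m d) (y m) + A.p (t m) (fderiv ℝ y m d)) := by
  have h1 : DifferentiableAt ℝ (fun m => A.g (t m) (x m)) m := by fun_prop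
  have h4 : DifferentiableAt ℝ (fun m => A.p (t m) (y m)) m := by fun_prop
  unfold flux
  rw [fderiv_fun_sub h1 (by fun_prop), fderiv_const_mul h4]
  simp only [sub_apply, smul_apply, smul_eq_mul]
  rw [fderiv_bilin_apply A.g ht hx, fderiv_bilin_apply A.p ht hy]

theorem contDiff_tPart {u : ℝ × ℝ → Fin 3 → E} (hu : ContDiff ℝ ∞ u) :
    ContDiff ℝ ∞ fun m => tPart (u m) := by unfold tPart; fun_prop

theorem contDiff_xPart {u : ℝ × ℝ → Fin 3 → E} (hu : ContDiff ℝ ∞ u) :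
    ContDiff ℝ ∞ fun m => xPart (u m) := by unfold xPart; fun_prop

variable [FiniteDimensional ℝ E]

/-- The reduced system in the frame components. -/
theorem solvesAt_iff {u : ℝ × ℝ → Fin 3 → E} {m : ℝ × ℝ} (hu : DifferentiableAt ℝ u m) :
    SolvesAt speed A.nonlin u m ↔
      fderiv ℝ (fun m => tPart (u m)) m (0, 1) = fderiv ℝ (fun m => xPart (u m)) m (1, 0) +
        A.source (tPart (u m)) (xPart (u m)) (u m 2) ∧
      fderiv ℝ (fun m => xPart (u m)) m (0, 1) = fderiv ℝ (fun m => tPart (u m)) m (1, 0) -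
        A.br (tPart (u m)) (xPart (u m)) ∧
      fderiv ℝ (fun m => u m 2) m (0, 1) = -A.br (tPart (u m)) (u m 2) := by
  have hi : ∀ i d, fderiv ℝ (fun m => u m i) m d = fderiv ℝ u m d i := fun i d => by
    rw [fderiv_apply hu i]; rfl
  have hdi : ∀ i, DifferentiableAt ℝ (fun m => u m i) m := fun i => by fun_prop
  have ht : ∀ d, fderiv ℝ (fun m => tPart (u m)) m d =
      (1 / 2 : ℝ) • (fderiv ℝ u m d 0 + fderiv ℝ u m d 1) := fun d => by
    unfold tPart
    rw [fderiv_fun_const_smul (f := fun m => u m 0 + u m 1) ((hdi 0).add (hdi 1)), fderiv_fun_add (hdi 0) (hdi 1)]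
    simp only [smul_apply, add_apply, hi]
  have hx : ∀ d, fderiv ℝ (fun m => xPart (u m)) m d =
      (1 / 2 : ℝ) • (fderiv ℝ u m d 0 - fderiv ℝ u m d 1) := fun d => by
    unfold xPart
    rw [fderiv_fun_const_smul (f := fun m => u m 0 - u m 1) ((hdi 0).sub (hdi 1)), fderiv_fun_sub (hdi 0) (hdi 1)]
    simp only [smul_apply, sub_apply, hi]
  have e0 : ((-1, 1) : ℝ × ℝ) = (0, 1) - (1, 0) := by ext <;> simp
  have e1 : ((1, 1) : ℝ × ℝ) = (0, 1) + (1, 0) := by ext <;> simp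
  rw [ht, ht, hx, hx, hi]
  simp only [SolvesAt, Fin.forall_fin_succ, speed, nonlin, IsEmpty.forall_iff, and_true,
    Matrix.cons_val_zero, Matrix.cons_val_succ, Fin.succ_zero_eq_one, Fin.succ_one_eq_two,
    neg_neg, neg_zero, e0, e1, map_sub, map_add,
    Pi.sub_apply, Pi.add_apply]
  constructor
  · rintro ⟨h0, h1, h2⟩
    refine ⟨?_, ?_, h2⟩
    · linear_combination (norm := module) (1 / 2 : ℝ) • h0 + (1 / 2 : ℝ) • h1
    · linear_combination (norm := module) (1 / 2 : ℝ) • h0 - (1 / 2 : ℝ) • h1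
  · rintro ⟨h0, h1, h2⟩
    refine ⟨?_, ?_, h2⟩
    · linear_combination (norm := module) h0 + h1
    · linear_combination (norm := module) h0 - h1

/-- The structure equation for the frame component along the orbits propagates. -/
theorem constraint_propagates {u : ℝ × ℝ → Fin 3 → E} (hu : ContDiff ℝ ∞ u)
    (h0 : ∀ x, fderiv ℝ (fun m => u m 2) (x, 0) (1, 0) = -A.br (xPart (u (x, 0))) (u (x, 0) 2))
    {p : ℝ × ℝ} (hp : 0 < p.2) (h : ∀ m ∈ cone p, SolvesAt speed A.nonlin u m) {m : ℝ × ℝ}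
    (hm : m ∈ cone p) :
    fderiv ℝ (fun m => u m 2) m (1, 0) = -A.br (xPart (u m)) (u m 2) := by
  set t := fun m => tPart (u m) with htdef
  set x := fun m => xPart (u m) with hxdef
  set y := fun m => u m 2 with hydef
  have ht : ContDiff ℝ ∞ t := contDiff_tPart hu
  have hx : ContDiff ℝ ∞ x := contDiff_xPart hu
  have hy : ContDiff ℝ ∞ y := by fun_prop
  have hy' : ContDiff ℝ ∞ (fderiv ℝ y) := hy.fderiv_right (by simp)
  have td : Differentiable ℝ t := ht.differentiable (by simp)
  have xd : Differentiable ℝ x := hx.differentiable (by simp)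
  have yd : Differentiable ℝ y := hy.differentiable (by simp)
  have yd' : Differentiable ℝ (fderiv ℝ y) := hy'.differentiable (by simp)
  have eqs := fun m hm => (A.solvesAt_iff ((hu.differentiable (by simp)) m)).1 (h m hm)
  -- The x-derivative of the evolution equation of y.
  have hH : ∀ m ∈ cone p, fderiv ℝ (fderiv ℝ y) m (0, 1) (1, 0) =
      -A.br (fderiv ℝ t m (1, 0)) (y m) - A.br (t m) (fderiv ℝ y m (1, 0)) := by
    intro m hm
    have hz := fderiv_eq_zero_of_eqOn_cone (H := fun m => fderiv ℝ y m (0, 1) + A.br (t m) (y m)) hp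
      (fun m hm => by
        rw [(eqs m hm).2.2]; simp [t, y]) hm (by fun_prop)
    have := congrArg (fun l : ℝ × ℝ →L[ℝ] E => l (1, 0)) hz
    rw [fderiv_fun_add (by fun_prop) (by fun_prop), add_apply,
      fderiv_fderiv_apply hy.contDiffAt, fderiv_bilin_apply A.br (td m) (yd m), zero_apply,
      fderiv_fderiv_symm hy.contDiffAt] at this
    linear_combination (norm := module) this
  -- The defect of the constraint. The Jacobi identity turns its time derivative into -[t, Z], so
  -- Gronwall propagates the value zero up the vertical line from the base.
  set Z := fun m => fderiv ℝ y m (1, 0) + A.br (x m) (y m) with hZ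
  have hZd : ∀ m ∈ cone p, fderiv ℝ Z m (0, 1) = -A.br (t m) (Z m) := by
    intro m hm
    have h1 := (eqs m hm).2.1
    have h2 := (eqs m hm).2.2
    rw [hZ, fderiv_fun_add (by fun_prop) (by fun_prop), add_apply,
      fderiv_fderiv_apply hy.contDiffAt, fderiv_bilin_apply A.br (xd m) (yd m), hH m hm, h1, h2]
    have hj := A.jacobi (t m) (x m) (y m)
    rw [A.br_symm (A.br (x m) (y m)), A.br_symm (A.br (y m) (t m)), A.br_symm (y m) (t m)] at hj
    simp only [map_sub, map_add, map_neg, sub_apply, neg_neg] at hj ⊢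
    linear_combination (norm := module) -hj
  have hZc : ContDiff ℝ ∞ Z := by
    have : ContDiff ℝ ∞ fun m => fderiv ℝ y m (1, 0) := by fun_prop
    fun_prop
  obtain ⟨C, hC⟩ := (isCompact_cone p).exists_bound_of_continuousOn (ht.continuous.continuousOn)
  have key : ‖Z (m.1, m.2)‖ ≤ gronwallBound 0 (‖A.br‖ * C) 0 (m.2 - 0) := by
    refine norm_le_gronwallBound_of_norm_deriv_right_le (f := fun s => Z (m.1, s))
      (f' := fun s => fderiv ℝ Z (m.1, s) (0, 1)) (b := m.2) ?_ ?_ ?_ ?_ m.2 ⟨hm.1, le_rfl⟩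
    · have := hZc.continuous; fun_prop
    · intro s _
      have h1 : HasDerivAt (fun s : ℝ => ((m.1, s) : ℝ × ℝ)) (0, 1) s :=
        (hasDerivAt_const s m.1).prodMk (hasDerivAt_id s)
      exact (HasFDerivAt.comp_hasDerivAt (f := fun s : ℝ => ((m.1, s) : ℝ × ℝ)) s
        ((hZc.differentiable (by simp)) (m.1, s)).hasFDerivAt h1).hasDerivWithinAt
    · simp only [hZ, y, x, h0]
      simp
    · intro s hs
      have hms := vertical_mem_cone hm ⟨hs.1, hs.2.le⟩
      rw [hZd _ hms, norm_neg, add_zero]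
      refine (A.br.le_opNorm₂ _ _).trans ?_
      gcongr
      exact hC _ hms
  rw [gronwallBound_ε0_δ0] at key
  have := norm_le_zero_iff.1 key
  exact eq_neg_of_add_eq_zero_left this

end FrameData

end

/-! ### The energy estimate for the component along the orbits -/

section

namespace FrameData

variable {E : Type*} [NormedAddCommGroup E] [NormedSpace ℝ E]
  (A : FrameData E)

/-- The linear factor ‖a‖ is replaced by 1 + g(a, a), via 2‖a‖ ≤ 1 + ‖a‖², because the energy flux
controls the integral of the square along an edge. -/
theorem exists_bracket_bound {C : ℝ} (hC : 0 < C) (hn : ∀ a, ‖a‖ ^ 2 ≤ C * A.g a a) :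
    ∃ C₁ : ℝ, 0 ≤ C₁ ∧ ∀ a y, |2 * A.g y (A.br a y)| ≤ C₁ * (1 + A.g a a) * A.g y y := by
  refine ⟨‖A.g‖ * ‖A.br‖ * C * (1 + C), by positivity, fun a y => ?_⟩
  have h1 : |A.g y (A.br a y)| ≤ ‖A.g‖ * ‖A.br‖ * ‖a‖ * ‖y‖ ^ 2 := by
    refine (A.g.le_opNorm₂ _ _).trans ?_
    calc _ ≤ ‖A.g‖ * ‖y‖ * (‖A.br‖ * ‖a‖ * ‖y‖) := by gcongr; exact A.br.le_opNorm₂ _ _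
      _ = _ := by ring
  have h2 : 2 * ‖a‖ ≤ (1 + C) * (1 + A.g a a) := by
    have := hn a
    have := A.g_self_nonneg a
    nlinarith [sq_nonneg (‖a‖ - 1)]
  have h3 := hn y
  have h4 := A.g_self_nonneg a
  have h5 := A.g_self_nonneg y
  rw [abs_mul, abs_two]
  calc 2 * |A.g y (A.br a y)| ≤ ‖A.g‖ * ‖A.br‖ * (2 * ‖a‖) * ‖y‖ ^ 2 := by linarith
    _ ≤ ‖A.g‖ * ‖A.br‖ * ((1 + C) * (1 + A.g a a)) * (C * A.g y y) := by gcongr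
    _ = _ := by ring

variable [FiniteDimensional ℝ E]

/-- The energy-momentum one-form has a primitive on a triangle. -/
theorem exists_energy_potential {u : ℝ × ℝ → Fin 3 → E} (hu : ContDiff ℝ ∞ u)
    (h0 : ∀ x, fderiv ℝ (fun m => u m 2) (x, 0) (1, 0) = -A.br (xPart (u (x, 0))) (u (x, 0) 2))
    {p : ℝ × ℝ} (hp : 0 < p.2) (h : ∀ m ∈ cone p, SolvesAt speed A.nonlin u m) :
    ∃ w : ℝ × ℝ → ℝ, ∀ m ∈ cone p, HasFDerivWithinAt w
      (A.energy (tPart (u m)) (xPart (u m)) (u m 2) • ContinuousLinearMap.fst ℝ ℝ ℝ +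
        A.flux (tPart (u m)) (xPart (u m)) (u m 2) • ContinuousLinearMap.snd ℝ ℝ ℝ) (cone p) m := by
  set t := fun m => tPart (u m) with htdef
  set x := fun m => xPart (u m) with hxdef
  set y := fun m => u m 2 with hydef
  have td : Differentiable ℝ t := (contDiff_tPart hu).differentiable (by simp)
  have xd : Differentiable ℝ x := (contDiff_xPart hu).differentiable (by simp)
  have yd : Differentiable ℝ y :=
    (show ContDiff ℝ ∞ fun m => u m 2 by fun_prop).differentiable (by simp)
  set e := fun m => A.energy (t m) (x m) (y m) with he
  set f := fun m => A.flux (t m) (x m) (y m) with hf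
  have ed : Differentiable ℝ e := by unfold e energy; fun_prop
  have fd : Differentiable ℝ f := by unfold f flux; fun_prop
  have hω : ∀ m, HasFDerivAt
      (fun m => e m • ContinuousLinearMap.fst ℝ ℝ ℝ + f m • ContinuousLinearMap.snd ℝ ℝ ℝ)
      ((fderiv ℝ e m).smulRight (ContinuousLinearMap.fst ℝ ℝ ℝ) +
        (fderiv ℝ f m).smulRight (ContinuousLinearMap.snd ℝ ℝ ℝ)) m := fun m =>
    ((ed m).hasFDerivAt.smul_const (ContinuousLinearMap.fst ℝ ℝ ℝ)).add
      ((fd m).hasFDerivAt.smul_const (ContinuousLinearMap.snd ℝ ℝ ℝ))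
  -- Poincaré lemma on the convex triangle: the one-form e dx + f dt is closed precisely by the
  -- conservation law `claw`.
  refine (convex_cone p).exists_forall_hasFDerivWithinAt_of_hasFDerivWithinAt_symmetric
    (fun m _ => (hω m).hasFDerivWithinAt) fun m hm d _ d' _ => ?_
  have cons := A.constraint_propagates hu h0 hp h hm
  obtain ⟨e1, e2, e3⟩ := (A.solvesAt_iff ((hu.differentiable (by simp)) m)).1 (h m hm)
  have claw : fderiv ℝ e m (0, 1) = fderiv ℝ f m (1, 0) := by
    rw [he, hf, A.fderiv_energy (td m) (xd m) (yd m), A.fderiv_flux (td m) (xd m) (yd m)]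
    have e1' : fderiv ℝ t m (0, 1) = _ := e1
    have e2' : fderiv ℝ x m (0, 1) = _ := e2
    have e3' : fderiv ℝ y m (0, 1) = _ := e3
    have cons' : fderiv ℝ y m (1, 0) = _ := cons
    rw [e1', e2', e3', cons']
    exact A.energy_identity _ _ _ _ _ _ (A.g_source _ _ _ _)
  have hdec : ∀ (l : ℝ × ℝ →L[ℝ] ℝ) (d : ℝ × ℝ), l d = d.1 * l (1, 0) + d.2 * l (0, 1) := by
    intro l d
    have : d = d.1 • ((1, 0) : ℝ × ℝ) + d.2 • ((0, 1) : ℝ × ℝ) := by ext <;> simp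
    calc l d = l (d.1 • ((1, 0) : ℝ × ℝ) + d.2 • ((0, 1) : ℝ × ℝ)) := by rw [← this]
      _ = _ := by rw [map_add, map_smul, map_smul, smul_eq_mul, smul_eq_mul]
  simp only [add_apply, ContinuousLinearMap.smulRight_apply, smul_apply, smul_eq_mul,
    ContinuousLinearMap.coe_fst', ContinuousLinearMap.coe_snd']
  rw [hdec (fderiv ℝ e m) d, hdec (fderiv ℝ e m) d', hdec (fderiv ℝ f m) d,
    hdec (fderiv ℝ f m) d', claw]
  ring

/-- The energy estimate: the frame component along the orbits is bounded at the tip of a triangle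
in terms of the data on its base. -/
theorem orbit_component_le {k C₁ : ℝ} (hk : 0 < k)
    (hsmall : ∀ e h, 1 / k * (A.g e e + A.g h h) ≤
      A.g e e + A.g h h + 2 * A.lam * A.v 2 * A.p h e) (hC₁ : 0 ≤ C₁)
    (hbr : ∀ a y, |2 * A.g y (A.br a y)| ≤ C₁ * (1 + A.g a a) * A.g y y)
    {u : ℝ × ℝ → Fin 3 → E} (hu : ContDiff ℝ ∞ u)
    (h0 : ∀ x, fderiv ℝ (fun m => u m 2) (x, 0) (1, 0) = -A.br (xPart (u (x, 0))) (u (x, 0) 2))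
    {p : ℝ × ℝ} (hp : 0 < p.2) (h : ∀ m ∈ cone p, SolvesAt speed A.nonlin u m) {M : ℝ}
    (hM : ∀ x, (x, 0) ∈ cone p → A.energy (tPart (u (x, 0))) (xPart (u (x, 0))) (u (x, 0) 2) ≤ M) :
    A.g (u p 2) (u p 2) ≤ A.g (u (p.1 + p.2, 0) 2) (u (p.1 + p.2, 0) 2) *
      Real.exp (C₁ * (p.2 + 2 * k * (M * (2 * p.2)))) := by
  obtain ⟨w, hw⟩ := A.exists_energy_potential hu h0 hp h
  have yd : Differentiable ℝ fun m => u m 2 :=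
    (show ContDiff ℝ ∞ fun m => u m 2 by fun_prop).differentiable (by simp)
  have hIcc : interior (Icc 0 p.2) = Ioo 0 p.2 := interior_Icc
  -- the right edge
  set γ : ℝ → ℝ × ℝ := fun s => (p.1 + (p.2 - s), s) with hγ
  have hγd : ∀ s, HasDerivAt γ (-1, 1) s := fun s =>
    (((hasDerivAt_id s).const_sub p.2).const_add p.1).prodMk (hasDerivAt_id s)
  have hγm : MapsTo γ (Icc 0 p.2) (cone p) := fun s hs => right_mem_cone hs
  have hwγ : ∀ s ∈ Icc 0 p.2, HasDerivWithinAt (fun s => w (γ s))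
      (A.flux (tPart (u (γ s))) (xPart (u (γ s))) (u (γ s) 2) -
        A.energy (tPart (u (γ s))) (xPart (u (γ s))) (u (γ s) 2)) (Icc 0 p.2) s := fun s hs => by
    have := (hw _ (hγm hs)).comp_hasDerivWithinAt s (hγd s).hasDerivWithinAt hγm
    refine this.congr_deriv ?_
    simp
    ring
  set n : ℝ → ℝ := fun s => A.g (u (γ s) 2) (u (γ s) 2) with hn
  have hnd : ∀ s ∈ Icc 0 p.2, HasDerivAt n
      (-(2 * A.g (u (γ s) 2) (A.br (tPart (u (γ s)) - xPart (u (γ s))) (u (γ s) 2)))) s := by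
    intro s hs
    have hy : HasDerivAt (fun s => u (γ s) 2) (fderiv ℝ (fun m => u m 2) (γ s) (-1, 1)) s :=
      (yd (γ s)).hasFDerivAt.comp_hasDerivAt s (hγd s)
    have e : ((-1, 1) : ℝ × ℝ) = (0, 1) - (1, 0) := by ext <;> simp
    rw [e, map_sub, A.constraint_propagates hu h0 hp h (hγm hs),
      ((A.solvesAt_iff ((hu.differentiable (by simp)) _)).1 (h _ (hγm hs))).2.2] at hy
    have h1 : HasDerivAt (fun s => A.g (u (γ s) 2)) _ s := A.g.hasFDerivAt.comp_hasDerivAt s hy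
    refine (h1.clm_apply hy).congr_deriv ?_
    rw [A.g_symm _ (u (γ s) 2)]
    simp only [map_sub, sub_apply, map_neg]
    ring
  -- Integrating factor for |y|² along the edge. There |y|² grows at rate at most C₁(1 + |t - x|²),
  -- which is at most C₁(1 + 2k(e - f)), and `w` decreases at rate e - f.
  set ψ : ℝ → ℝ := fun s => n s * Real.exp (-C₁ * (s - 2 * k * w (γ s))) with hψ
  have hψd : ∀ s ∈ Icc 0 p.2, HasDerivWithinAt ψ
      ((-(2 * A.g (u (γ s) 2) (A.br (tPart (u (γ s)) - xPart (u (γ s))) (u (γ s) 2))) +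
        n s * (-C₁ * (1 - 2 * k *
          (A.flux (tPart (u (γ s))) (xPart (u (γ s))) (u (γ s) 2) -
            A.energy (tPart (u (γ s))) (xPart (u (γ s))) (u (γ s) 2))))) *
        Real.exp (-C₁ * (s - 2 * k * w (γ s)))) (Icc 0 p.2) s := fun s hs =>
    ((hnd s hs).hasDerivWithinAt.mul
      ((((hasDerivAt_id s).hasDerivWithinAt.sub ((hwγ s hs).const_mul (2 * k))).const_mul
        (-C₁)).exp)).congr_deriv (by simp only [Pi.sub_apply, id]; ring)
  have hanti : AntitoneOn ψ (Icc 0 p.2) := by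
    refine antitoneOn_of_hasDerivWithinAt_nonpos (convex_Icc _ _)
      (fun s hs => (hψd s hs).continuousWithinAt)
      (fun s hs => (hψd s (interior_subset hs)).mono interior_subset) fun s hs => ?_
    set t := tPart (u (γ s))
    set x := xPart (u (γ s))
    set y := u (γ s) 2
    have h1 := A.energy_sub_flux t x y
    have h2 := hsmall y (t - x)
    have h3 := abs_le.1 (hbr (t - x) y)
    have h4 := A.g_self_nonneg y
    have h5 := A.g_self_nonneg (t - x)
    have h6 : A.g (t - x) (t - x) ≤ 2 * k * (A.energy t x y - A.flux t x y) := by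
      rw [h1]
      rw [div_mul_eq_mul_div, one_mul, div_le_iff₀ hk] at h2
      linarith
    have h7 : C₁ * (1 + A.g (t - x) (t - x)) * A.g y y ≤
        C₁ * (1 + 2 * k * (A.energy t x y - A.flux t x y)) * A.g y y := by gcongr
    have h8 : n s = A.g y y := rfl
    rw [h8]
    have hexp := Real.exp_pos (-C₁ * (s - 2 * k * w (γ s)))
    have : -(2 * A.g y (A.br (t - x) y)) +
        A.g y y * (-C₁ * (1 - 2 * k * (A.flux t x y - A.energy t x y))) ≤ 0 := by
      linarith [h3.1]
    exact mul_nonpos_of_nonpos_of_nonneg this hexp.le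
  -- the left edge
  set γ' : ℝ → ℝ × ℝ := fun s => (p.1 - (p.2 - s), s) with hγ'
  have hγd' : ∀ s, HasDerivAt γ' (1, 1) s := fun s => by
    have := (((hasDerivAt_id s).const_sub p.2).const_sub p.1).prodMk (hasDerivAt_id s)
    simpa using this
  have hγm' : MapsTo γ' (Icc 0 p.2) (cone p) := fun s hs => left_mem_cone hs
  have hwγ' : ∀ s ∈ Icc 0 p.2, HasDerivWithinAt (fun s => w (γ' s))
      (A.energy (tPart (u (γ' s))) (xPart (u (γ' s))) (u (γ' s) 2) +
        A.flux (tPart (u (γ' s))) (xPart (u (γ' s))) (u (γ' s) 2)) (Icc 0 p.2) s := fun s hs => by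
    have := (hw _ (hγm' hs)).comp_hasDerivWithinAt s (hγd' s).hasDerivWithinAt hγm'
    refine this.congr_deriv ?_
    simp
  -- The flux e + f through the left edge is nonnegative by smallness, so it can be discarded.
  have hmono : MonotoneOn (fun s => w (γ' s)) (Icc 0 p.2) := by
    refine monotoneOn_of_hasDerivWithinAt_nonneg (convex_Icc _ _)
      (fun s hs => (hwγ' s hs).continuousWithinAt)
      (fun s hs => (hwγ' s (interior_subset hs)).mono interior_subset) fun s hs => ?_
    rw [A.energy_add_flux]
    have h4 := A.g_self_nonneg (u (γ' s) 2)
    have h5 := A.g_self_nonneg (tPart (u (γ' s)) + xPart (u (γ' s)))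
    have h6 := hsmall (u (γ' s) 2) (-(tPart (u (γ' s)) + xPart (u (γ' s))))
    rw [map_neg A.g, neg_apply, map_neg (A.g _), neg_neg] at h6
    exact mul_nonneg (by norm_num) (le_trans (by positivity) h6)
  -- the base
  have hbase : ∀ x ∈ Icc (p.1 - p.2) (p.1 + p.2), (x, (0 : ℝ)) ∈ cone p := fun x hx =>
    ⟨le_rfl, abs_le.2 ⟨by dsimp only; linarith [hx.1], by dsimp only; linarith [hx.2]⟩⟩
  have hwb : ∀ x ∈ Icc (p.1 - p.2) (p.1 + p.2), HasDerivWithinAt (fun x => M * x - w (x, 0))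
      (M * 1 - A.energy (tPart (u (x, 0))) (xPart (u (x, 0))) (u (x, 0) 2))
      (Icc (p.1 - p.2) (p.1 + p.2)) x := fun x hx => by
    have h1 : HasDerivAt (fun x : ℝ => ((x, 0) : ℝ × ℝ)) (1, 0) x :=
      (hasDerivAt_id x).prodMk (hasDerivAt_const x 0)
    have := (hw _ (hbase x hx)).comp_hasDerivWithinAt x h1.hasDerivWithinAt hbase
    refine ((hasDerivAt_id x).hasDerivWithinAt.const_mul M).sub (this.congr_deriv ?_)
    simp
  have hmonob : MonotoneOn (fun x => M * x - w (x, 0)) (Icc (p.1 - p.2) (p.1 + p.2)) := by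
    refine monotoneOn_of_hasDerivWithinAt_nonneg (convex_Icc _ _)
      (fun s hs => (hwb s hs).continuousWithinAt)
      (fun s hs => (hwb s (interior_subset hs)).mono interior_subset) fun s hs => ?_
    linarith [hM s (hbase s (interior_subset hs))]
  have h1 := hanti (left_mem_Icc.2 hp.le) (right_mem_Icc.2 hp.le) hp.le
  have h2 := hmono (left_mem_Icc.2 hp.le) (right_mem_Icc.2 hp.le) hp.le
  have h3 := hmonob (left_mem_Icc.2 (by linarith)) (right_mem_Icc.2 (by linarith))
    (by linarith : p.1 - p.2 ≤ p.1 + p.2)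
  simp only [hψ, hn, hγ, hγ', sub_self, add_zero, sub_zero, zero_sub, Prod.mk.eta] at h1 h2 h3
  rw [← le_div_iff₀ (Real.exp_pos _), mul_div_assoc, ← Real.exp_sub] at h1
  refine h1.trans (mul_le_mul_of_nonneg_left (Real.exp_le_exp.2 ?_) (A.g_self_nonneg _))
  -- The increment of `w` from the tip down the right edge is at most its increment over the base,
  -- that is, at most `M` times the base length 2 `p.2`.
  have : w (p.1 + p.2, 0) - w p ≤ M * (2 * p.2) := by linarith
  have h4 : C₁ * (2 * k) * (w (p.1 + p.2, 0) - w p) ≤ C₁ * (2 * k) * (M * (2 * p.2)) := by gcongr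
  linarith

end FrameData

end

/-! ### The maximum principle for the characteristic components and the global reduced solution -/

section

/-- Difference quotients from the left are nonnegative, which suffices when the maximum sits at the
right end of the interval, as at the tip of a characteristic. -/
theorem derivative_nonneg_of_max_right {φ : ℝ → ℝ} {d τ : ℝ} (h : HasDerivAt φ d τ) (hτ : 0 < τ)
    (hmax : ∀ s ∈ Icc 0 τ, φ s ≤ φ τ) : 0 ≤ d := by
  have h1 : Tendsto (slope φ τ) (𝓝[<] τ) (𝓝 d) :=
    (hasDerivAt_iff_tendsto_slope.1 h).mono_left (nhdsWithin_mono _ fun s hs => ne_of_lt hs)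
  refine ge_of_tendsto h1 ?_
  filter_upwards [Ioo_mem_nhdsLT hτ] with s hs
  rw [slope_def_field]
  exact div_nonneg_of_nonpos (sub_nonpos.2 (hmax s ⟨hs.1.le, hs.2.le⟩)) (sub_nonpos.2 hs.2.le)

namespace FrameData

variable {E : Type*} [NormedAddCommGroup E] [NormedSpace ℝ E] (A : FrameData E)

-- Each term has the size |y|²|z|, |y||x||z| or |y||t||z|. Once |y| is bounded, all are at most
-- quadratic in t + x and t - x; without the null cancellation a cubic term would remain.
set_option maxHeartbeats 800000 in
theorem exists_remainder_bound {C : ℝ} (hC : 0 < C) (hn : ∀ a, ‖a‖ ^ 2 ≤ C * A.g a a) {Y : ℝ}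
    (hY : 0 ≤ Y) : ∃ C₂ : ℝ, 0 ≤ C₂ ∧ ∀ t x y z : E, A.g y y ≤ Y →
      ‖z‖ ^ 2 ≤ ‖t + x‖ ^ 2 + ‖t - x‖ ^ 2 →
      2 * (-A.g y (A.br y z) - A.lam * (A.v 2 * A.dp x y z + A.v 0 * A.dp y t z)) ≤
        C₂ * (1 + A.g (t + x) (t + x) + A.g (t - x) (t - x)) := by
  set η := 1 + C * Y with hη
  have hη0 : 0 ≤ η := by positivity
  set K := ‖A.g‖ * ‖A.br‖ * η + |A.lam| * ((|A.v 2| + |A.v 0|) * (3 * ‖A.p‖ * ‖A.br‖ * η)) with hK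
  have hK0 : 0 ≤ K := by positivity
  refine ⟨2 * K * (1 + C), by positivity, fun t x y z hy hz => ?_⟩
  set q := ‖t + x‖ ^ 2 + ‖t - x‖ ^ 2 with hq
  have hq0 : 0 ≤ q := by positivity
  have hy2 : ‖y‖ ^ 2 ≤ η := by
    have := hn y
    have : C * A.g y y ≤ C * Y := by gcongr
    linarith
  have hy1 : ‖y‖ ≤ η := by
    have := hn y
    have : C * A.g y y ≤ C * Y := by gcongr
    nlinarith [sq_nonneg (‖y‖ - 1)]
  have hx2 : ‖x‖ ^ 2 ≤ q := by
    have e : x = (1 / 2 : ℝ) • ((t + x) - (t - x)) := by module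
    have h1 : ‖x‖ ≤ 1 / 2 * (‖t + x‖ + ‖t - x‖) := by
      conv_lhs => rw [e, norm_smul]
      rw [Real.norm_of_nonneg (by norm_num)]
      gcongr
      exact norm_sub_le _ _
    nlinarith [sq_nonneg (‖t + x‖ - ‖t - x‖), norm_nonneg x, norm_nonneg (t + x),
      norm_nonneg (t - x)]
  have ht2 : ‖t‖ ^ 2 ≤ q := by
    have e : t = (1 / 2 : ℝ) • ((t + x) + (t - x)) := by module
    have h1 : ‖t‖ ≤ 1 / 2 * (‖t + x‖ + ‖t - x‖) := by
      conv_lhs => rw [e, norm_smul]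
      rw [Real.norm_of_nonneg (by norm_num)]
      gcongr
      exact norm_add_le _ _
    nlinarith [sq_nonneg (‖t + x‖ - ‖t - x‖), norm_nonneg t, norm_nonneg (t + x),
      norm_nonneg (t - x)]
  have hz1 : ‖z‖ ≤ 1 + q := by nlinarith [sq_nonneg (‖z‖ - 1)]
  have hprod : ∀ b : E, ‖b‖ ^ 2 ≤ q → ‖b‖ * ‖z‖ ≤ 1 + q := fun b hb => by
    nlinarith [sq_nonneg (‖b‖ - ‖z‖)]
  have h1 : |A.g y (A.br y z)| ≤ ‖A.g‖ * ‖A.br‖ * η * (1 + q) := by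
    refine (A.g.le_opNorm₂ _ _).trans ?_
    calc _ ≤ ‖A.g‖ * ‖y‖ * (‖A.br‖ * ‖y‖ * ‖z‖) := by gcongr; exact A.br.le_opNorm₂ _ _
      _ = ‖A.g‖ * ‖A.br‖ * ‖y‖ ^ 2 * ‖z‖ := by ring
      _ ≤ _ := by gcongr
  have h2 : |A.dp x y z| ≤ 3 * ‖A.p‖ * ‖A.br‖ * η * (1 + q) := by
    refine (A.norm_dp_le _ _ _).trans ?_
    calc _ = 3 * ‖A.p‖ * ‖A.br‖ * ‖y‖ * (‖x‖ * ‖z‖) := by ring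
      _ ≤ _ := by gcongr; exact hprod x hx2
  have h3 : |A.dp y t z| ≤ 3 * ‖A.p‖ * ‖A.br‖ * η * (1 + q) := by
    refine (A.norm_dp_le _ _ _).trans ?_
    calc _ = 3 * ‖A.p‖ * ‖A.br‖ * ‖y‖ * (‖t‖ * ‖z‖) := by ring
      _ ≤ _ := by gcongr; exact hprod t ht2
  have h4 : |A.v 2 * A.dp x y z + A.v 0 * A.dp y t z| ≤
      (|A.v 2| + |A.v 0|) * (3 * ‖A.p‖ * ‖A.br‖ * η * (1 + q)) := by
    refine (abs_add_le _ _).trans ?_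
    rw [abs_mul, abs_mul, add_mul]
    gcongr
  have h5 : |A.lam * (A.v 2 * A.dp x y z + A.v 0 * A.dp y t z)| ≤
      |A.lam| * ((|A.v 2| + |A.v 0|) * (3 * ‖A.p‖ * ‖A.br‖ * η * (1 + q))) := by
    rw [abs_mul]; gcongr
  have h6 : -A.g y (A.br y z) - A.lam * (A.v 2 * A.dp x y z + A.v 0 * A.dp y t z) ≤
      K * (1 + q) := by
    have := neg_abs_le (A.g y (A.br y z))
    have := neg_abs_le (A.lam * (A.v 2 * A.dp x y z + A.v 0 * A.dp y t z))
    rw [hK]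
    linarith
  have h7 : 1 + q ≤ (1 + C) * (1 + A.g (t + x) (t + x) + A.g (t - x) (t - x)) := by
    have := hn (t + x)
    have := hn (t - x)
    have := A.g_self_nonneg (t + x)
    have := A.g_self_nonneg (t - x)
    rw [add_mul, mul_add, mul_add]
    linarith
  calc _ ≤ 2 * (K * (1 + q)) := by linarith
    _ ≤ 2 * (K * ((1 + C) * (1 + A.g (t + x) (t + x) + A.g (t - x) (t - x)))) := by gcongr
    _ = _ := by ring

variable [FiniteDimensional ℝ E]

/-- The null identities `force_add` and `force_sub` leave exactly the remainder estimated before.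
The constant depends on the bound `Y` for the orbit component, which must therefore come first. -/
theorem exists_nonlin_bound {C : ℝ} (hC : 0 < C) (hn : ∀ a, ‖a‖ ^ 2 ≤ C * A.g a a) {Y : ℝ}
    (hY : 0 ≤ Y) : ∃ C₂ : ℝ, 0 ≤ C₂ ∧ ∀ u : Fin 3 → E, A.g (u 2) (u 2) ≤ Y → ∀ i, i = 0 ∨ i = 1 →
      2 * A.g (u i) (A.nonlin u i) ≤ C₂ * (1 + A.g (u 0) (u 0) + A.g (u 1) (u 1)) := by
  obtain ⟨C₂, h0, h⟩ := A.exists_remainder_bound hC hn hY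
  refine ⟨C₂, h0, fun u hu i hi => ?_⟩
  rcases hi with rfl | rfl
  · have e : A.g (u 0) (A.nonlin u 0) = A.force (tPart u) (xPart u) (u 2) (tPart u + xPart u) -
        A.g (tPart u + xPart u) (A.br (tPart u) (xPart u)) := by
      rw [tPart_add_xPart]
      simp [nonlin, A.g_source]
    rw [e, A.force_add]
    have := h (tPart u) (xPart u) (u 2) (tPart u + xPart u) hu (by simp)
    rwa [tPart_add_xPart, tPart_sub_xPart] at *
  · have e : A.g (u 1) (A.nonlin u 1) = A.force (tPart u) (xPart u) (u 2) (tPart u - xPart u) +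
        A.g (tPart u - xPart u) (A.br (tPart u) (xPart u)) := by
      rw [tPart_sub_xPart]
      simp [nonlin, A.g_source]
    rw [e, A.force_sub]
    have := h (tPart u) (xPart u) (u 2) (tPart u - xPart u) hu (by simp)
    rwa [tPart_add_xPart, tPart_sub_xPart] at *

/-- The characteristic components are bounded on a triangle by the maximum principle. -/
theorem char_component_le {C₂ Y B : ℝ} (hC₂ : 0 ≤ C₂)
    (hN : ∀ u : Fin 3 → E, A.g (u 2) (u 2) ≤ Y → ∀ i, i = 0 ∨ i = 1 →
      2 * A.g (u i) (A.nonlin u i) ≤ C₂ * (1 + A.g (u 0) (u 0) + A.g (u 1) (u 1)))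
    {u : ℝ × ℝ → Fin 3 → E} (hu : ContDiff ℝ ∞ u) {p : ℝ × ℝ} (hp : 0 ≤ p.2)
    (h : ∀ m ∈ cone p, SolvesAt speed A.nonlin u m) (hY : ∀ m ∈ cone p, A.g (u m 2) (u m 2) ≤ Y)
    (hB : ∀ x, (x, 0) ∈ cone p → ∀ i, i = 0 ∨ i = 1 → A.g (u (x, 0) i) (u (x, 0) i) ≤ B)
    (i : Fin 3) (hi : i = 0 ∨ i = 1) :
    A.g (u p i) (u p i) ≤ (1 + B) * Real.exp ((2 * C₂ + 1) * p.2) := by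
  -- At a maximum of the larger of the two weighted functions, the growth is at most 2 `C₂` times 1
  -- + |u i|². The extra 1 in `μ` makes the derivative along the characteristic strictly negative,
  -- which excludes a maximum above the base.
  set μ := 2 * C₂ + 1 with hμ
  set F : Fin 3 → ℝ × ℝ → ℝ := fun i m => Real.exp (-μ * m.2) * (1 + A.g (u m i) (u m i)) with hF
  have ud : Differentiable ℝ u := hu.differentiable (by simp)
  have hFc : ∀ i, Continuous (F i) := fun i => by
    have := hu.continuous
    fun_prop
  -- a maximum of one of the two functions, dominating the other, lies on the base
  have step : ∀ m ∈ cone p, ∀ i, i = 0 ∨ i = 1 → (∀ q ∈ cone p, F i q ≤ F i m) →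
      (∀ j, j = 0 ∨ j = 1 → F j m ≤ F i m) → F i m ≤ 1 + B := by
    intro m hm i hi hmax hdom
    rcases hm.1.eq_or_lt with h0 | h0
    · have e : m = (m.1, 0) := by ext <;> simp [← h0]
      have := hB m.1 (e ▸ hm) i hi
      rw [← e] at this
      simp only [hF, ← h0, mul_zero, Real.exp_zero, one_mul]
      linarith
    · exfalso
      set γ : ℝ → ℝ × ℝ := fun s => (m.1 + speed i * (m.2 - s), s) with hγ
      have hγm : γ m.2 = m := by simp [hγ]
      have hγd : HasDerivAt γ (-speed i, 1) m.2 := by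
        have := ((((hasDerivAt_id m.2).const_sub m.2).const_mul (speed i)).const_add m.1).prodMk
          (hasDerivAt_id m.2)
        simpa using this
      have hγc : ∀ s ∈ Icc 0 m.2, γ s ∈ cone p := fun s hs => by
        refine cone_subset hm ⟨hs.1, ?_⟩
        simp only [hγ, add_sub_cancel_left]
        rw [abs_mul, abs_of_nonneg (sub_nonneg.2 hs.2)]
        exact mul_le_of_le_one_left (sub_nonneg.2 hs.2) (abs_speed_le i)
      have hui : HasDerivAt (fun s => u (γ s) i) (A.nonlin (u m) i) m.2 := by
        have h1 := HasFDerivAt.comp_hasDerivAt (f := γ) m.2 (ud (γ m.2)).hasFDerivAt hγd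
        rw [hγm] at h1
        have h2 := hasDerivAt_pi.1 h1 i
        rwa [h m hm i] at h2
      have hgi : HasDerivAt (fun s => A.g (u (γ s) i)) _ m.2 :=
        A.g.hasFDerivAt.comp_hasDerivAt m.2 hui
      have hexp : HasDerivAt (fun s => Real.exp (-μ * s)) (Real.exp (-μ * m.2) * (-μ * 1)) m.2 :=
        ((hasDerivAt_id m.2).const_mul (-μ)).exp
      have hφ : HasDerivAt (fun s => F i (γ s)) _ m.2 :=
        hexp.mul ((hgi.clm_apply hui).const_add 1)
      have hd := derivative_nonneg_of_max_right hφ h0 (fun s hs => by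
        simp only [hγm]
        exact hmax _ (hγc s hs))
      rw [hγm, A.g_symm (A.nonlin (u m) i)] at hd
      have hb := hN (u m) (hY m hm) i hi
      have hle : ∀ j, j = 0 ∨ j = 1 → A.g (u m j) (u m j) ≤ A.g (u m i) (u m i) := fun j hj => by
        have := hdom j hj
        simp only [hF] at this
        have := le_of_mul_le_mul_left this (Real.exp_pos _)
        linarith
      have h00 := hle 0 (Or.inl rfl)
      have h11 := hle 1 (Or.inr rfl)
      have hnn := A.g_self_nonneg (u m i)
      have hE := Real.exp_pos (-μ * m.2)
      have hneg : -μ * (1 + A.g (u m i) (u m i)) + 2 * A.g (u m i) (A.nonlin (u m) i) < 0 := by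
        have : C₂ * (1 + A.g (u m 0) (u m 0) + A.g (u m 1) (u m 1)) ≤
            C₂ * (2 * (1 + A.g (u m i) (u m i))) := by gcongr; linarith
        rw [hμ]
        nlinarith
      nlinarith [mul_neg_of_pos_of_neg hE hneg]
  have hne : (cone p).Nonempty := ⟨p, self_mem_cone hp⟩
  obtain ⟨m0, hm0, hmax0⟩ := (isCompact_cone p).exists_isMaxOn hne (hFc 0).continuousOn
  obtain ⟨m1, hm1, hmax1⟩ := (isCompact_cone p).exists_isMaxOn hne (hFc 1).continuousOn
  have key : F i p ≤ 1 + B := by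
    have hp' := self_mem_cone hp
    rcases le_total (F 1 m1) (F 0 m0) with hle | hle
    · have := step m0 hm0 0 (Or.inl rfl) (fun q hq => hmax0 hq) (by
        rintro j (rfl | rfl)
        · exact le_rfl
        · exact (hmax1 hm0).trans hle)
      rcases hi with rfl | rfl
      · exact (hmax0 hp').trans this
      · exact ((hmax1 hp').trans hle).trans this
    · have := step m1 hm1 1 (Or.inr rfl) (fun q hq => hmax1 hq) (by
        rintro j (rfl | rfl)
        · exact (hmax0 hm1).trans hle
        · exact le_rfl)
      rcases hi with rfl | rfl
      · exact ((hmax0 hp').trans hle).trans this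
      · exact (hmax1 hp').trans this
  simp only [hF] at key
  rw [neg_mul, Real.exp_neg, inv_mul_le_iff₀ (Real.exp_pos _)] at key
  linarith

/-- A priori bound on forward triangles. -/
theorem exists_bound_of_pos {a : ℝ → Fin 3 → E} (ha : ContDiff ℝ ∞ a)
    (hca : ∀ x, deriv (fun x => a x 2) x = -A.br (xPart (a x)) (a x 2)) (r : ℝ) :
    ∃ M : ℝ, ∀ u : ℝ × ℝ → Fin 3 → E, ContDiff ℝ ∞ u → (∀ x, u (x, 0) = a x) →
      ∀ p : ℝ × ℝ, 0 < p.2 → |p.1| + |p.2| ≤ r → (∀ m ∈ cone p, SolvesAt speed A.nonlin u m) →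
        ‖u p‖ ≤ M := by
  obtain ⟨k, hk, hsmall⟩ := A.small
  obtain ⟨C, hC, hn⟩ := A.exists_norm_sq_le
  obtain ⟨C₁, hC₁, hbr⟩ := A.exists_bracket_bound hC hn
  have hcont : Continuous fun x => |A.energy (tPart (a x)) (xPart (a x)) (a x 2)| +
      (A.g (a x 0) (a x 0) + A.g (a x 1) (a x 1) + A.g (a x 2) (a x 2)) := by
    have := ha.continuous
    unfold energy tPart xPart
    fun_prop
  obtain ⟨M₁, hM₁⟩ := (isCompact_Icc (a := -r) (b := r)).exists_bound_of_continuousOn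
    hcont.continuousOn
  set M₀ := max M₁ 0 with hM₀
  have hM₀0 : 0 ≤ M₀ := le_max_right _ _
  have hdata : ∀ x, |x| ≤ r → A.energy (tPart (a x)) (xPart (a x)) (a x 2) ≤ M₀ ∧
      A.g (a x 0) (a x 0) ≤ M₀ ∧ A.g (a x 1) (a x 1) ≤ M₀ ∧ A.g (a x 2) (a x 2) ≤ M₀ := by
    intro x hx
    have h1 := (le_abs_self _).trans ((hM₁ x (abs_le.1 hx)).trans (le_max_left M₁ 0))
    have h2 := le_abs_self (A.energy (tPart (a x)) (xPart (a x)) (a x 2))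
    have h3 := abs_nonneg (A.energy (tPart (a x)) (xPart (a x)) (a x 2))
    have h4 := A.g_self_nonneg (a x 0)
    have h5 := A.g_self_nonneg (a x 1)
    have h6 := A.g_self_nonneg (a x 2)
    refine ⟨?_, ?_, ?_, ?_⟩ <;> linarith
  -- The energy estimate with the data bound `M₀` and heights at most `r`. It is applied at every
  -- point of the triangle, each being the tip of a smaller one.
  set Y := M₀ * Real.exp (C₁ * (r + 2 * k * (M₀ * (2 * r)))) with hYdef
  have hY0 : 0 ≤ Y := by positivity
  obtain ⟨C₂, hC₂, hN⟩ := A.exists_nonlin_bound hC hn hY0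
  refine ⟨1 + C * (Y + (1 + M₀) * Real.exp ((2 * C₂ + 1) * r)), fun u hu hu0 p hp hpr h => ?_⟩
  have hr : 0 ≤ r := le_trans (by positivity) hpr
  have h0 : ∀ x, fderiv ℝ (fun m => u m 2) (x, 0) (1, 0) =
      -A.br (xPart (u (x, 0))) (u (x, 0) 2) := by
    intro x
    rw [hu0, ← hca]
    have h1 : HasDerivAt (fun x : ℝ => ((x, 0) : ℝ × ℝ)) (1, 0) x :=
      (hasDerivAt_id x).prodMk (hasDerivAt_const x 0)
    have yd : Differentiable ℝ fun m => u m 2 :=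
      (show ContDiff ℝ ∞ fun m => u m 2 by fun_prop).differentiable (by simp)
    have h2 := HasFDerivAt.comp_hasDerivAt (f := fun x : ℝ => ((x, 0) : ℝ × ℝ)) x
      (yd (x, 0)).hasFDerivAt h1
    have e : (fun x => a x 2) = (fun m => u m 2) ∘ fun x : ℝ => ((x, 0) : ℝ × ℝ) := by
      ext1 x; simp [hu0]
    rw [e, h2.deriv]
  have hbase : ∀ m ∈ cone p, ∀ x, (x, 0) ∈ cone m → |x| ≤ r := fun m hm x hx => by
    have := abs_le_of_mem_cone hpr (cone_subset hm hx)
    simpa using this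
  have hYb : ∀ m ∈ cone p, A.g (u m 2) (u m 2) ≤ Y := by
    intro m hm
    rcases hm.1.eq_or_lt with h0' | h0'
    · have e : m = (m.1, 0) := by ext <;> simp [← h0']
      rw [e, hu0]
      have hm' := hbase m hm m.1 (by rw [← e]; exact self_mem_cone hm.1)
      refine (hdata _ hm').2.2.2.trans ?_
      exact le_mul_of_one_le_right hM₀0 (Real.one_le_exp (by positivity))
    · have h1 := A.orbit_component_le hk hsmall hC₁ hbr hu h0 h0' (M := M₀)
        (fun q hq => h q (cone_subset hm hq)) (fun x hx => by
          rw [hu0]; exact (hdata x (hbase m hm x hx)).1)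
      refine h1.trans ?_
      have h2 : m.2 ≤ r := by
        have := abs_le_of_mem_cone hpr hm
        have := abs_nonneg m.1
        have := le_abs_self m.2
        linarith
      have h3 := (right_mem_cone (p := m) (s := 0) ⟨le_rfl, hm.1⟩)
      rw [sub_zero] at h3
      rw [hYdef, hu0]
      have h4 := (hdata _ (hbase m hm _ h3)).2.2.2
      gcongr
  have hcomp : ∀ i, A.g (u p i) (u p i) ≤ Y + (1 + M₀) * Real.exp ((2 * C₂ + 1) * r) := by
    have hp2 : p.2 ≤ r := by
      have := abs_nonneg p.1
      have := le_abs_self p.2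
      linarith
    have hchar : ∀ i, i = 0 ∨ i = 1 → A.g (u p i) (u p i) ≤
        (1 + M₀) * Real.exp ((2 * C₂ + 1) * r) := fun i hi => by
      have h1 := A.char_component_le (B := M₀) hC₂ hN hu hp.le h hYb (fun x hx i hi => by
        rw [hu0]
        have := hdata x (hbase p (self_mem_cone hp.le) x hx)
        rcases hi with rfl | rfl
        · exact this.2.1
        · exact this.2.2.1) i hi
      refine h1.trans ?_
      gcongr
    intro i
    fin_cases i
    · exact (hchar 0 (Or.inl rfl)).trans (le_add_of_nonneg_left hY0)
    · exact (hchar 1 (Or.inr rfl)).trans (le_add_of_nonneg_left hY0)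
    · exact (hYb p (self_mem_cone hp.le)).trans (le_add_of_nonneg_right (by positivity))
  refine (pi_norm_le_iff_of_nonneg (by positivity)).2 fun i => ?_
  have h1 := hn (u p i)
  have h2 : C * A.g (u p i) (u p i) ≤ C * (Y + (1 + M₀) * Real.exp ((2 * C₂ + 1) * r)) := by
    gcongr
    exact hcomp i
  nlinarith [sq_nonneg (‖u p i‖ - 1)]

/-- The reduced system has global smooth solutions. -/
theorem exists_reduced_solution {a : ℝ → Fin 3 → E} (ha : ContDiff ℝ ∞ a)
    (hca : ∀ x, deriv (fun x => a x 2) x = -A.br (xPart (a x)) (a x 2)) :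
    ∃ u : ℝ × ℝ → Fin 3 → E, ContDiff ℝ ∞ u ∧ (∀ x, u (x, 0) = a x) ∧
      ∀ m, SolvesAt speed A.nonlin u m := by
  refine exists_solution_of_bound abs_speed_le A.contDiff_nonlin ha fun r => ?_
  -- The reflected data are again admissible, and the bound for them on forward triangles is the
  -- bound for the original data on backward ones.
  set a' : ℝ → Fin 3 → E := fun x => -a (-x) with ha'
  have ha's : ContDiff ℝ ∞ a' := (ha.comp contDiff_neg).neg
  have hca' : ∀ x, deriv (fun x => a' x 2) x = -A.br (xPart (a' x)) (a' x 2) := by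
    intro x
    have e : (fun x => a' x 2) = fun x => -(fun x => a x 2) (-x) := rfl
    have e2 : deriv (fun x => (fun x => a x 2) (-x)) x = -deriv (fun x => a x 2) (-x) :=
      deriv_comp_neg (fun x => a x 2) x
    rw [e, deriv.fun_neg, e2, hca]
    simp only [ha', xPart, Pi.neg_apply, map_neg]
    rw [neg_sub_neg, ← neg_sub (a (-x) 0), smul_neg, map_neg, neg_apply]
  obtain ⟨M₁, hM₁⟩ := A.exists_bound_of_pos ha hca r
  obtain ⟨M₂, hM₂⟩ := A.exists_bound_of_pos ha's hca' r
  obtain ⟨M₃, hM₃⟩ := (isCompact_Icc (a := -r) (b := r)).exists_bound_of_continuousOn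
    ha.continuous.continuousOn
  refine ⟨max M₁ (max M₂ M₃), fun u hu hu0 p hpr h => ?_⟩
  rcases lt_trichotomy p.2 0 with hp | hp | hp
  · refine le_trans ?_ ((le_max_left M₂ M₃).trans (le_max_right _ _))
    set u' : ℝ × ℝ → Fin 3 → E := fun m => -u (-m) with hu'
    have := hM₂ u' (hu.comp contDiff_neg).neg (fun x => by simp [hu', ha', ← hu0]) (-p)
      (by simpa using hp) (by simpa using hpr) (fun m hm i => by
        obtain ⟨z, rfl⟩ := mem_cone_iff_aff (by simpa using hp) hm
        have e : Tri.aff (-p) z = -Tri.aff p z := by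
          ext <;> simp [Tri.aff]
          ring
        have hd : HasFDerivAt u' (fderiv ℝ u (Tri.aff p z)) (-Tri.aff p z) := by
          have h1 : HasFDerivAt u (fderiv ℝ u (Tri.aff p z)) (-(-Tri.aff p z)) := by
            rw [neg_neg]; exact ((hu.differentiable (by simp)) _).hasFDerivAt
          have h2 := (h1.comp (-Tri.aff p z) (hasFDerivAt_id (-Tri.aff p z)).neg).neg
          exact h2.congr_fderiv (ContinuousLinearMap.ext fun d => by simp)
        rw [e, hd.fderiv, h z i, hu']
        simp only [neg_neg, A.nonlin_neg])
    simpa [hu'] using this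
  · refine le_trans ?_ ((le_max_right M₂ M₃).trans (le_max_right _ _))
    have e : p = (p.1, 0) := by ext <;> simp [hp]
    rw [e, hu0]
    refine hM₃ _ (abs_le.1 ?_)
    rw [hp] at hpr
    simpa using hpr
  · refine le_trans ?_ (le_max_left _ _)
    refine hM₁ u hu hu0 p hp hpr fun m hm => ?_
    obtain ⟨z, rfl⟩ := mem_cone_iff_aff hp hm
    exact h z

end FrameData

end

section

/-! ### The left logarithmic derivative -/

variable {E : Type*} [NormedAddCommGroup E] [NormedSpace ℝ E]
variable {G : Type*} [TopologicalSpace G] [ChartedSpace E G] [Group G]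
variable {M : Type*} [NormedAddCommGroup M] [NormedSpace ℝ M]
variable {M' : Type*} [NormedAddCommGroup M'] [NormedSpace ℝ M']

/-- The left logarithmic derivative `f⁻¹ df`, with values in the Lie algebra. -/
def logD (f : M → G) (m : M) : M →L[ℝ] E :=
  fderiv ℝ (fun m' => extChartAt 𝓘(ℝ, E) (1 : G) ((f m)⁻¹ * f m')) m

theorem logD_mul_left (c : G) (f : M → G) : logD (E := E) (fun m => c * f m) = logD f := by
  ext m : 1
  unfold logD
  congr 1
  ext m'
  simp [mul_assoc]

theorem logD_congr {f f' : M → G} {m : M} (h : f =ᶠ[𝓝 m] f') : logD (E := E) f m = logD f' m := by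
  refine Filter.EventuallyEq.fderiv_eq ?_
  filter_upwards [h] with m' hm'
  rw [hm', h.self_of_nhds]

/-- The inverse of the chart at the identity. -/
def chartInv (z : E) : G := (extChartAt 𝓘(ℝ, E) (1 : G)).symm z

variable (E G) in
/-- The coordinates of the identity. -/
def coordOne : E := extChartAt 𝓘(ℝ, E) (1 : G) 1

theorem target_mem_nhds : (extChartAt 𝓘(ℝ, E) (1 : G)).target ∈ 𝓝 (coordOne E G) :=
  extChartAt_target_mem_nhds (I := 𝓘(ℝ, E)) (1 : G)

theorem chartInv_coordOne : chartInv (coordOne E G) = (1 : G) := by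
  simp [chartInv, coordOne]

variable (G) in
/-- The Maurer–Cartan form in the chart at the identity. -/
def mcForm (z : E) : E →L[ℝ] E := logD (chartInv (G := G)) z

/-- The coordinates of `(f m)⁻¹ * f m'`. -/
def localCoord {X : Type*} (f : X → G) (m m' : X) : E := extChartAt 𝓘(ℝ, E) (1 : G) ((f m)⁻¹ * f m')

theorem localCoord_self {X : Type*} (f : X → G) (m : X) : localCoord f m m = coordOne E G := by
  simp [localCoord, coordOne]

variable (E G) in
/-- The Lie bracket. -/
def lieBr : E →L[ℝ] E →L[ℝ] E :=
  (fderiv ℝ (mcForm G) (coordOne E G)).flip - fderiv ℝ (mcForm G) (coordOne E G)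

theorem lieBr_apply (u w : E) : lieBr E G u w =
    fderiv ℝ (mcForm G) (coordOne E G) w u - fderiv ℝ (mcForm G) (coordOne E G) u w := rfl

theorem lieBr_self (u : E) : lieBr E G u u = 0 := by simp [lieBr_apply]

theorem lieBr_symm (u w : E) : lieBr E G u w = -lieBr E G w u := by simp [lieBr_apply]

theorem mcForm_coordOne : mcForm G (coordOne E G) = ContinuousLinearMap.id ℝ E := by
  have h : (fun z => extChartAt 𝓘(ℝ, E) (1 : G) ((chartInv (coordOne E G))⁻¹ * chartInv z))
      =ᶠ[𝓝 (coordOne E G)] id := by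
    filter_upwards [target_mem_nhds] with z hz
    rw [chartInv_coordOne, inv_one, one_mul]
    exact (extChartAt 𝓘(ℝ, E) (1 : G)).right_inv hz
  unfold mcForm logD
  rw [h.fderiv_eq, fderiv_id]

section

variable [LieGroup 𝓘(ℝ, E) ∞ G]

theorem contMDiffAt_chart_mul {f h : M → G} {m : M} (hf : ContMDiffAt 𝓘(ℝ, M) 𝓘(ℝ, E) ∞ f m)
    (hh : ContMDiffAt 𝓘(ℝ, M) 𝓘(ℝ, E) ∞ h m) (he : f m = h m) :
    ContDiffAt ℝ ∞ (fun m' => extChartAt 𝓘(ℝ, E) (1 : G) ((f m')⁻¹ * h m')) m := by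
  rw [← contMDiffAt_iff_contDiffAt]
  have h1 : ContMDiffAt 𝓘(ℝ, M) 𝓘(ℝ, E) ∞ (fun m' => (f m')⁻¹ * h m') m := hf.inv.mul hh
  have : IsManifold 𝓘(ℝ, E) ∞ G := inferInstance
  refine ContMDiffAt.comp (g := extChartAt 𝓘(ℝ, E) (1 : G)) m ?_ h1
  exact contMDiffAt_extChartAt' (by simp [he])

/-- The map (m, m') ↦ (f m)⁻¹ f m' is jointly smooth in the chart near the diagonal, and `logD` is
its partial derivative in m'. -/
theorem contDiffAt_logD {f : M → G} {m : M} (hf : ContMDiffAt 𝓘(ℝ, M) 𝓘(ℝ, E) ∞ f m) :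
    ContDiffAt ℝ ∞ (logD (E := E) f) m := by
  refine ContDiffAt.fderiv (f := fun m m' => extChartAt 𝓘(ℝ, E) (1 : G) ((f m)⁻¹ * f m'))
    (g := fun m => m) (n := ∞) ?_ contDiffAt_id (by simp)
  refine contMDiffAt_chart_mul (f := fun q : M × M => f q.1) (h := fun q : M × M => f q.2) ?_ ?_ rfl
  · exact ContMDiffAt.comp (g := f) (f := Prod.fst) (m, m) hf contDiff_fst.contDiffAt.contMDiffAt
  · exact ContMDiffAt.comp (g := f) (f := Prod.snd) (m, m) hf contDiff_snd.contDiffAt.contMDiffAt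

theorem differentiableAt_translate {f : M → G} {m : M} (hf : MDifferentiableAt 𝓘(ℝ, M) 𝓘(ℝ, E) f m) :
    DifferentiableAt ℝ (fun m' => extChartAt 𝓘(ℝ, E) (1 : G) ((f m)⁻¹ * f m')) m := by
  rw [← mdifferentiableAt_iff_differentiableAt]
  have h1 : MDifferentiableAt 𝓘(ℝ, E) 𝓘(ℝ, E) (fun h : G => extChartAt 𝓘(ℝ, E) (1 : G)
      ((f m)⁻¹ * h)) (f m) := by
    refine ContMDiffAt.mdifferentiableAt (n := ∞) ?_ (by simp)
    refine ContMDiffAt.comp (g := extChartAt 𝓘(ℝ, E) (1 : G)) (f m)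
      (contMDiffAt_extChartAt' (by simp)) contMDiff_mul_left.contMDiffAt
  exact h1.comp m hf

theorem logD_comp {f : M → G} {h : M' → M} {m : M'}
    (hf : MDifferentiableAt 𝓘(ℝ, M) 𝓘(ℝ, E) f (h m)) (hh : DifferentiableAt ℝ h m) :
    logD (E := E) (fun m' => f (h m')) m = (logD f (h m)).comp (fderiv ℝ h m) := by
  exact fderiv_comp (g := fun k => extChartAt 𝓘(ℝ, E) (1 : G) ((f (h m))⁻¹ * f k)) m
    (differentiableAt_translate hf) hh

theorem contMDiffAt_extChartAt_symm {q : G} {z : E} (hz : z ∈ (extChartAt 𝓘(ℝ, E) q).target) :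
    ContMDiffAt 𝓘(ℝ, E) 𝓘(ℝ, E) ∞ (extChartAt 𝓘(ℝ, E) q).symm z :=
  (contMDiffOn_extChartAt_symm q).contMDiffAt ((isOpen_extChartAt_target q).mem_nhds hz)

theorem contMDiffAt_chartInv {z : E} (hz : z ∈ (extChartAt 𝓘(ℝ, E) (1 : G)).target) :
    ContMDiffAt 𝓘(ℝ, E) 𝓘(ℝ, E) ∞ (chartInv (G := G)) z :=
  contMDiffAt_extChartAt_symm hz

theorem contDiffAt_mcForm {z : E} (hz : z ∈ (extChartAt 𝓘(ℝ, E) (1 : G)).target) :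
    ContDiffAt ℝ ∞ (mcForm (E := E) G) z :=
  contDiffAt_logD (contMDiffAt_chartInv hz)

theorem contDiffAt_localCoord {f : M → G} {m : M} (hf : ContMDiffAt 𝓘(ℝ, M) 𝓘(ℝ, E) ∞ f m) :
    ContDiffAt ℝ ∞ (localCoord (E := E) f m) m :=
  contMDiffAt_chart_mul contMDiffAt_const hf rfl

theorem eventually_eq_mul_chartInv {X : Type*} [TopologicalSpace X] {f : X → G} {m : X} (hf : ContinuousAt f m) :
    f =ᶠ[𝓝 m] fun m' => f m * chartInv (localCoord (E := E) f m m') := by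
  have h1 : ContinuousAt (fun m' => (f m)⁻¹ * f m') m := by
    have : IsTopologicalGroup G := topologicalGroup_of_lieGroup 𝓘(ℝ, E) ∞
    exact continuousAt_const.mul hf
  have h2 : ∀ᶠ m' in 𝓝 m, (f m)⁻¹ * f m' ∈ (extChartAt 𝓘(ℝ, E) (1 : G)).source :=
    h1 (by simpa using extChartAt_source_mem_nhds (I := 𝓘(ℝ, E)) (1 : G))
  filter_upwards [h2] with m' hm'
  rw [localCoord, chartInv, PartialEquiv.left_inv _ hm', mul_inv_cancel_left]

/-- Near `m` the map is `f m` times a map through the chart at the identity, and the constant left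
factor is invisible to `logD`. So `logD f` is the pullback of the Maurer–Cartan form by `localCoord
f m`. -/
theorem eventually_logD_eq {f : M → G} {m : M}
    (hf : ∀ᶠ m' in 𝓝 m, ContMDiffAt 𝓘(ℝ, M) 𝓘(ℝ, E) ∞ f m') :
    ∀ᶠ m' in 𝓝 m, logD (E := E) f m' =
      (mcForm G (localCoord f m m')).comp (fderiv ℝ (localCoord f m) m') := by
  have h0 := hf.self_of_nhds
  have h1 := contDiffAt_localCoord h0
  have h2 : ∀ᶠ m' in 𝓝 m, localCoord f m m' ∈ (extChartAt 𝓘(ℝ, E) (1 : G)).target :=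
    h1.continuousAt (by rw [localCoord_self]; exact target_mem_nhds)
  have h3 : ∀ᶠ m' in 𝓝 m, ContDiffAt ℝ 1 (localCoord (E := E) f m) m' :=
    (h1.of_le (m := 1) (by simp)).eventually (by simp)
  filter_upwards [h2, h3, (eventually_eq_mul_chartInv (E := E) h0.continuousAt).eventually_nhds]
    with m' hm h3 h4
  rw [logD_congr h4, logD_mul_left, mcForm]
  exact logD_comp ((contMDiffAt_chartInv hm).mdifferentiableAt (by simp))
    (h3.differentiableAt (by simp))

theorem two_le_infty : (2 : WithTop ℕ∞) ≤ ∞ := by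
  simpa using WithTop.coe_le_coe.2 (le_top : (2 : ℕ∞) ≤ ⊤)

/-- The Maurer–Cartan equation. -/
theorem maurer_cartan {f : M → G} {m : M}
    (hf : ∀ᶠ m' in 𝓝 m, ContMDiffAt 𝓘(ℝ, M) 𝓘(ℝ, E) ∞ f m') (u w : M) :
    fderiv ℝ (logD f) m u w - fderiv ℝ (logD f) m w u =
      -lieBr E G (logD f m u) (logD f m w) := by
  have h0 := hf.self_of_nhds
  have h1 := contDiffAt_localCoord h0
  have h2 := eventually_logD_eq hf
  have hψ : logD f m = fderiv ℝ (localCoord (E := E) f m) m := by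
    rw [h2.self_of_nhds, localCoord_self, mcForm_coordOne, ContinuousLinearMap.id_comp]
  have d1 : DifferentiableAt ℝ (localCoord (E := E) f m) m := h1.differentiableAt (by simp)
  have d2 : DifferentiableAt ℝ (fderiv ℝ (localCoord (E := E) f m)) m :=
    (h1.fderiv_right (m := 1) two_le_infty).differentiableAt (by simp)
  have d3 : DifferentiableAt ℝ (mcForm G) (localCoord (E := E) f m m) := by
    rw [localCoord_self]
    exact (contDiffAt_mcForm (mem_of_mem_nhds target_mem_nhds)).differentiableAt (by simp)
  have e := h2
  have key : HasFDerivAt (logD (E := E) f) _ m :=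
    HasFDerivAt.congr_of_eventuallyEq ((d3.hasFDerivAt.comp m d1.hasFDerivAt).clm_comp
      d2.hasFDerivAt) h2
  have hs : IsSymmSndFDerivAt ℝ (localCoord (E := E) f m) m :=
    h1.isSymmSndFDerivAt (by simpa using two_le_infty)
  rw [key.fderiv, hψ]
  simp only [localCoord_self, mcForm_coordOne, lieBr_apply, add_apply,
    ContinuousLinearMap.comp_apply, ContinuousLinearMap.compL_apply, ContinuousLinearMap.flip_apply,
    ContinuousLinearMap.id_apply, Function.comp_apply]
  -- The second derivatives of the coordinates cancel by symmetry. What remains is the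
  -- antisymmetrized derivative of `mcForm` at the identity, which is how `lieBr` is defined.
  rw [hs.eq u w]
  abel

/-- Differentiate the Maurer–Cartan equation of the chart once more at the identity. In the cyclic
sum the second derivatives of `mcForm` cancel by symmetry, and the first derivatives assemble into
nested brackets. -/
theorem lieBr_jacobi (a b c : E) :
    lieBr E G (lieBr E G a b) c + lieBr E G (lieBr E G b c) a + lieBr E G (lieBr E G c a) b = 0 := by
  set θ := mcForm (E := E) G
  set o := coordOne E G
  have ht : ∀ᶠ z in 𝓝 o, z ∈ (extChartAt 𝓘(ℝ, E) (1 : G)).target := target_mem_nhds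
  have hθ : ContDiffAt ℝ ∞ θ o := contDiffAt_mcForm (mem_of_mem_nhds target_mem_nhds)
  have d1 : DifferentiableAt ℝ θ o := hθ.differentiableAt (by simp)
  have d2 : DifferentiableAt ℝ (fderiv ℝ θ) o :=
    (hθ.fderiv_right (m := 1) two_le_infty).differentiableAt (by simp)
  have hs : IsSymmSndFDerivAt ℝ θ o := hθ.isSymmSndFDerivAt (by simpa using two_le_infty)
  have hmc : ∀ u w, (fun z => fderiv ℝ θ z u w - fderiv ℝ θ z w u) =ᶠ[𝓝 o]
      fun z => -lieBr E G (θ z u) (θ z w) := fun u w => by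
    filter_upwards [ht.eventually_nhds] with z hz
    exact maurer_cartan (f := chartInv (G := G)) (hz.mono fun y hy => contMDiffAt_chartInv hy) u w
  have hθo : θ o = ContinuousLinearMap.id ℝ E := mcForm_coordOne
  have key : ∀ x u w, fderiv ℝ (fderiv ℝ θ) o x u w - fderiv ℝ (fderiv ℝ θ) o x w u =
      -(lieBr E G (fderiv ℝ θ o x u) w + lieBr E G u (fderiv ℝ θ o x w)) := fun x u w => by
    have happ : ∀ u w, HasFDerivAt (𝕜 := ℝ) (fun z => fderiv ℝ θ z u w) _ o := fun u w =>
      (d2.hasFDerivAt.clm_apply (hasFDerivAt_const u o)).clm_apply (hasFDerivAt_const w o)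
    have hap : ∀ u, HasFDerivAt (𝕜 := ℝ) (fun z => θ z u) _ o := fun u =>
      d1.hasFDerivAt.clm_apply (hasFDerivAt_const u o)
    have h1 := (happ u w).sub (happ w u)
    have h2 := (((lieBr E G).hasFDerivAt.comp o (hap u)).clm_apply (hap w)).neg
    have h3 := (hmc u w).fderiv_eq (𝕜 := ℝ)
    have h4 := h1.fderiv.symm.trans (h3.trans h2.fderiv)
    have h5 := congrArg (fun l : E →L[ℝ] E => l x) h4
    simp only [add_apply, sub_apply, neg_apply, ContinuousLinearMap.comp_apply,
      ContinuousLinearMap.flip_apply, Function.comp_apply, hθo, ContinuousLinearMap.id_apply,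
      zero_apply, map_zero, zero_add] at h5
    rw [h5]
    abel_nf
  have k1 := key a b c
  have k2 := key b c a
  have k3 := key c a b
  rw [hs.eq a b] at k1
  rw [hs.eq b c] at k2
  rw [hs.eq c a] at k3
  have e : ∀ a b, lieBr E G a b = fderiv ℝ θ o b a - fderiv ℝ θ o a b := lieBr_apply
  rw [e a b, e b c, e c a]
  simp only [map_sub, sub_apply]
  rw [lieBr_symm b (fderiv ℝ θ o a c), ] at k1
  rw [lieBr_symm c (fderiv ℝ θ o b a), ] at k2
  rw [lieBr_symm a (fderiv ℝ θ o c b), ] at k3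
  linear_combination (norm := module) -k1 - k2 - k3

end

end

section

/-! ### Maps with prescribed logarithmic derivative -/

variable {E : Type*} [NormedAddCommGroup E] [NormedSpace ℝ E]
variable {G : Type*} [TopologicalSpace G] [ChartedSpace E G] [Group G] [LieGroup 𝓘(ℝ, E) ∞ G]
variable {M : Type*} [NormedAddCommGroup M] [NormedSpace ℝ M]

/-- Both maps move in the same direction after left translation to the identity, and (f m · c)(f' m
· c)⁻¹ does not depend on c. So the derivative of the quotient vanishes on the diagonal, where the
two coordinate velocities lie. -/
theorem fderiv_div_eq_zero {q : G} {f f' : M → G} {m : M} (hf : MDifferentiableAt 𝓘(ℝ, M) 𝓘(ℝ, E) f m)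
    (hf' : MDifferentiableAt 𝓘(ℝ, M) 𝓘(ℝ, E) f' m) (h : logD (E := E) f m = logD f' m)
    (hq : f m * (f' m)⁻¹ ∈ (extChartAt 𝓘(ℝ, E) q).source) :
    HasFDerivAt (𝕜 := ℝ) (fun m' => extChartAt 𝓘(ℝ, E) q (f m' * (f' m')⁻¹)) 0 m := by
  set o := coordOne E G
  set F : E × E → E := fun z => extChartAt 𝓘(ℝ, E) q
    ((f m * chartInv z.1) * (f' m * chartInv z.2)⁻¹) with hF
  have hoo : o ∈ (extChartAt 𝓘(ℝ, E) (1 : G)).target := mem_of_mem_nhds target_mem_nhds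
  have hFd : DifferentiableAt ℝ F (o, o) := by
    refine ContDiffAt.differentiableAt (n := ∞) ?_ (by simp)
    rw [← contMDiffAt_iff_contDiffAt]
    have h1 : ContMDiffAt 𝓘(ℝ, E × E) 𝓘(ℝ, E) ∞ (fun z : E × E => chartInv (G := G) z.1) (o, o) :=
      ContMDiffAt.comp (f := Prod.fst) (o, o) (contMDiffAt_chartInv hoo)
        contDiff_fst.contDiffAt.contMDiffAt
    have h2 : ContMDiffAt 𝓘(ℝ, E × E) 𝓘(ℝ, E) ∞ (fun z : E × E => chartInv (G := G) z.2) (o, o) :=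
      ContMDiffAt.comp (f := Prod.snd) (o, o) (contMDiffAt_chartInv hoo)
        contDiff_snd.contDiffAt.contMDiffAt
    have h3 : ContMDiffAt 𝓘(ℝ, E × E) 𝓘(ℝ, E) ∞ (fun z : E × E =>
        (f m * chartInv z.1) * (f' m * chartInv z.2)⁻¹) (o, o) :=
      (contMDiffAt_const.mul h1).mul (contMDiffAt_const.mul h2).inv
    refine ContMDiffAt.comp (g := extChartAt 𝓘(ℝ, E) q) (o, o) (contMDiffAt_extChartAt' ?_) h3
    simpa [o, chartInv_coordOne] using hq
  have hdiag : ∀ z, fderiv ℝ F (o, o) (z, z) = 0 := by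
    have e : (F ∘ fun z => (z, z)) = fun _ => extChartAt 𝓘(ℝ, E) q (f m * (f' m)⁻¹) := by
      ext1 z
      simp [hF, mul_assoc]
    have h1 := (hFd.hasFDerivAt.comp (f := fun z : E => (z, z)) o
      ((hasFDerivAt_id o).prodMk (hasFDerivAt_id o))).fderiv
    rw [e, fderiv_const_apply] at h1
    intro z
    exact (congrArg (fun l : E →L[ℝ] E => l z) h1).symm
  have d1 : HasFDerivAt (localCoord (E := E) f m) (logD f m) m :=
    (differentiableAt_translate hf).hasFDerivAt
  have d2 : HasFDerivAt (localCoord (E := E) f' m) (logD f m) m := by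
    rw [h]; exact (differentiableAt_translate hf').hasFDerivAt
  have d3 := d1.prodMk d2
  have hFd' : HasFDerivAt F (fderiv ℝ F (o, o)) (localCoord f m m, localCoord f' m m) := by
    rw [localCoord_self, localCoord_self]; exact hFd.hasFDerivAt
  have d4 := HasFDerivAt.comp m hFd' d3
  have d5 : (fun m' => extChartAt 𝓘(ℝ, E) q (f m' * (f' m')⁻¹)) =ᶠ[𝓝 m]
      F ∘ fun m' => (localCoord f m m', localCoord f' m m') := by
    filter_upwards [eventually_eq_mul_chartInv (E := E) hf.continuousAt,
      eventually_eq_mul_chartInv (E := E) hf'.continuousAt] with m' h1 h2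
    simp only [hF, Function.comp_apply]
    rw [← h1, ← h2]
  exact (d4.congr_of_eventuallyEq d5).congr_fderiv (ContinuousLinearMap.ext fun w => hdiag _)

/-- On a connected open set, a map is determined by its logarithmic derivative and one value. -/
theorem eqOn_of_logD_eq {U : Set M} (hU : IsOpen U) (hUc : IsPreconnected U) {f f' : M → G}
    (hf : ∀ m ∈ U, MDifferentiableAt 𝓘(ℝ, M) 𝓘(ℝ, E) f m)
    (hf' : ∀ m ∈ U, MDifferentiableAt 𝓘(ℝ, M) 𝓘(ℝ, E) f' m)
    (h : ∀ m ∈ U, logD (E := E) f m = logD f' m) {m₀ : M} (hm₀ : m₀ ∈ U) (h₀ : f m₀ = f' m₀) :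
    EqOn f f' U := by
  have hloc : ∀ m ∈ U, ∀ᶠ m' in 𝓝 m, f m' * (f' m')⁻¹ = f m * (f' m)⁻¹ := by
    intro m hm
    set q := f m * (f' m)⁻¹ with hq
    have : IsTopologicalGroup G := topologicalGroup_of_lieGroup 𝓘(ℝ, E) ∞
    have hc : ∀ m ∈ U, ContinuousAt (fun m' => f m' * (f' m')⁻¹) m := fun m hm =>
      (hf m hm).continuousAt.mul (hf' m hm).continuousAt.inv
    have h1 : ∀ᶠ m' in 𝓝 m, m' ∈ U ∧ f m' * (f' m')⁻¹ ∈ (extChartAt 𝓘(ℝ, E) q).source :=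
      (hU.eventually_mem hm).and (hc m hm (extChartAt_source_mem_nhds q))
    obtain ⟨r, hr, hball⟩ := Metric.eventually_nhds_iff_ball.1 h1
    have h2 : ∀ m' ∈ Metric.ball m r,
        HasFDerivAt (𝕜 := ℝ) (fun m' => extChartAt 𝓘(ℝ, E) q (f m' * (f' m')⁻¹)) 0 m' := fun m' hm' =>
      fderiv_div_eq_zero (hf _ (hball m' hm').1) (hf' _ (hball m' hm').1) (h _ (hball m' hm').1)
        (hball m' hm').2
    filter_upwards [Metric.ball_mem_nhds m hr] with m' hm'
    have h3 := (convex_ball m r).is_const_of_fderivWithin_eq_zero (𝕜 := ℝ)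
      (fun x hx => (h2 x hx).differentiableAt.differentiableWithinAt)
      (fun x hx => (h2 x hx).hasFDerivWithinAt.fderivWithin
        (Metric.isOpen_ball.uniqueDiffWithinAt hx)) hm' (Metric.mem_ball_self hr)
    exact (extChartAt 𝓘(ℝ, E) q).injOn (hball m' hm').2 (hball m (Metric.mem_ball_self hr)).2 h3
  have : PreconnectedSpace U := isPreconnected_iff_preconnectedSpace.1 hUc
  have hlc : IsLocallyConstant fun m : U => f m * (f' m)⁻¹ := by
    rw [IsLocallyConstant.iff_eventually_eq]
    intro m
    exact continuous_subtype_val.continuousAt.eventually (hloc m m.2)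
  intro m hm
  have h5 := hlc.apply_eq_of_preconnectedSpace ⟨m, hm⟩ ⟨m₀, hm₀⟩
  simp only [h₀, mul_inv_cancel] at h5
  exact mul_inv_eq_one.1 h5

/-- The logarithmic derivative in the direction of time. -/
theorem logD_slice {S : ℝ × ℝ → G} (hS : ContMDiff 𝓘(ℝ, ℝ × ℝ) 𝓘(ℝ, E) ∞ S) (x t : ℝ) :
    logD (E := E) (fun t => S (x, t)) t = (logD S (x, t)).comp (ContinuousLinearMap.inr ℝ ℝ ℝ) := by
  have h1 : HasFDerivAt (fun t : ℝ => ((x, t) : ℝ × ℝ)) (ContinuousLinearMap.inr ℝ ℝ ℝ) t :=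
    hasFDerivAt_prodMk_right x t
  have h2 := logD_comp (E := E) (f := S) (h := fun t : ℝ => ((x, t) : ℝ × ℝ)) (m := t)
    (hS.mdifferentiableAt (by simp)) h1.differentiableAt
  rw [h2, h1.fderiv]

/-- Two maps of the plane with the same time component of the logarithmic derivative in a strip,
which agree at one time, agree in the strip. -/
theorem eq_of_logD_time_eq {S S' : ℝ × ℝ → G} (hS : ContMDiff 𝓘(ℝ, ℝ × ℝ) 𝓘(ℝ, E) ∞ S)
    (hS' : ContMDiff 𝓘(ℝ, ℝ × ℝ) 𝓘(ℝ, E) ∞ S') {J : Set ℝ} (hJ : IsOpen J) (hJc : IsPreconnected J)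
    {x : ℝ} (h : ∀ t ∈ J, logD (E := E) S (x, t) (0, 1) = logD S' (x, t) (0, 1)) {t₀ : ℝ}
    (ht₀ : t₀ ∈ J) (h₀ : S (x, t₀) = S' (x, t₀)) {t : ℝ} (ht : t ∈ J) : S (x, t) = S' (x, t) := by
  have sl : ∀ {S : ℝ × ℝ → G}, ContMDiff 𝓘(ℝ, ℝ × ℝ) 𝓘(ℝ, E) ∞ S → ∀ t : ℝ,
      MDifferentiableAt 𝓘(ℝ, ℝ) 𝓘(ℝ, E) (fun t : ℝ => S (x, t)) t := fun hS t => by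
    have h1 : ContDiff ℝ ∞ fun t : ℝ => ((x, t) : ℝ × ℝ) := by fun_prop
    exact (hS.comp h1.contMDiff).mdifferentiableAt (by simp)
  refine eqOn_of_logD_eq (E := E) (f := fun t => S (x, t)) (f' := fun t => S' (x, t)) hJ hJc
    (fun t _ => sl hS t) (fun t _ => sl hS' t) (fun t ht => ?_) ht₀ h₀ ht
  rw [logD_slice hS, logD_slice hS']
  ext
  simpa using h t ht

/-- For fixed x the factor `c` is constant in time, hence invisible to the time component. This
freedom is used to match and normalize families of curves. -/
theorem logD_mul_slice {S c : ℝ × ℝ → G} (hS : ContMDiff 𝓘(ℝ, ℝ × ℝ) 𝓘(ℝ, E) ∞ S)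
    (hc : ContMDiff 𝓘(ℝ, ℝ × ℝ) 𝓘(ℝ, E) ∞ c) (hct : ∀ x t t', c (x, t) = c (x, t')) (x t : ℝ) :
    logD (E := E) (fun m => c m * S m) (x, t) (0, 1) = logD S (x, t) (0, 1) := by
  have h1 := congrArg (fun l : ℝ →L[ℝ] E => l 1) (logD_slice (S := fun m => c m * S m) (hc.mul hS) x t)
  have h2 := congrArg (fun l : ℝ →L[ℝ] E => l 1) (logD_slice hS x t)
  simp only [ContinuousLinearMap.comp_apply, ContinuousLinearMap.inr_apply] at h1 h2
  rw [← h1, ← h2]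
  have e : (fun t' => c (x, t') * S (x, t')) = fun t' => c (x, t) * S (x, t') := by
    ext1 t'
    rw [hct x t' t]
  rw [e, logD_mul_left]

end

/-! ### Parametric flows and global families of curves with prescribed logarithmic derivative -/

section

section Flow

variable {E : Type*} [NormedAddCommGroup E] [NormedSpace ℝ E]

/-- A linear differential equation has no nontrivial solution that vanishes somewhere. -/
theorem eq_zero_of_linear_ode {w : ℝ → E} {B : ℝ → E →L[ℝ] E} (hB : Continuous B)
    (hw : ∀ t, HasDerivAt w (B t (w t)) t) {t₀ : ℝ} (h₀ : w t₀ = 0) (t : ℝ) : w t = 0 := by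
  set r := |t| + |t₀| + 1
  obtain ⟨C, hC⟩ := (isCompact_Icc (a := -r) (b := r)).exists_bound_of_continuousOn
    hB.continuousOn
  have mem : ∀ s, |s| ≤ |t| + |t₀| → s ∈ Ioo (-r) r := fun s hs => by
    exact abs_lt.1 (hs.trans_lt (lt_add_one _))
  have := ODE_solution_unique_of_mem_Ioo (v := fun t w => B t w) (s := fun _ => univ)
    (K := C.toNNReal) (f := w) (g := fun _ => 0) (a := -r) (b := r) (t₀ := t₀)
    (fun s hs => (((B s).lipschitz.weaken (by
      rw [← NNReal.coe_le_coe, Real.coe_toNNReal']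
      exact (hC s ⟨hs.1.le, hs.2.le⟩).trans (le_max_left _ _))).lipschitzOnWith))
    (mem t₀ (by simp)) (fun s _ => ⟨hw s, mem_univ _⟩)
    (fun s _ => ⟨by simpa using hasDerivAt_const s (0 : E), mem_univ _⟩) h₀
  exact this (mem t (by simp))

theorem hasDerivAt_slice {F : Type*} [NormedAddCommGroup F] [NormedSpace ℝ F] {z : ℝ × ℝ → F}
    (hz : Differentiable ℝ z) (x t : ℝ) :
    HasDerivAt (fun t => z (x, t)) (fderiv ℝ z (x, t) (0, 1)) t :=
  HasFDerivAt.comp_hasDerivAt (f := fun t : ℝ => ((x, t) : ℝ × ℝ)) t (hz (x, t)).hasFDerivAt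
    ((hasDerivAt_const t x).prodMk (hasDerivAt_id t))

/-- The flow of a globally Lipschitz time-dependent vector field depending on a parameter. -/
theorem exists_parametric_flow [FiniteDimensional ℝ E] {F : E × ℝ × ℝ → E} (hF : ContDiff ℝ ∞ F)
    {l : NNReal} (hl : LipschitzWith l F) (o : E) (s : ℝ) :
    ∃ z : ℝ × ℝ → E, ContDiff ℝ ∞ z ∧ (∀ x, z (x, s) = o) ∧
      ∀ x t, fderiv ℝ z (x, t) (0, 1) = F (z (x, t), x, t) := by
  -- The flow is a semilinear system with a single characteristic speed 0. The parameter x and the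
  -- time are carried as extra unknowns to make it autonomous, and smooth dependence on x comes with
  -- the solution.
  set N : (Unit → E × ℝ × ℝ) → Unit → E × ℝ × ℝ := fun u _ => (F (u ()), 0, 1) with hN
  have hNl : LipschitzWith l N := by
    refine LipschitzWith.of_dist_le_mul fun u u' => ?_
    refine (dist_pi_le_iff (by positivity)).2 fun _ => ?_
    rw [Prod.dist_eq, dist_self, max_eq_left dist_nonneg]
    exact (hl.dist_le_mul _ _).trans (by gcongr; exact dist_le_pi_dist _ _ _)
  have hNs : ContDiff ℝ ∞ N := by fun_prop
  obtain ⟨u, hu, hu0, hus⟩ := exists_solution_of_lipschitz (fun _ => 0) (by simp) hNl hNs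
    (a := fun x _ => (o, x, s)) (by fun_prop)
  have hd : ∀ x t, HasDerivAt (fun t => u (x, t) ()) (F (u (x, t) ()), 0, 1) t := fun x t => by
    have h1 := hasDerivAt_pi.1 (hasDerivAt_slice (hu.differentiable (by simp)) x t) ()
    have h2 := hus (x, t) ()
    rw [neg_zero] at h2
    rwa [h2] at h1
  have hx : ∀ x t, (u (x, t) ()).2 = (x, s + t) := fun x t => by
    have h1 : ∀ t, HasDerivAt (fun t => (u (x, t) ()).2 - (x, s + t)) 0 t := fun t => by
      have h2 : HasDerivAt (fun t => (u (x, t) ()).2) ((0, 1) : ℝ × ℝ) t :=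
        HasFDerivAt.comp_hasDerivAt (f := fun t => u (x, t) ()) t hasFDerivAt_snd (hd x t)
      have h3 : HasDerivAt (fun t => ((x, s + t) : ℝ × ℝ)) (0, 1) t :=
        (hasDerivAt_const t x).prodMk ((hasDerivAt_id t).const_add s)
      have h4 := h2.sub h3
      rwa [sub_self] at h4
    have h2 := is_const_of_deriv_eq_zero (fun t => (h1 t).differentiableAt)
      (fun t => (h1 t).deriv) t 0
    simp only [hu0, add_zero, sub_self] at h2
    exact sub_eq_zero.1 h2
  set z : ℝ × ℝ → E := fun m => (u (m.1, m.2 - s) ()).1 with hz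
  have hzs : ContDiff ℝ ∞ z := by fun_prop
  refine ⟨z, hzs, fun x => by simp [hz, hu0], fun x t => ?_⟩
  have h1 := hasDerivAt_slice (hzs.differentiable (by simp)) x t
  have h3 : HasDerivAt (fun t => u (x, t - s) ()) (F (u (x, t - s) ()), 0, 1) t :=
    HasDerivAt.comp_sub_const t s (hd x (t - s))
  have h2 : HasDerivAt (fun t => z (x, t)) (F (u (x, t - s) ())) t :=
    HasFDerivAt.comp_hasDerivAt (f := fun t => u (x, t - s) ()) t hasFDerivAt_fst h3
  rw [h1.unique h2, ← Prod.mk.eta (p := u (x, t - s) ()), hx]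
  simp [hz]

theorem contMDiff_slice {G : Type*} [TopologicalSpace G] [ChartedSpace E G] {S : ℝ × ℝ → G} (hS : ContMDiff 𝓘(ℝ, ℝ × ℝ) 𝓘(ℝ, E) ∞ S) (s : ℝ) :
    ContMDiff 𝓘(ℝ, ℝ × ℝ) 𝓘(ℝ, E) ∞ fun m : ℝ × ℝ => S (m.1, s) :=
  hS.comp (show ContDiff ℝ ∞ fun m : ℝ × ℝ => ((m.1, s) : ℝ × ℝ) by fun_prop).contMDiff

end Flow

variable {E : Type*} [NormedAddCommGroup E] [NormedSpace ℝ E]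
variable {G : Type*} [TopologicalSpace G] [ChartedSpace E G] [Group G] [LieGroup 𝓘(ℝ, E) ∞ G]

variable (G) in
/-- `S` has prescribed time component `A` of its logarithmic derivative between times `a` and
`b`. -/
def SolvesBetween (A : ℝ × ℝ → E) (a b : ℝ) (S : ℝ × ℝ → G) : Prop :=
  ContMDiff 𝓘(ℝ, ℝ × ℝ) 𝓘(ℝ, E) ∞ S ∧ ∀ x, ∀ t ∈ Ioo a b, logD S (x, t) (0, 1) = A (x, t)

/-- Left multiplication of `S'` by a factor depending only on x makes the two families agree at time
`s` without changing the equation. By uniqueness they then agree throughout the overlap and can be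
glued at `s`. -/
theorem SolvesBetween.join {A : ℝ × ℝ → E} {a b c d s : ℝ} {S S' : ℝ × ℝ → G}
    (h : SolvesBetween G A a b S) (h' : SolvesBetween G A c d S') (hs : s ∈ Ioo a b)
    (hs' : s ∈ Ioo c d) : ∃ S'' : ℝ × ℝ → G, SolvesBetween G A a d S'' := by
  set k : ℝ × ℝ → G := fun m => S (m.1, s) * (S' (m.1, s))⁻¹ with hk
  have hks : ContMDiff 𝓘(ℝ, ℝ × ℝ) 𝓘(ℝ, E) ∞ k :=
    (contMDiff_slice h.1 s).mul (contMDiff_slice h'.1 s).inv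
  set R : ℝ × ℝ → G := fun m => k m * S' m with hR
  have hRs : ContMDiff 𝓘(ℝ, ℝ × ℝ) 𝓘(ℝ, E) ∞ R := hks.mul h'.1
  have hRd : ∀ x t, logD (E := E) R (x, t) (0, 1) = logD S' (x, t) (0, 1) :=
    logD_mul_slice h'.1 hks fun _ _ _ => rfl
  have hagree : ∀ x, ∀ t ∈ Ioo (max a c) (min b d), S (x, t) = R (x, t) := fun x t ht => by
    refine eq_of_logD_time_eq h.1 hRs isOpen_Ioo isPreconnected_Ioo (fun t ht => ?_) (t₀ := s)
      ⟨max_lt hs.1 hs'.1, lt_min hs.2 hs'.2⟩ ?_ ht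
    · rw [hRd, h.2 x t ⟨(le_max_left _ _).trans_lt ht.1, ht.2.trans_le (min_le_left _ _)⟩,
        h'.2 x t ⟨(le_max_right _ _).trans_lt ht.1, ht.2.trans_le (min_le_right _ _)⟩]
    · simp [hR, hk]
  set T : ℝ × ℝ → G := fun m => if m.2 < s then S m else R m with hT
  have hlt : ∀ m : ℝ × ℝ, m.2 < min b d → max a c < m.2 ∨ m.2 < s → T =ᶠ[𝓝 m] S := by
    intro m hm hm'
    have h1 : ∀ᶠ q : ℝ × ℝ in 𝓝 m, q.2 < min b d ∧ (max a c < q.2 ∨ q.2 < s) :=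
      (continuous_snd.continuousAt.eventually_lt continuousAt_const hm).and (by
        rcases hm' with hm' | hm'
        · exact (continuousAt_const.eventually_lt continuous_snd.continuousAt hm').mono
            fun _ => Or.inl
        · exact (continuous_snd.continuousAt.eventually_lt continuousAt_const hm').mono
            fun _ => Or.inr)
    filter_upwards [h1] with q hq
    simp only [hT]
    split_ifs with hqs
    · rfl
    · exact (hagree q.1 q.2 ⟨hq.2.resolve_right hqs, hq.1⟩).symm
  have hgt : ∀ m : ℝ × ℝ, s < m.2 → T =ᶠ[𝓝 m] R := by
    intro m hm
    filter_upwards [continuousAt_const.eventually_lt continuous_snd.continuousAt hm] with q hq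
    simp [hT, hq.le]
  have hsm : s < min b d := lt_min hs.2 hs'.2
  have hsm' : max a c < s := max_lt hs.1 hs'.1
  refine ⟨T, fun m => ?_, fun x t ht => ?_⟩
  · rcases lt_or_ge s m.2 with hm | hm
    · exact (hRs m).congr_of_eventuallyEq (hgt m hm)
    · refine (h.1 m).congr_of_eventuallyEq (hlt m (hm.trans_lt hsm) ?_)
      rcases hm.lt_or_eq with hm | hm
      · exact Or.inr hm
      · exact Or.inl (hm ▸ hsm')
  · rcases lt_or_ge s t with hm | hm
    · rw [logD_congr (hgt (x, t) hm), hRd, h'.2 x t ⟨hs'.1.trans hm, ht.2⟩]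
    · rw [logD_congr (hlt (x, t) (hm.trans_lt hsm) ?_), h.2 x t ⟨ht.1, hm.trans_lt hs.2⟩]
      rcases hm.lt_or_eq with hm | hm
      · exact Or.inr hm
      · exact Or.inl (hm ▸ hsm')

variable [FiniteDimensional ℝ E]

variable (G) in
theorem exists_mcForm_isInvertible : ∃ r : ℝ, 0 < r ∧ ∀ z ∈ Metric.closedBall (coordOne E G) r,
    z ∈ (extChartAt 𝓘(ℝ, E) (1 : G)).target ∧ (mcForm G z).IsInvertible := by
  have : CompleteSpace E := FiniteDimensional.complete ℝ E
  have h1 : ContinuousAt (mcForm (E := E) G) (coordOne E G) :=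
    (contDiffAt_mcForm (mem_of_mem_nhds target_mem_nhds)).continuousAt
  have h2 : ∀ᶠ z in 𝓝 (coordOne E G), (mcForm G z).IsInvertible := by
    refine h1.eventually (p := fun l => l.IsInvertible) ?_
    rw [mcForm_coordOne]
    exact (ContinuousLinearEquiv.refl ℝ E).nhds
  have h3 : ∀ᶠ z in 𝓝 (coordOne E G), z ∈ (extChartAt 𝓘(ℝ, E) (1 : G)).target := target_mem_nhds
  obtain ⟨r, hr, h⟩ := Metric.nhds_basis_closedBall.eventually_iff.1 (h3.and h2)
  exact ⟨r, hr, fun z hz => h hz⟩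

/-- In the chart at the identity the equation is z' = θ(z)⁻¹ A, with θ the Maurer–Cartan form.
Multiplication by a bump makes this field globally Lipschitz, and the life span `δ` does not depend
on the starting time, so the steps can be chained. -/
theorem exists_local_solution {A : ℝ × ℝ → E} (hA : ContDiff ℝ ∞ A) (hc : HasCompactSupport A) :
    ∃ δ : ℝ, 0 < δ ∧ ∀ s, ∃ S : ℝ × ℝ → G, SolvesBetween G A (s - δ) (s + δ) S := by
  have : CompleteSpace E := FiniteDimensional.complete ℝ E
  obtain ⟨r, hr, hball⟩ := exists_mcForm_isInvertible (E := E) G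
  set o := coordOne E G
  let χ : ContDiffBump o := ⟨r / 2, r, by positivity, by linarith⟩
  set X : E → E →L[ℝ] E := fun z => χ z • (mcForm G z).inverse with hX
  have hXs : ContDiff ℝ ∞ X := by
    refine contDiff_iff_contDiffAt.2 fun z => ?_
    by_cases hz : z ∈ tsupport X
    swap
    · exact contDiffAt_const.congr_of_eventuallyEq (notMem_tsupport_iff_eventuallyEq.1 hz)
    have hz' : z ∈ Metric.closedBall o r := by
      have := tsupport_smul_subset_left χ _ hz
      rwa [χ.tsupport_eq] at this
    obtain ⟨h1, h2⟩ := hball z hz'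
    exact χ.contDiffAt.smul ((h2.contDiffAt_map_inverse).comp z (contDiffAt_mcForm h1))
  have hXc : HasCompactSupport X := χ.hasCompactSupport.smul_right
  set F : E × ℝ × ℝ → E := fun q => X q.1 (A q.2) with hF
  have hFs : ContDiff ℝ ∞ F := (hXs.comp contDiff_fst).clm_apply (hA.comp contDiff_snd)
  have hFc : HasCompactSupport F := by
    refine HasCompactSupport.intro (hXc.isCompact.prod hc.isCompact) fun q hq => ?_
    rw [mem_prod, not_and_or] at hq
    rcases hq with hq | hq
    · simp [hF, image_eq_zero_of_notMem_tsupport hq]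
    · simp [hF, image_eq_zero_of_notMem_tsupport hq]
  obtain ⟨l, hl⟩ := hFs.lipschitzWith_of_hasCompactSupport hFc (by simp)
  obtain ⟨K, hK⟩ := hFc.exists_bound_of_continuous hFs.continuous
  have hK0 : 0 ≤ K := (norm_nonneg _).trans (hK 0)
  -- With speed at most `K`, the flow stays in the ball of radius `r / 2`, where the cutoff is 1,
  -- for this time; `K + 1` guards against `K = 0`.
  refine ⟨r / (2 * (K + 1)), by positivity, fun s => ?_⟩
  obtain ⟨z, hz, hz0, hzd⟩ := exists_parametric_flow hFs hl o s
  -- `ρ` maps all of `E` into the good ball and is the identity near the orbits in question, so the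
  -- family is smooth on the whole plane even after the flow leaves the chart.
  set ρ : E → E := fun z => o + χ z • (z - o) with hρ
  have hρs : ContDiff ℝ ∞ ρ := contDiff_const.add (χ.contDiff.smul (contDiff_id.sub contDiff_const))
  have hρb : ∀ z, ρ z ∈ (extChartAt 𝓘(ℝ, E) (1 : G)).target := fun z => by
    refine (hball _ ?_).1
    rw [mem_closedBall_iff_norm, hρ, add_sub_cancel_left, norm_smul,
      Real.norm_of_nonneg χ.nonneg]
    rcases le_total r ‖z - o‖ with h | h
    · rw [χ.zero_of_le_dist (by rwa [dist_eq_norm]), zero_mul]; exact hr.le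
    · exact (mul_le_of_le_one_left (norm_nonneg _) χ.le_one).trans h
  have hρz : ContDiff ℝ ∞ fun m => ρ (z m) := hρs.comp hz
  have hS : ContMDiff 𝓘(ℝ, ℝ × ℝ) 𝓘(ℝ, E) ∞ fun m => chartInv (G := G) (ρ (z m)) := fun m =>
    ContMDiffAt.comp (f := fun m => ρ (z m)) m (contMDiffAt_chartInv (hρb _))
      hρz.contMDiff.contMDiffAt
  refine ⟨_, hS, fun x t ht => ?_⟩
  have hdist : ‖z (x, t) - o‖ < r / 2 := by
    have h1 := Convex.norm_image_sub_le_of_norm_hasDerivWithin_le (s := univ) (C := K)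
      (f := fun t => z (x, t)) (x := s) (y := t)
      (fun t _ => (hasDerivAt_slice (hz.differentiable (by simp)) x t).hasDerivWithinAt)
      (fun t _ => by rw [hzd]; exact hK _) convex_univ (mem_univ _) (mem_univ _)
    rw [hz0] at h1
    have h2 : |t - s| < r / (2 * (K + 1)) := by rw [abs_lt]; constructor <;> linarith [ht.1, ht.2]
    rw [lt_div_iff₀ (by positivity)] at h2
    rw [Real.norm_eq_abs] at h1
    nlinarith [abs_nonneg (t - s)]
  have hzb : z (x, t) ∈ Metric.ball o (r / 2) := by rwa [mem_ball_iff_norm]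
  have hev : (fun m => chartInv (G := G) (ρ (z m))) =ᶠ[𝓝 (x, t)] fun m => chartInv (z m) := by
    have : ∀ᶠ m in 𝓝 (x, t), z m ∈ Metric.ball o (r / 2) :=
      hz.continuous.continuousAt (Metric.isOpen_ball.mem_nhds hzb)
    filter_upwards [this] with m hm
    simp only [hρ]
    rw [χ.one_of_mem_closedBall (Metric.ball_subset_closedBall hm), one_smul, add_sub_cancel]
  obtain ⟨h1, h2⟩ := hball (z (x, t)) (Metric.ball_subset_closedBall
    (Metric.ball_subset_ball (by linarith) hzb))
  rw [logD_congr hev, logD_comp ((contMDiffAt_chartInv h1).mdifferentiableAt (by simp))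
    (hz.differentiable (by simp) _), ContinuousLinearMap.comp_apply, hzd]
  simp only [hF, hX]
  rw [χ.one_of_mem_closedBall (Metric.ball_subset_closedBall hzb), one_smul]
  exact h2.self_apply_inverse _

theorem exists_solution_between {A : ℝ × ℝ → E} (hA : ContDiff ℝ ∞ A) (hc : HasCompactSupport A)
    (r : ℝ) : ∃ S : ℝ × ℝ → G, SolvesBetween G A (-r) r S := by
  obtain ⟨δ, hδ, h⟩ := exists_local_solution (G := G) hA hc
  have step : ∀ n : ℕ, ∃ S : ℝ × ℝ → G, SolvesBetween G A (-r - δ) (-r + (n + 1) * δ) S := by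
    intro n
    induction n with
    | zero => simpa using h (-r)
    | succ n ih =>
      obtain ⟨S, hS⟩ := ih
      obtain ⟨S', hS'⟩ := h (-r + (n + 1) * δ)
      have hn : (0 : ℝ) ≤ n * δ := by positivity
      -- The gluing time is the midpoint of the overlap, which has length `δ`.
      obtain ⟨T, hT⟩ := hS.join hS' (s := -r + (n + 1 / 2) * δ)
        ⟨by linarith, by linarith⟩ ⟨by linarith, by linarith⟩
      refine ⟨T, ?_⟩
      convert hT using 1
      push_cast
      ring
  obtain ⟨n, hn⟩ := exists_nat_ge (2 * r / δ)
  obtain ⟨S, hS⟩ := step n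
  refine ⟨S, hS.1, fun x t ht => hS.2 x t ⟨by linarith [ht.1], ?_⟩⟩
  rw [div_le_iff₀ hδ] at hn
  linarith [ht.2]

/-- A smooth family of curves with prescribed logarithmic derivatives. -/
theorem exists_logD_time_eq {A : ℝ × ℝ → E} (hA : ContDiff ℝ ∞ A) (t₀ : ℝ) :
    ∃ S : ℝ × ℝ → G, ContMDiff 𝓘(ℝ, ℝ × ℝ) 𝓘(ℝ, E) ∞ S ∧ (∀ x, S (x, t₀) = 1) ∧
      ∀ x t, logD S (x, t) (0, 1) = A (x, t) := by
  have step : ∀ n : ℕ, ∃ S : ℝ × ℝ → G, ContMDiff 𝓘(ℝ, ℝ × ℝ) 𝓘(ℝ, E) ∞ S ∧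
      (∀ x, S (x, t₀) = 1) ∧
      ∀ x t, |x| < n + |t₀| + 1 → |t| < n + |t₀| + 1 → logD S (x, t) (0, 1) = A (x, t) := by
    intro n
    set r : ℝ := n + |t₀| + 1
    have hr : 0 < r := by positivity
    -- The cutoff equals 1 on the square of half-side `r`, which contains the line t = `t₀`, |x| <
    -- `r`. The solutions normalized there agree on smaller squares and exhaust the plane.
    let χ : ContDiffBump (0 : ℝ × ℝ) := ⟨r, r + 1, hr, by linarith⟩
    obtain ⟨S, hS, hSd⟩ := exists_solution_between (G := G) (χ.contDiff.smul hA)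
      χ.hasCompactSupport.smul_right r
    refine ⟨fun m => (S (m.1, t₀))⁻¹ * S m, (contMDiff_slice hS t₀).inv.mul hS, fun x => by simp,
      fun x t hx ht => ?_⟩
    refine (logD_mul_slice hS (contMDiff_slice hS t₀).inv (fun _ _ _ => rfl) x t).trans ?_
    rw [hSd x t (abs_lt.1 ht), Pi.smul_apply', χ.one_of_mem_closedBall, one_smul]
    rw [mem_closedBall_zero_iff, Prod.norm_def]
    exact max_le hx.le ht.le
  choose S hS hS0 hSd using step
  have agree : ∀ n k : ℕ, n ≤ k → ∀ x t, |x| < n + |t₀| + 1 → |t| < n + |t₀| + 1 →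
      S n (x, t) = S k (x, t) := fun n k hnk x t hx ht => by
    have hnk' : (n : ℝ) + |t₀| + 1 ≤ k + |t₀| + 1 := by gcongr
    refine eq_of_logD_time_eq (hS n) (hS k) (J := Ioo (-(n + |t₀| + 1)) (n + |t₀| + 1)) isOpen_Ioo
      isPreconnected_Ioo (fun t ht => ?_) (t₀ := t₀) ?_ (by rw [hS0, hS0]) (abs_lt.1 ht)
    · rw [hSd n x t hx (abs_lt.2 ht), hSd k x t (hx.trans_le hnk') ((abs_lt.2 ht).trans_le hnk')]
    · refine abs_lt.1 ?_
      have : (0 : ℝ) ≤ n := n.cast_nonneg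
      linarith
  set ν : ℝ × ℝ → ℕ := fun m => ⌈‖m‖⌉₊ with hν
  have hνm : ∀ m : ℝ × ℝ, ‖m‖ ≤ ν m := fun m => Nat.le_ceil _
  set T : ℝ × ℝ → G := fun m => S (ν m) m with hT
  have small : ∀ (n : ℕ) (m : ℝ × ℝ), ‖m‖ < n + 1 → |m.1| < n + |t₀| + 1 ∧ |m.2| < n + |t₀| + 1 :=
    fun n m hm => by
      have h1 := norm_fst_le m
      have h2 := norm_snd_le m
      have h3 := abs_nonneg t₀
      rw [Real.norm_eq_abs] at h1 h2
      constructor <;> linarith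
  have hloc : ∀ m, T =ᶠ[𝓝 m] S (ν m) := fun m => by
    have : ∀ᶠ q in 𝓝 m, ‖q‖ < ν m + 1 :=
      continuous_norm.continuousAt.eventually_lt continuousAt_const
        ((hνm m).trans_lt (lt_add_one _))
    filter_upwards [this] with q hq
    have h1 := small _ q hq
    have h2 := small (ν q) q ((hνm q).trans_lt (lt_add_one _))
    rcases le_total (ν q) (ν m) with h | h
    · exact agree _ _ h q.1 q.2 h2.1 h2.2
    · exact (agree _ _ h q.1 q.2 h1.1 h1.2).symm
  refine ⟨T, fun m => (hS _ m).congr_of_eventuallyEq (hloc m), fun x => hS0 _ x, fun x t => ?_⟩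
  have h1 := small (ν (x, t)) (x, t) ((hνm _).trans_lt (lt_add_one _))
  rw [logD_congr (hloc (x, t)), hSd _ x t h1.1 h1.2]

end

section

/-! ### The torsion wave map equation in a left-invariant frame -/

variable {E : Type*} [NormedAddCommGroup E] [NormedSpace ℝ E]
variable {G : Type*} [TopologicalSpace G] [ChartedSpace E G] [Group G] [LieGroup 𝓘(ℝ, E) ∞ G]
variable {M : Type*} [NormedAddCommGroup M] [NormedSpace ℝ M]

theorem mfderiv_div_eq_logD {f : M → G} {m : M} (hf : MDifferentiableAt 𝓘(ℝ, M) 𝓘(ℝ, E) f m)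
    {c : G} (hc : f m = c) :
    (mfderiv 𝓘(ℝ, M) 𝓘(ℝ, E) (fun m' => c⁻¹ * f m') m : M →L[ℝ] E) = logD (E := E) f m := by
  subst hc
  have h1 : MDifferentiableAt 𝓘(ℝ, E) 𝓘(ℝ, E) (fun x : G => (f m)⁻¹ * x) (f m) :=
    (contMDiff_mul_left (I := 𝓘(ℝ, E)) (n := ∞)).mdifferentiableAt (by simp)
  refine (MDifferentiableAt.mfderiv (h1.comp m hf)).trans ?_
  simp [writtenInExtChartAt, logD, Function.comp_def, fderivWithin_univ, mfld_simps,
    chartAt_self_eq]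
  rfl

theorem mfderiv_translate {f : M → G} {m : M} (hf : MDifferentiableAt 𝓘(ℝ, M) 𝓘(ℝ, E) f m) (u : M) :
    (mfderiv 𝓘(ℝ, E) 𝓘(ℝ, E) (fun x : G => (f m)⁻¹ * x) (f m)
      (mfderiv 𝓘(ℝ, M) 𝓘(ℝ, E) f m u) : E) = logD (E := E) f m u := by
  have h1 : MDifferentiableAt 𝓘(ℝ, E) 𝓘(ℝ, E) (fun x : G => (f m)⁻¹ * x) (f m) :=
    (contMDiff_mul_left (I := 𝓘(ℝ, E)) (n := ∞)).mdifferentiableAt (by simp)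
  exact congrArg (fun l : M →L[ℝ] E => l u)
    ((mfderiv_comp m h1 hf).symm.trans (mfderiv_div_eq_logD hf rfl))

variable (G) in
/-- The Maurer–Cartan form in the chart at `q`. -/
def chartForm (q : G) (y : E) : E →L[ℝ] E := logD (extChartAt 𝓘(ℝ, E) q).symm y

theorem contDiffAt_chartForm {q : G} {y : E} (hy : y ∈ (extChartAt 𝓘(ℝ, E) q).target) :
    ContDiffAt ℝ ∞ (chartForm G q) y :=
  contDiffAt_logD (contMDiffAt_extChartAt_symm hy)

/-- Translating back from the identity and applying the chart at `q` inverts `localCoord`, so its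
derivative is a left inverse. -/
theorem chartForm_injective {q : G} {y : E} (hy : y ∈ (extChartAt 𝓘(ℝ, E) q).target) :
    Function.Injective (chartForm G q y) := by
  set f : E → G := (extChartAt 𝓘(ℝ, E) q).symm.toFun with hf
  set o := coordOne E G
  have hfm : MDifferentiableAt 𝓘(ℝ, E) 𝓘(ℝ, E) f y :=
    (contMDiffAt_extChartAt_symm hy).mdifferentiableAt (by simp)
  set k : E → E := fun w => extChartAt 𝓘(ℝ, E) q (f y * chartInv w) with hk
  have hkd : DifferentiableAt ℝ k (localCoord f y y) := by
    rw [localCoord_self]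
    refine ContDiffAt.differentiableAt (n := ∞) ?_ (by simp)
    rw [← contMDiffAt_iff_contDiffAt]
    refine ContMDiffAt.comp (g := extChartAt 𝓘(ℝ, E) q) o (contMDiffAt_extChartAt' ?_)
      (contMDiffAt_const.mul (contMDiffAt_chartInv (mem_of_mem_nhds target_mem_nhds)))
    rw [chartInv_coordOne, mul_one, ← extChartAt_source 𝓘(ℝ, E)]
    exact (extChartAt 𝓘(ℝ, E) q).map_target hy
  have h1 : HasFDerivAt (localCoord (E := E) f y) (chartForm G q y) y :=
    (differentiableAt_translate hfm).hasFDerivAt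
  have h2 := HasFDerivAt.comp y hkd.hasFDerivAt h1
  have h3 : k ∘ localCoord f y =ᶠ[𝓝 y] id := by
    filter_upwards [eventually_eq_mul_chartInv (E := E) hfm.continuousAt,
      (isOpen_extChartAt_target (I := 𝓘(ℝ, E)) q).mem_nhds hy] with z hz hzt
    simp only [hk, Function.comp_apply]
    rw [← hz]
    exact (extChartAt 𝓘(ℝ, E) q).right_inv hzt
  have h4 := (h2.congr_of_eventuallyEq h3.symm).unique (hasFDerivAt_id y)
  intro u w huw
  have h5 : ∀ u, fderiv ℝ k (localCoord f y y) (chartForm G q y u) = u := fun u =>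
    congrArg (fun l : E →L[ℝ] E => l u) h4
  rw [← h5 u, ← h5 w, huw]

/-- A left-invariant form is the constant form `B` pulled back by the Maurer–Cartan form, so all
coordinate dependence sits in `chartForm`. -/
theorem coordForm_eq (B : LinearMap.BilinForm ℝ (GroupLieAlgebra 𝓘(ℝ, E) G)) {q : G} {y : E}
    (hy : y ∈ (extChartAt 𝓘(ℝ, E) q).target) (u w : E) :
    coordForm B q y u w = B (chartForm G q y u : E) (chartForm G q y w : E) := by
  have hfm : MDifferentiableAt 𝓘(ℝ, E) 𝓘(ℝ, E) (extChartAt 𝓘(ℝ, E) q).symm y :=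
    (contMDiffAt_extChartAt_symm hy).mdifferentiableAt (by simp)
  have h := mfderiv_translate hfm
  unfold coordForm leftInvariantForm chartForm
  rw [← h u, ← h w]

section Connection

variable {q : G} {y : E}

theorem fderiv_chartForm_comm (hy : y ∈ (extChartAt 𝓘(ℝ, E) q).target) (u w : E) :
    fderiv ℝ (chartForm G q) y u w = fderiv ℝ (chartForm G q) y w u -
      lieBr E G (chartForm G q y u) (chartForm G q y w) := by
  have ht : ∀ᶠ z in 𝓝 y, z ∈ (extChartAt 𝓘(ℝ, E) q).target :=
    (isOpen_extChartAt_target (I := 𝓘(ℝ, E)) q).mem_nhds hy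
  have := maurer_cartan (E := E) (f := (extChartAt 𝓘(ℝ, E) q).symm)
    (ht.mono fun z hz => contMDiffAt_extChartAt_symm hz) u w
  exact (sub_eq_iff_eq_add'.1 this).trans (sub_eq_add_neg _ _).symm

theorem coordFormDeriv_eq {B : LinearMap.BilinForm ℝ (GroupLieAlgebra 𝓘(ℝ, E) G)}
    {b : E →L[ℝ] E →L[ℝ] ℝ} (hb : ∀ u w : E, b u w = B u w)
    (hy : y ∈ (extChartAt 𝓘(ℝ, E) q).target) (z u w : E) : coordFormDeriv B q y z u w =
      b (fderiv ℝ (chartForm G q) y z u) (chartForm G q y w) +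
        b (chartForm G q y u) (fderiv ℝ (chartForm G q) y z w) := by
  have ht : ∀ᶠ z in 𝓝 y, z ∈ (extChartAt 𝓘(ℝ, E) q).target :=
    (isOpen_extChartAt_target (I := 𝓘(ℝ, E)) q).mem_nhds hy
  have hd : DifferentiableAt ℝ (chartForm G q) y :=
    (contDiffAt_chartForm hy).differentiableAt (by simp)
  have e : (fun y' => coordForm B q y' u w) =ᶠ[𝓝 y]
      fun y' => b (chartForm G q y' u) (chartForm G q y' w) := by
    filter_upwards [ht] with y' hy'
    rw [coordForm_eq B hy', hb]
  have hu : ∀ u, HasFDerivAt (𝕜 := ℝ) (fun y' => chartForm G q y' u)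
      ((fderiv ℝ (chartForm G q) y).flip u) y := fun u => by
    refine (hd.hasFDerivAt.clm_apply (hasFDerivAt_const u y)).congr_fderiv ?_
    ext d
    simp
  have h2 := (b.hasFDerivAt.comp y (hu u)).clm_apply (hu w)
  unfold coordFormDeriv
  rw [e.fderiv_eq]
  refine (congrArg (fun l : E →L[ℝ] ℝ => l z) h2.fderiv).trans ?_
  simp [add_comm]

/-- Raising an index with a metric pulled back by an isomorphism. -/
theorem FrameData.apply_raise [FiniteDimensional ℝ E] (A : FrameData E) {θ : E →L[ℝ] E} (hθ : Function.Injective θ) {b : E → E → ℝ}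
    (hb : ∀ a z, b a z = A.g (θ a) (θ z)) {f : E → ℝ} {c : E} (hc : ∀ z, A.g c (θ z) = f z) :
    θ (raise b f) = c := by
  have hs : Function.Surjective θ := LinearMap.surjective_of_injective (f := θ.toLinearMap) hθ
  have hex : ∃ a, ∀ z, b a z = f z := by
    obtain ⟨a, rfl⟩ := hs c
    exact ⟨a, fun z => by rw [hb, hc]⟩
  refine A.eq_of_g_eq fun z => ?_
  obtain ⟨z, rfl⟩ := hs z
  rw [hc, ← hb]
  exact Classical.epsilon_spec hex z

variable [FiniteDimensional ℝ E]
variable {g p : LinearMap.BilinForm ℝ (GroupLieAlgebra 𝓘(ℝ, E) G)}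

/-- The Koszul formula in the frame: derivatives of the metric fall on `chartForm`, and the
Maurer–Cartan equation exchanges their arguments. The second-order-type terms collapse to the
symmetrized derivative, leaving only brackets. -/
theorem chartForm_christoffel (A : FrameData E) (hbr : A.br = lieBr E G)
    (hg : ∀ u w : E, A.g u w = g u w) (hy : y ∈ (extChartAt 𝓘(ℝ, E) q).target) (u w : E) : chartForm G q y (christoffel g q y u w) =
    (1 / 2 : ℝ) • (fderiv ℝ (chartForm G q) y u w + fderiv ℝ (chartForm G q) y w u -
      A.sharp ((A.g (chartForm G q y w)).comp (A.br (chartForm G q y u)) +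
        (A.g (chartForm G q y u)).comp (A.br (chartForm G q y w)))) := by
  refine A.apply_raise (chartForm_injective hy) (fun a z => by rw [coordForm_eq g hy, hg])
    fun z => ?_
  simp only [coordFormDeriv_eq hg hy]
  rw [fderiv_chartForm_comm hy z u, fderiv_chartForm_comm hy z w, ← hbr]
  simp only [map_smul, map_add, map_sub, smul_apply, add_apply, sub_apply, smul_eq_mul]
  rw [A.g_sharp, A.g_sharp]
  simp only [ContinuousLinearMap.comp_apply]
  rw [A.br_symm _ (chartForm G q y u), A.br_symm _ (chartForm G q y w)]
  simp only [map_neg, neg_apply]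
  rw [A.g_symm (fderiv ℝ (chartForm G q) y u z),
    A.g_symm (A.br (chartForm G q y u) (chartForm G q y z)),
    A.g_symm (chartForm G q y u) (fderiv ℝ (chartForm G q) y w z)]
  ring

/-- In the cyclic sum the derivatives of `chartForm` cancel by the skewness of p, and the
Maurer–Cartan brackets add up to `dp`. -/
theorem chartForm_torsion (A : FrameData E) (hbr : A.br = lieBr E G)
    (hg : ∀ u w : E, A.g u w = g u w) (hp : ∀ u w : E, A.p u w = p u w)
    (hy : y ∈ (extChartAt 𝓘(ℝ, E) q).target) (u w : E) : chartForm G q y (torsion g p q y u w) =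
    -(1 / 2 : ℝ) • A.sharp (A.dp (chartForm G q y u) (chartForm G q y w)) := by
  refine A.apply_raise (chartForm_injective hy) (fun a z => by rw [coordForm_eq g hy, hg])
    fun z => ?_
  simp only [coordFormDeriv_eq hp hy]
  rw [fderiv_chartForm_comm hy z u, fderiv_chartForm_comm hy w z, fderiv_chartForm_comm hy u w,
    ← hbr]
  simp only [map_smul, map_sub, smul_apply, sub_apply, smul_eq_mul, A.g_sharp, A.dp_apply]
  rw [A.p_symm (chartForm G q y z), A.p_symm (chartForm G q y w), A.p_symm (chartForm G q y u)]
  ring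

theorem christoffel_symm (A : FrameData E) (hbr : A.br = lieBr E G)
    (hg : ∀ u w : E, A.g u w = g u w) (hy : y ∈ (extChartAt 𝓘(ℝ, E) q).target) (u w : E) :
    christoffel g q y u w = christoffel g q y w u := by
  refine chartForm_injective hy ?_
  rw [chartForm_christoffel A hbr hg hy, chartForm_christoffel A hbr hg hy,
    add_comm (fderiv ℝ (chartForm G q) y u w), add_comm ((A.g (chartForm G q y w)).comp _)]

theorem torsion_antisymm (A : FrameData E) (hbr : A.br = lieBr E G)
    (hg : ∀ u w : E, A.g u w = g u w) (hp : ∀ u w : E, A.p u w = p u w)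
    (hy : y ∈ (extChartAt 𝓘(ℝ, E) q).target) (u w : E) :
    torsion g p q y u w = -torsion g p q y w u := by
  refine chartForm_injective hy ?_
  have e : ∀ a b : E, A.dp a b = -A.dp b a := fun a b => by
    ext z
    rw [neg_apply, A.dp_apply, A.dp_apply, A.br_symm a b, A.br_symm z a, A.br_symm z b]
    simp only [map_neg, neg_apply]
    ring
  rw [map_neg, chartForm_torsion A hbr hg hp hy, chartForm_torsion A hbr hg hp hy, e, map_neg,
    smul_neg]

end Connection

theorem eventually_logD_eq_chartForm {f : M → G} {m : M}
    (hf : ∀ᶠ m' in 𝓝 m, ContMDiffAt 𝓘(ℝ, M) 𝓘(ℝ, E) ∞ f m') {q : G}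
    (hq : f m ∈ (extChartAt 𝓘(ℝ, E) q).source) :
    ∀ᶠ m' in 𝓝 m, logD (E := E) f m' =
      (chartForm G q (extChartAt 𝓘(ℝ, E) q (f m'))).comp
        (fderiv ℝ (fun m' => extChartAt 𝓘(ℝ, E) q (f m')) m') := by
  have h1 : ∀ᶠ m' in 𝓝 m, f m' ∈ (extChartAt 𝓘(ℝ, E) q).source :=
    hf.self_of_nhds.continuousAt ((isOpen_extChartAt_source q).mem_nhds hq)
  filter_upwards [hf, h1.eventually_nhds] with m' hm h2
  have h3 : f =ᶠ[𝓝 m'] fun m => (extChartAt 𝓘(ℝ, E) q).symm (extChartAt 𝓘(ℝ, E) q (f m)) :=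
    h2.mono fun m hm => ((extChartAt 𝓘(ℝ, E) q).left_inv hm).symm
  have h4 := h2.self_of_nhds
  have h5 : ContMDiffAt 𝓘(ℝ, M) 𝓘(ℝ, E) ∞ (fun m' => extChartAt 𝓘(ℝ, E) q (f m')) m' :=
    ContMDiffAt.comp (g := extChartAt 𝓘(ℝ, E) q) m'
      (contMDiffAt_extChartAt' (by rwa [← extChartAt_source 𝓘(ℝ, E)])) hm
  rw [logD_congr h3]
  exact logD_comp ((contMDiffAt_extChartAt_symm
    ((extChartAt 𝓘(ℝ, E) q).map_source h4)).mdifferentiableAt (by simp))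
    ((contMDiffAt_iff_contDiffAt.1 h5).differentiableAt (by simp))

/-- The Minkowski part involves only the diagonal of the connection terms, the ε part only their
antisymmetrization; the two see the Christoffel symbols and the torsion separately. -/
theorem sum_waveOperator (P T : Fin 3 → Fin 3 → E) (lam : ℝ) (v : Fin 3 → ℝ) :
    (∑ μ, ∑ ν, minkowski μ ν • P μ ν) +
      (∑ μ, ∑ ν, (minkowski μ ν + lam * ∑ σ, volTensor μ ν σ * v σ) • T μ ν) =
    (P 0 0 + T 0 0) + (P 1 1 + T 1 1) - (P 2 2 + T 2 2) +
      lam • (v 2 • (T 0 1 - T 1 0) + v 0 • (T 1 2 - T 2 1) + v 1 • (T 2 0 - T 0 2)) := by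
  simp only [Fin.sum_univ_three, minkowski, volTensor, Matrix.diagonal_apply]
  have h : (0 : Fin 3) ≠ 1 ∧ (0 : Fin 3) ≠ 2 ∧ (1 : Fin 3) ≠ 2 ∧ (![1, 1, -1] : Fin 3 → ℝ) 2 = -1 :=
    ⟨by decide, by decide, by decide, rfl⟩
  norm_num [h.1, h.2.1, h.2.2.1, h.2.2.2, h.1.symm, h.2.1.symm, h.2.2.1.symm]
  module

/-- The torsion wave map equation in terms of the logarithmic derivative. -/
theorem isTorsionWaveMap_iff [FiniteDimensional ℝ E] (A : FrameData E) (hbr : A.br = lieBr E G)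
    {g p : LinearMap.BilinForm ℝ (GroupLieAlgebra 𝓘(ℝ, E) G)}
    (hg : ∀ u w : E, A.g u w = g u w) (hp : ∀ u w : E, A.p u w = p u w) {Ψ : ℝ × ℝ × ℝ → G}
    (hΨ : ContMDiff 𝓘(ℝ, ℝ × ℝ × ℝ) 𝓘(ℝ, E) ∞ Ψ) :
    IsTorsionWaveMap g p A.lam A.v Ψ ↔ ∀ m, fderiv ℝ (logD (E := E) Ψ) m (0, 0, 1) (0, 0, 1) =
      fderiv ℝ (logD Ψ) m (1, 0, 0) (1, 0, 0) + fderiv ℝ (logD Ψ) m (0, 1, 0) (0, 1, 0) +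
        A.source (logD Ψ m (0, 0, 1)) (logD Ψ m (1, 0, 0)) (logD Ψ m (0, 1, 0)) := by
  refine forall_congr' fun m => ?_
  set q := Ψ m
  set ψ : ℝ × ℝ × ℝ → E := fun m' => extChartAt 𝓘(ℝ, E) q (Ψ m') with hψ
  set y := ψ m with hydef
  set θ : E → E →L[ℝ] E := chartForm G q
  have hy : y ∈ (extChartAt 𝓘(ℝ, E) q).target := mem_extChartAt_target q
  have hψs : ContDiffAt ℝ ∞ ψ m := by
    rw [← contMDiffAt_iff_contDiffAt]
    exact ContMDiffAt.comp (g := extChartAt 𝓘(ℝ, E) q) m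
      (contMDiffAt_extChartAt' (by simp [q])) hΨ.contMDiffAt
  have hev := eventually_logD_eq_chartForm (E := E) (m := m) (q := q)
    (Eventually.of_forall fun m => hΨ.contMDiffAt)
    (mem_extChartAt_source q)
  have hd1 : DifferentiableAt ℝ ψ m := hψs.differentiableAt (by simp)
  have hd2 : DifferentiableAt ℝ (fderiv ℝ ψ) m :=
    (hψs.fderiv_right (m := 1) two_le_infty).differentiableAt (by simp)
  have hd3 : DifferentiableAt ℝ θ y := (contDiffAt_chartForm hy).differentiableAt (by simp)
  have hA : ∀ u, logD (E := E) Ψ m u = θ y (fderiv ℝ ψ m u) := fun u => by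
    rw [hev.self_of_nhds]; rfl
  have hdA : ∀ u w, fderiv ℝ (logD (E := E) Ψ) m u w =
      fderiv ℝ θ y (fderiv ℝ ψ m u) (fderiv ℝ ψ m w) + θ y (fderiv ℝ (fderiv ℝ ψ) m u w) := by
    intro u w
    have h1 := HasFDerivAt.congr_of_eventuallyEq
      ((hd3.hasFDerivAt.comp m hd1.hasFDerivAt).clm_comp hd2.hasFDerivAt) hev
    rw [h1.fderiv]
    simp only [add_apply, ContinuousLinearMap.comp_apply, ContinuousLinearMap.compL_apply,
      ContinuousLinearMap.flip_apply]
    exact add_comm _ _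
  have hpd : ∀ μ ν, partialD μ (partialD ν ψ) m =
      fderiv ℝ (fderiv ℝ ψ) m (coordVec μ) (coordVec ν) := fun μ ν => by
    have h1 := hd2.hasFDerivAt.clm_apply (hasFDerivAt_const (coordVec ν) m)
    refine (congrArg (fun l : ℝ × ℝ × ℝ →L[ℝ] E => l (coordVec μ)) h1.fderiv).trans ?_
    simp
  have hΓ : ∀ u, θ y (torsionConnection g p q y u u) = fderiv ℝ θ y u u -
      A.sharp ((A.g (θ y u)).comp (A.br (θ y u))) := fun u => by
    have h1 : A.dp (θ y u) (θ y u) = 0 := by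
      ext z
      rw [A.dp_apply, A.br_self, A.br_symm z]
      simp
    unfold torsionConnection
    rw [map_add, chartForm_christoffel A hbr hg hy, chartForm_torsion A hbr hg hp hy, h1, map_zero,
      smul_zero, add_zero, map_add A.sharp]
    module
  have hQ : ∀ u w, θ y (torsionConnection g p q y u w - torsionConnection g p q y w u) =
      -A.sharp (A.dp (θ y u) (θ y w)) := fun u w => by
    unfold torsionConnection
    rw [christoffel_symm A hbr hg hy w u, add_sub_add_left_eq_sub,
      torsion_antisymm A hbr hg hp hy w u, sub_neg_eq_add, map_add,
      chartForm_torsion A hbr hg hp hy]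
    module
  have hinj : Function.Injective (θ y) := chartForm_injective hy
  change (_ + _ = (0 : E)) ↔ _
  -- The coordinate equation is mapped into the Lie algebra by the injective `θ y`. There θ applied
  -- to the second derivatives plus the derivative of θ is the derivative of `logD Ψ`, and the
  -- remaining terms form the force.
  rw [sum_waveOperator (fun μ ν => partialD μ (partialD ν ψ) m) (fun μ ν =>
    torsionConnection g p q y (partialD μ ψ m) (partialD ν ψ m)) A.lam A.v,
    ← hinj.eq_iff, map_zero]
  have h2 : ∀ μ, θ y (partialD μ (partialD μ ψ) m +
      torsionConnection g p q y (partialD μ ψ m) (partialD μ ψ m)) =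
      fderiv ℝ (logD Ψ) m (coordVec μ) (coordVec μ) -
        A.sharp ((A.g (logD Ψ m (coordVec μ))).comp (A.br (logD Ψ m (coordVec μ)))) := fun μ => by
    rw [map_add, hΓ, hpd, hdA, hA]
    simp only [partialD]
    abel
  have h3 : ∀ μ ν, θ y (torsionConnection g p q y (partialD μ ψ m) (partialD ν ψ m) -
      torsionConnection g p q y (partialD ν ψ m) (partialD μ ψ m)) =
      -A.sharp (A.dp (logD Ψ m (coordVec μ)) (logD Ψ m (coordVec ν))) := fun μ ν => by
    rw [hQ, hA, hA]
    rfl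
  rw [map_add (θ y), map_sub (θ y) (_ + _), map_add (θ y) (_ + _), h2, h2, h2, map_smul,
    map_add (θ y), map_add (θ y), map_smul, map_smul, map_smul, h3, h3, h3, FrameData.source,
    FrameData.force]
  simp only [map_sub, map_add, map_smul, coordVec]
  simp only [Matrix.cons_val]
  rw [← sub_eq_zero (b := _ + _ + (_ - _ - _ - _)), ← neg_eq_zero]
  refine Eq.congr_left ?_
  module

theorem exists_frameData [FiniteDimensional ℝ E]
    (g p : LinearMap.BilinForm ℝ (GroupLieAlgebra 𝓘(ℝ, E) G))
    (g_symm : ∀ u w, g u w = g w u) (g_pos : ∀ u, u ≠ 0 → 0 < g u u) (p_alt : ∀ u, p u u = 0)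
    (lam : ℝ) (v : Fin 3 → ℝ)
    (lam_small : ∃ k : ℝ, 0 < k ∧ ∀ e h,
      1 / k * (g e e + g h h) ≤ g e e + g h h + 2 * lam * v 2 * p h e) :
    ∃ A : FrameData E, A.br = lieBr E G ∧ (∀ u w : E, A.g u w = g u w) ∧
      (∀ u w : E, A.p u w = p u w) ∧ A.lam = lam ∧ A.v = v :=
  ⟨{ br := lieBr E G
     g := LinearMap.toContinuousBilinearMap (E := E) (F := E) (G := ℝ) g
     p := LinearMap.toContinuousBilinearMap (E := E) (F := E) (G := ℝ) p
     lam := lam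
     v := v
     br_self := lieBr_self
     jacobi := lieBr_jacobi
     g_symm := g_symm
     g_pos := g_pos
     p_self := p_alt
     small := lam_small }, rfl, fun _ _ => rfl, fun _ _ => rfl, rfl, rfl⟩

end

section

/-! ### One-parameter subgroups and tangent vectors in a left-invariant frame -/

variable {E : Type*} [NormedAddCommGroup E] [NormedSpace ℝ E]
variable {G : Type*} [TopologicalSpace G] [ChartedSpace E G] [Group G] [LieGroup 𝓘(ℝ, E) ∞ G]
variable {M : Type*} [NormedAddCommGroup M] [NormedSpace ℝ M]

theorem mdifferentiableAt_mul_left (a b : G) :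
    MDifferentiableAt 𝓘(ℝ, E) 𝓘(ℝ, E) (fun x : G => a * x) b :=
  (contMDiff_mul_left (I := 𝓘(ℝ, E)) (n := ∞)).mdifferentiableAt (by simp)

/-- The left trivialization of the tangent bundle. -/
def leftTriv (X : TangentBundle 𝓘(ℝ, E) G) : E :=
  mfderiv 𝓘(ℝ, E) 𝓘(ℝ, E) (fun x : G => X.1⁻¹ * x) X.1 X.2

theorem mfderiv_inv_mul_left (a h : G) (u : E) :
    (mfderiv 𝓘(ℝ, E) 𝓘(ℝ, E) (fun x : G => a⁻¹ * x) (a * h)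
      (mfderiv 𝓘(ℝ, E) 𝓘(ℝ, E) (fun x : G => a * x) h u) : E) = u := by
  have h1 := mfderiv_comp h (mdifferentiableAt_mul_left (E := E) a⁻¹ (a * h))
    (mdifferentiableAt_mul_left (E := E) a h)
  have h2 : ((fun x : G => a⁻¹ * x) ∘ fun x => a * x) = id := by
    ext x; simp
  rw [h2, mfderiv_id] at h1
  exact congrArg (fun l : E →L[ℝ] E => l u) h1.symm

theorem mfderiv_mul_left_injective (a h : G) : Function.Injective
    (mfderiv 𝓘(ℝ, E) 𝓘(ℝ, E) (fun x : G => a * x) h : E → E) :=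
  Function.LeftInverse.injective (g := fun z : E =>
    (mfderiv 𝓘(ℝ, E) 𝓘(ℝ, E) (fun x : G => a⁻¹ * x) (a * h) z : E)) (mfderiv_inv_mul_left (E := E) a h)

/-- Left translation is injective on each tangent space, so a prescribed velocity amounts to a base
point together with a vector in the Lie algebra. -/
theorem tangent_eq_iff {f : ℝ → G} {t : ℝ} (hf : MDifferentiableAt 𝓘(ℝ, ℝ) 𝓘(ℝ, E) f t)
    (X : TangentBundle 𝓘(ℝ, E) G) :
    (⟨f t, mfderiv 𝓘(ℝ, ℝ) 𝓘(ℝ, E) f t (1 : ℝ)⟩ : TangentBundle 𝓘(ℝ, E) G) = X ↔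
      f t = X.1 ∧ logD (E := E) f t 1 = leftTriv X := by
  have h0 := mfderiv_translate hf 1
  constructor
  · rintro rfl
    exact ⟨rfl, h0.symm⟩
  · obtain ⟨h, v⟩ := X
    rintro ⟨rfl, h2⟩
    rw [← h0] at h2
    have := mfderiv_mul_left_injective (E := E) _ _ h2
    exact congrArg (fun w : TangentSpace 𝓘(ℝ, E) (f t) => (⟨f t, w⟩ : TangentBundle 𝓘(ℝ, E) G)) this

/-- Relates the left trivialization to the bundle charts, in which the smoothness of the data is
expressed. -/
theorem leftTriv_eq {q : G} {X : TangentBundle 𝓘(ℝ, E) G} (hX : X.1 ∈ (chartAt E q).source) :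
    leftTriv X = chartForm G q (extChartAt 𝓘(ℝ, E) q X.1)
      (trivializationAt E (TangentSpace 𝓘(ℝ, E)) q X).2 := by
  set φ := extChartAt 𝓘(ℝ, E) q
  have hX' : X.1 ∈ φ.source := by rwa [extChartAt_source]
  have h1 : (trivializationAt E (TangentSpace 𝓘(ℝ, E)) q X).2 =
      (mfderiv 𝓘(ℝ, E) 𝓘(ℝ, E) φ X.1 X.2 : E) := by
    have h2 := TangentBundle.continuousLinearMapAt_trivializationAt (I := 𝓘(ℝ, E)) hX
    have h3 : ((trivializationAt E (TangentSpace 𝓘(ℝ, E)) q).continuousLinearMapAt ℝ X.1 X.2 : E) =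
        (trivializationAt E (TangentSpace 𝓘(ℝ, E)) q X).2 := by
      rw [Bundle.Trivialization.continuousLinearMapAt_apply,
        Bundle.Trivialization.coe_linearMapAt_of_mem]
      exact hX
    exact h3.symm.trans (congrArg (fun l : E →L[ℝ] E => l X.2) h2)
  have hφ : MDifferentiableAt 𝓘(ℝ, E) 𝓘(ℝ, E) φ X.1 := mdifferentiableAt_extChartAt hX
  have hs : MDifferentiableAt 𝓘(ℝ, E) 𝓘(ℝ, E) φ.symm (φ X.1) :=
    (contMDiffAt_extChartAt_symm (φ.map_source hX')).mdifferentiableAt (by simp)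
  have hK : MDifferentiableAt 𝓘(ℝ, E) 𝓘(ℝ, E) (fun z => X.1⁻¹ * φ.symm z) (φ X.1) :=
    (mdifferentiableAt_mul_left X.1⁻¹ (φ.symm (φ X.1))).comp (φ X.1) hs
  have e : (fun x => X.1⁻¹ * x) =ᶠ[𝓝 X.1] (fun z => X.1⁻¹ * φ.symm z) ∘ φ := by
    filter_upwards [(isOpen_extChartAt_source (I := 𝓘(ℝ, E)) q).mem_nhds hX'] with x hx
    rw [Function.comp_apply, φ.left_inv hx]
  have h4 : (mfderiv 𝓘(ℝ, E) 𝓘(ℝ, E) (fun x => X.1⁻¹ * x) X.1 : E →L[ℝ] E) =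
      (chartForm G q (φ X.1)).comp (mfderiv 𝓘(ℝ, E) 𝓘(ℝ, E) φ X.1 : E →L[ℝ] E) := by
    refine e.mfderiv_eq.trans ((mfderiv_comp X.1 hK hφ).trans ?_)
    exact congrArg (fun l : E →L[ℝ] E => l.comp (mfderiv 𝓘(ℝ, E) 𝓘(ℝ, E) φ X.1 : E →L[ℝ] E))
      (mfderiv_div_eq_logD hs (φ.left_inv hX'))
  rw [h1]
  exact congrArg (fun l : E →L[ℝ] E => l X.2) h4

theorem contDiff_leftTriv {D : ℝ → TangentBundle 𝓘(ℝ, E) G}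
    (hD : ContMDiff 𝓘(ℝ, ℝ) 𝓘(ℝ, E).tangent ∞ D) : ContDiff ℝ ∞ fun x => leftTriv (D x) := by
  refine contDiff_iff_contDiffAt.2 fun x₀ => ?_
  set q := (D x₀).1 with hq
  have h1 := Bundle.contMDiffAt_totalSpace.1 (hD x₀)
  have hsrc : ∀ᶠ x in 𝓝 x₀, (D x).1 ∈ (chartAt E q).source :=
    h1.1.continuousAt (chart_source_mem_nhds E q)
  have h2 : ContDiffAt ℝ ∞ (fun x => extChartAt 𝓘(ℝ, E) q (D x).1) x₀ := by
    rw [← contMDiffAt_iff_contDiffAt]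
    exact ContMDiffAt.comp (g := extChartAt 𝓘(ℝ, E) q) x₀ (contMDiffAt_extChartAt' (by simp [hq])) h1.1
  have h3 : ContDiffAt ℝ ∞ (fun x => chartForm G q (extChartAt 𝓘(ℝ, E) q (D x).1)) x₀ :=
    ContDiffAt.comp (g := chartForm G q) x₀ (contDiffAt_chartForm (mem_extChartAt_target q)) h2
  refine (h3.clm_apply (contMDiffAt_iff_contDiffAt.1 h1.2)).congr_of_eventuallyEq ?_
  filter_upwards [hsrc] with x hx
  exact leftTriv_eq hx

variable [FiniteDimensional ℝ E] [T2Space G] (L : GroupLieAlgebra 𝓘(ℝ, E) G)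

theorem lieExp_zero : lieExp L 0 = 1 := (Classical.choose_spec (exists_expCurve L)).1

theorem hasMFDerivAt_lieExp (s : ℝ) : HasMFDerivAt 𝓘(ℝ, ℝ) 𝓘(ℝ, E) (lieExp L) s
    ((1 : ℝ →L[ℝ] ℝ).smulRight (mulInvariantVectorField L (lieExp L s))) :=
  (Classical.choose_spec (exists_expCurve L)).2 s

/-- An element of the Lie algebra as a vector of the model space. -/
def lieVec {G : Type*} [TopologicalSpace G] [ChartedSpace E G] [Group G]
    (L : GroupLieAlgebra 𝓘(ℝ, E) G) : E := L

theorem logD_lieExp (s : ℝ) :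
    logD (E := E) (lieExp L) s = ContinuousLinearMap.toSpanSingleton ℝ (lieVec (E := E) L) := by
  have h := hasMFDerivAt_lieExp L s
  refine ContinuousLinearMap.ext_ring ?_
  rw [← mfderiv_translate h.mdifferentiableAt, h.mfderiv]
  have h1 : ∀ z : G, lieExp L s * 1 = z →
      (mfderiv 𝓘(ℝ, E) 𝓘(ℝ, E) (fun x : G => (lieExp L s)⁻¹ * x) z
        (mfderiv 𝓘(ℝ, E) 𝓘(ℝ, E) (fun x : G => lieExp L s * x) 1 (lieVec (E := E) L) : E) : E) = lieVec (E := E) L := by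
    rintro z rfl
    exact mfderiv_inv_mul_left (E := E) _ _ _
  rw [ContinuousLinearMap.toSpanSingleton_apply, one_smul]
  refine Eq.trans ?_ (h1 _ (mul_one _))
  refine congrArg (fun w : E => (mfderiv 𝓘(ℝ, E) 𝓘(ℝ, E) (fun x : G => (lieExp L s)⁻¹ * x)
    (lieExp L s) w : E)) ?_
  exact one_smul ℝ (mfderiv 𝓘(ℝ, E) 𝓘(ℝ, E) (fun x : G => lieExp L s * x) 1 (lieVec (E := E) L) : E)

/-- The integral curve is given with its first derivative only. It has the constant logarithmic
derivative `L`, so it coincides with the smooth curve constructed from that derivative. -/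
theorem contMDiff_lieExp : ContMDiff 𝓘(ℝ, ℝ) 𝓘(ℝ, E) ∞ (lieExp L) := by
  obtain ⟨S, hS, hS0, hSd⟩ := exists_logD_time_eq (G := G) (A := fun _ : ℝ × ℝ => lieVec (E := E) L)
    contDiff_const 0
  have hs : ContMDiff 𝓘(ℝ, ℝ) 𝓘(ℝ, E) ∞ fun t : ℝ => S (0, t) :=
    hS.comp (show ContDiff ℝ ∞ fun t : ℝ => ((0, t) : ℝ × ℝ) by fun_prop).contMDiff
  have : EqOn (lieExp L) (fun t => S (0, t)) univ := by
    refine eqOn_of_logD_eq (E := E) isOpen_univ isPreconnected_univ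
      (fun t _ => (hasMFDerivAt_lieExp L t).mdifferentiableAt)
      (fun t _ => hs.mdifferentiableAt (by simp)) (fun t _ => ?_) (mem_univ 0)
      (by rw [lieExp_zero, hS0])
    rw [logD_lieExp, logD_slice hS]
    ext
    simp [hSd]
  rw [eqOn_univ] at this
  rwa [this]

theorem lieExp_add (s t : ℝ) : lieExp L (s + t) = lieExp L s * lieExp L t := by
  have hd := fun t => (contMDiff_lieExp L).mdifferentiableAt (x := t) (by simp)
  have : EqOn (fun t => lieExp L (s + t)) (fun t => lieExp L s * lieExp L t) univ := by
    refine eqOn_of_logD_eq (E := E) isOpen_univ isPreconnected_univ (fun t _ => ?_)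
      (fun t _ => ?_) (fun t _ => ?_) (mem_univ 0) (by simp [lieExp_zero])
    · exact ((contMDiff_lieExp L).comp
        (show ContDiff ℝ ∞ fun t : ℝ => s + t by fun_prop).contMDiff).mdifferentiableAt (by simp)
    · exact (contMDiff_const.mul (contMDiff_lieExp L)).mdifferentiableAt (by simp)
    · have h1 : HasFDerivAt (fun t : ℝ => s + t) (ContinuousLinearMap.id ℝ ℝ) t :=
        (hasFDerivAt_id t).const_add s
      rw [logD_mul_left, logD_comp (h := fun t : ℝ => s + t) (hd _) h1.differentiableAt, h1.fderiv,
        logD_lieExp, logD_lieExp, ContinuousLinearMap.comp_id]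
  exact this (mem_univ t)

end

section

/-! ### Equivariant maps and the reduced system -/

open FrameData

section LogD

variable {E : Type*} [NormedAddCommGroup E] [NormedSpace ℝ E]
variable {G : Type*} [TopologicalSpace G] [ChartedSpace E G] [Group G]
variable {M : Type*} [NormedAddCommGroup M] [NormedSpace ℝ M]

theorem logD_comp_add (f : M → G) (c m : M) : logD (E := E) (fun m' => f (m' + c)) m = logD f (m + c) :=
  fderiv_comp_add_right (f := fun m' => extChartAt 𝓘(ℝ, E) (1 : G) ((f (m + c))⁻¹ * f m')) c

theorem logD_curve [LieGroup 𝓘(ℝ, E) ∞ G] {f : M → G} (hf : ContMDiff 𝓘(ℝ, M) 𝓘(ℝ, E) ∞ f)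
    {c : ℝ → M} {s : ℝ} {d : M} (hc : HasDerivAt c d s) :
    logD (E := E) (fun s => f (c s)) s 1 = logD f (c s) d := by
  rw [logD_comp (hf.mdifferentiableAt (by simp)) hc.differentiableAt,
    ContinuousLinearMap.comp_apply, fderiv_apply_one_eq_deriv, hc.deriv]

theorem contDiff_logD [LieGroup 𝓘(ℝ, E) ∞ G] {f : M → G}
    (hf : ContMDiff 𝓘(ℝ, M) 𝓘(ℝ, E) ∞ f) : ContDiff ℝ ∞ (logD (E := E) f) :=
  contDiff_iff_contDiffAt.2 fun _ => contDiffAt_logD hf.contMDiffAt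

/-- The line `y = 0` with shifted time. -/
def sliceMap (t₀ : ℝ) (q : ℝ × ℝ) : ℝ × ℝ × ℝ := (q.1, 0, t₀ + q.2)

theorem hasFDerivAt_sliceMap (t₀ : ℝ) (q : ℝ × ℝ) : HasFDerivAt (sliceMap t₀)
    ((ContinuousLinearMap.fst ℝ ℝ ℝ).prod
      ((0 : ℝ × ℝ →L[ℝ] ℝ).prod (ContinuousLinearMap.snd ℝ ℝ ℝ))) q :=
  hasFDerivAt_fst.prodMk ((hasFDerivAt_const _ _).prodMk (hasFDerivAt_snd.const_add t₀))

theorem contDiff_sliceMap (t₀ : ℝ) : ContDiff ℝ ∞ (sliceMap t₀) := by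
  unfold sliceMap
  fun_prop

/-- The characteristic components of the logarithmic derivative on the slice `y = 0`. -/
def charData (Ψ : ℝ × ℝ × ℝ → G) (t₀ : ℝ) (q : ℝ × ℝ) : Fin 3 → E :=
  ![logD Ψ (sliceMap t₀ q) (0, 0, 1) + logD Ψ (sliceMap t₀ q) (1, 0, 0),
    logD Ψ (sliceMap t₀ q) (0, 0, 1) - logD Ψ (sliceMap t₀ q) (1, 0, 0),
    logD Ψ (sliceMap t₀ q) (0, 1, 0)]

theorem tPart_charData (Ψ : ℝ × ℝ × ℝ → G) (t₀ : ℝ) (q : ℝ × ℝ) :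
    tPart (charData (E := E) Ψ t₀ q) = logD Ψ (sliceMap t₀ q) (0, 0, 1) := by
  simp only [tPart, charData, Matrix.cons_val]
  module

theorem xPart_charData (Ψ : ℝ × ℝ × ℝ → G) (t₀ : ℝ) (q : ℝ × ℝ) :
    xPart (charData (E := E) Ψ t₀ q) = logD Ψ (sliceMap t₀ q) (1, 0, 0) := by
  simp only [xPart, charData, Matrix.cons_val]
  module

theorem charPart_ext {u u' : Fin 3 → E} (ht : tPart u = tPart u') (hx : xPart u = xPart u')
    (hy : u 2 = u' 2) : u = u' := by
  ext i
  fin_cases i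
  · change u 0 = u' 0
    rw [← tPart_add_xPart u, ht, hx, tPart_add_xPart]
  · change u 1 = u' 1
    rw [← tPart_sub_xPart u, ht, hx, tPart_sub_xPart]
  · exact hy

theorem contDiff_charData [LieGroup 𝓘(ℝ, E) ∞ G] {Ψ : ℝ × ℝ × ℝ → G}
    (hΨ : ContMDiff 𝓘(ℝ, ℝ × ℝ × ℝ) 𝓘(ℝ, E) ∞ Ψ) (t₀ : ℝ) :
    ContDiff ℝ ∞ (charData (E := E) Ψ t₀) := by
  have h1 : ContDiff ℝ ∞ fun q => logD (E := E) Ψ (sliceMap t₀ q) :=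
    (contDiff_logD hΨ).comp (contDiff_sliceMap t₀)
  refine contDiff_pi.2 fun i => ?_
  fin_cases i <;> simp only [charData] <;> simp <;> fun_prop

theorem fderiv_logD_slice [LieGroup 𝓘(ℝ, E) ∞ G] {Ψ : ℝ × ℝ × ℝ → G}
    (hΨ : ContMDiff 𝓘(ℝ, ℝ × ℝ × ℝ) 𝓘(ℝ, E) ∞ Ψ) (t₀ : ℝ) (q d : ℝ × ℝ)
    (e : ℝ × ℝ × ℝ) : fderiv ℝ (fun q => logD (E := E) Ψ (sliceMap t₀ q) e) q d =
      fderiv ℝ (logD Ψ) (sliceMap t₀ q) (d.1, 0, d.2) e := by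
  have hd : Differentiable ℝ (logD (E := E) Ψ) := (contDiff_logD hΨ).differentiable (by simp)
  have h1 := ((hd (sliceMap t₀ q)).hasFDerivAt.comp q (hasFDerivAt_sliceMap t₀ q)).clm_apply
    (hasFDerivAt_const e q)
  refine (congrArg (fun l : ℝ × ℝ →L[ℝ] E => l d) h1.fderiv).trans ?_
  simp

theorem sliceMap_zero (t₀ x : ℝ) : sliceMap t₀ (x, 0) = (x, 0, t₀) := by simp [sliceMap]

theorem logD_initial_x [LieGroup 𝓘(ℝ, E) ∞ G] {Ψ : ℝ × ℝ × ℝ → G}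
    (hΨ : ContMDiff 𝓘(ℝ, ℝ × ℝ × ℝ) 𝓘(ℝ, E) ∞ Ψ) {h : ℝ → G} {t₀ : ℝ}
    (hh : ∀ x, Ψ (x, 0, t₀) = h x) (x : ℝ) :
    logD (E := E) Ψ (x, 0, t₀) (1, 0, 0) = logD h x 1 := by
  have e : h = fun x => Ψ (x, 0, t₀) := by ext1 x; rw [hh]
  rw [e, logD_curve hΨ (c := fun x => (x, 0, t₀)) (d := (1, 0, 0))]
  exact (hasDerivAt_id _).prodMk ((hasDerivAt_const _ _).prodMk (hasDerivAt_const _ _))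

theorem logD_initial_t [LieGroup 𝓘(ℝ, E) ∞ G] {Ψ : ℝ × ℝ × ℝ → G}
    (hΨ : ContMDiff 𝓘(ℝ, ℝ × ℝ × ℝ) 𝓘(ℝ, E) ∞ Ψ) (x t : ℝ) :
    logD (E := E) Ψ (x, 0, t) (0, 0, 1) = logD (fun t => Ψ (x, 0, t)) t 1 := by
  rw [logD_curve hΨ (c := fun t => (x, 0, t)) (d := (0, 0, 1))]
  exact (hasDerivAt_const _ _).prodMk ((hasDerivAt_const _ _).prodMk (hasDerivAt_id _))

end LogD

variable {E : Type*} [NormedAddCommGroup E] [NormedSpace ℝ E] [FiniteDimensional ℝ E]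
variable {G : Type*} [TopologicalSpace G] [ChartedSpace E G] [Group G] [LieGroup 𝓘(ℝ, E) ∞ G]
  [T2Space G] {L : GroupLieAlgebra 𝓘(ℝ, E) G}

namespace LeftEquivariant

variable {Ψ : ℝ × ℝ × ℝ → G}

/-- A shift in y is a left multiplication, which `logD` does not see. -/
theorem logD_add (h : LeftEquivariant L Ψ) (m : ℝ × ℝ × ℝ) (y : ℝ) :
    logD (E := E) Ψ (m + (0, y, 0)) = logD Ψ m := by
  rw [← logD_comp_add, ← logD_mul_left (lieExp L y) Ψ]
  congr 1
  ext1 m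
  obtain ⟨a, b, c⟩ := m
  simpa using h a b c y

theorem fderiv_logD_add (h : LeftEquivariant L Ψ) (m : ℝ × ℝ × ℝ) (y : ℝ) :
    fderiv ℝ (logD (E := E) Ψ) (m + (0, y, 0)) = fderiv ℝ (logD Ψ) m := by
  rw [← fderiv_comp_add_right]
  congr 1
  ext1 m
  exact h.logD_add m y

theorem fderiv_logD_apply (h : LeftEquivariant L Ψ) (hΨ : ContMDiff 𝓘(ℝ, ℝ × ℝ × ℝ) 𝓘(ℝ, E) ∞ Ψ)
    (m : ℝ × ℝ × ℝ) : fderiv ℝ (logD (E := E) Ψ) m (0, 1, 0) = 0 := by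
  have hd : Differentiable ℝ (logD (E := E) Ψ) := (contDiff_logD hΨ).differentiable (by simp)
  have h1 : HasDerivAt (fun y : ℝ => m + ((0, y, 0) : ℝ × ℝ × ℝ)) (0, 1, 0) 0 :=
    ((hasDerivAt_const _ _).prodMk ((hasDerivAt_id _).prodMk (hasDerivAt_const _ _))).const_add m
  have h2 := HasFDerivAt.comp_hasDerivAt (f := fun y : ℝ => m + ((0, y, 0) : ℝ × ℝ × ℝ)) 0
    (hd _).hasFDerivAt h1
  have h3 : logD (E := E) Ψ ∘ (fun y : ℝ => m + ((0, y, 0) : ℝ × ℝ × ℝ)) = fun _ => logD Ψ m := by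
    ext1 y
    exact h.logD_add m y
  rw [h3] at h2
  have h4 := h2.unique (hasDerivAt_const _ _)
  rwa [h.fderiv_logD_add] at h4

theorem eq_mul (h : LeftEquivariant L Ψ) (x y t : ℝ) : Ψ (x, y, t) = lieExp L y * Ψ (x, 0, t) := by
  simpa using h x 0 t y

end LeftEquivariant

variable {Ψ : ℝ × ℝ × ℝ → G}

/-- The structure equations in the reduced variables. -/
theorem LeftEquivariant.structure_equations (h : LeftEquivariant L Ψ)
    (hΨ : ContMDiff 𝓘(ℝ, ℝ × ℝ × ℝ) 𝓘(ℝ, E) ∞ Ψ) (t₀ : ℝ) (q : ℝ × ℝ) :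
    fderiv ℝ (fun q => xPart (charData (E := E) Ψ t₀ q)) q (0, 1) =
        fderiv ℝ (fun q => tPart (charData (E := E) Ψ t₀ q)) q (1, 0) -
          lieBr E G (tPart (charData Ψ t₀ q)) (xPart (charData Ψ t₀ q)) ∧
      fderiv ℝ (fun q => charData (E := E) Ψ t₀ q 2) q (0, 1) =
        -lieBr E G (tPart (charData Ψ t₀ q)) (charData Ψ t₀ q 2) ∧
      fderiv ℝ (fun q => charData (E := E) Ψ t₀ q 2) q (1, 0) =
        -lieBr E G (xPart (charData Ψ t₀ q)) (charData Ψ t₀ q 2) := by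
  have mc := maurer_cartan (E := E) (f := Ψ) (m := sliceMap t₀ q)
    (Eventually.of_forall fun m => hΨ.contMDiffAt)
  have h2 : ∀ q, charData (E := E) Ψ t₀ q 2 = logD Ψ (sliceMap t₀ q) (0, 1, 0) := fun _ => rfl
  have h0 := h.fderiv_logD_apply hΨ (sliceMap t₀ q)
  simp only [tPart_charData, xPart_charData, h2, fderiv_logD_slice hΨ]
  refine ⟨?_, ?_, ?_⟩
  · rw [sub_eq_add_neg, ← mc]
    abel
  · rw [← mc, h0, zero_apply, sub_zero]
  · rw [← mc, h0, zero_apply, sub_zero]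

/-- Two of the three reduced equations are structure equations and hold for every equivariant map;
only the evolution of t carries the wave map equation. -/
theorem LeftEquivariant.solvesAt_iff (h : LeftEquivariant L Ψ)
    (hΨ : ContMDiff 𝓘(ℝ, ℝ × ℝ × ℝ) 𝓘(ℝ, E) ∞ Ψ) (A : FrameData E) (hbr : A.br = lieBr E G)
    (t₀ : ℝ) (q : ℝ × ℝ) : SolvesAt speed A.nonlin (charData Ψ t₀) q ↔
      fderiv ℝ (logD (E := E) Ψ) (sliceMap t₀ q) (0, 0, 1) (0, 0, 1) =
        fderiv ℝ (logD Ψ) (sliceMap t₀ q) (1, 0, 0) (1, 0, 0) +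
        fderiv ℝ (logD Ψ) (sliceMap t₀ q) (0, 1, 0) (0, 1, 0) +
        A.source (logD Ψ (sliceMap t₀ q) (0, 0, 1)) (logD Ψ (sliceMap t₀ q) (1, 0, 0))
          (logD Ψ (sliceMap t₀ q) (0, 1, 0)) := by
  have h1 := h.structure_equations hΨ t₀ q
  have h2 : ∀ q, charData (E := E) Ψ t₀ q 2 = logD Ψ (sliceMap t₀ q) (0, 1, 0) := fun _ => rfl
  rw [A.solvesAt_iff ((contDiff_charData hΨ t₀).differentiable (by simp) q), hbr,
    and_iff_left ⟨h1.1, h1.2.1⟩, h.fderiv_logD_apply hΨ, zero_apply, add_zero]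
  simp only [tPart_charData, xPart_charData, h2, fderiv_logD_slice hΨ]

/-- Both sides of the frame equation are invariant under shifts in y, so testing on y = 0 is enough.
-/
theorem LeftEquivariant.isTorsionWaveMap_iff (h : LeftEquivariant L Ψ)
    (hΨ : ContMDiff 𝓘(ℝ, ℝ × ℝ × ℝ) 𝓘(ℝ, E) ∞ Ψ) (A : FrameData E) (hbr : A.br = lieBr E G)
    {g p : LinearMap.BilinForm ℝ (GroupLieAlgebra 𝓘(ℝ, E) G)}
    (hg : ∀ u w : E, A.g u w = g u w) (hp : ∀ u w : E, A.p u w = p u w) (t₀ : ℝ) :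
    IsTorsionWaveMap g p A.lam A.v Ψ ↔ ∀ q, SolvesAt speed A.nonlin (charData Ψ t₀) q := by
  rw [LieWaveMap.isTorsionWaveMap_iff A hbr hg hp hΨ]
  simp only [h.solvesAt_iff hΨ A hbr t₀]
  refine ⟨fun H q => H _, fun H m => ?_⟩
  have e : m = sliceMap t₀ (m.1, m.2.2 - t₀) + (0, m.2.1, 0) := by
    ext <;> simp [sliceMap]
  rw [e, h.fderiv_logD_add, h.logD_add]
  exact H _

/-! ### Initial data -/

theorem contMDiff_lieExp_mul {h : ℝ × ℝ → G} (hh : ContMDiff 𝓘(ℝ, ℝ × ℝ) 𝓘(ℝ, E) ∞ h) :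
    ContMDiff 𝓘(ℝ, ℝ × ℝ × ℝ) 𝓘(ℝ, E) ∞ fun m : ℝ × ℝ × ℝ => lieExp L m.2.1 * h (m.1, m.2.2) :=
  ((contMDiff_lieExp L).comp
    (show ContDiff ℝ ∞ fun m : ℝ × ℝ × ℝ => m.2.1 by fun_prop).contMDiff).mul
    (hh.comp (show ContDiff ℝ ∞ fun m : ℝ × ℝ × ℝ => (m.1, m.2.2) by fun_prop).contMDiff)

theorem leftEquivariant_lieExp_mul (h : ℝ × ℝ → G) :
    LeftEquivariant L fun m : ℝ × ℝ × ℝ => lieExp L m.2.1 * h (m.1, m.2.2) := fun x y t s => by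
  simp only
  rw [add_comm, lieExp_add, mul_assoc]

variable (L) in
/-- The characteristic components of the initial data. -/
def initialData (D : ℝ → TangentBundle 𝓘(ℝ, E) G) (x : ℝ) : Fin 3 → E :=
  ![leftTriv (D x) + logD (fun x => (D x).1) x 1, leftTriv (D x) - logD (fun x => (D x).1) x 1,
    logD (fun y => lieExp L y * (D x).1) 0 1]

theorem tPart_initialData (D : ℝ → TangentBundle 𝓘(ℝ, E) G) (x : ℝ) :
    tPart (initialData L D x) = leftTriv (D x) := by
  simp only [tPart, initialData, Matrix.cons_val]
  module

theorem LeftEquivariant.logD_initial_y (he : LeftEquivariant L Ψ)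
    (hΨ : ContMDiff 𝓘(ℝ, ℝ × ℝ × ℝ) 𝓘(ℝ, E) ∞ Ψ) {h : ℝ → G} {t₀ : ℝ}
    (hh : ∀ x, Ψ (x, 0, t₀) = h x) (x : ℝ) :
    logD (E := E) Ψ (x, 0, t₀) (0, 1, 0) = logD (fun y => lieExp L y * h x) 0 1 := by
  simp only [← hh, ← he.eq_mul]
  rw [logD_curve hΨ (c := fun y => (x, y, t₀)) (d := (0, 1, 0))]
  exact (hasDerivAt_const _ _).prodMk ((hasDerivAt_id _).prodMk (hasDerivAt_const _ _))

theorem LeftEquivariant.charData_zero (h : LeftEquivariant L Ψ)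
    (hΨ : ContMDiff 𝓘(ℝ, ℝ × ℝ × ℝ) 𝓘(ℝ, E) ∞ Ψ) {D : ℝ → TangentBundle 𝓘(ℝ, E) G} {t₀ : ℝ}
    (hD : ∀ x, Ψ (x, 0, t₀) = (D x).1) (x : ℝ)
    (ht : logD (E := E) (fun t => Ψ (x, 0, t)) t₀ 1 = leftTriv (D x)) :
    charData Ψ t₀ (x, 0) = initialData L D x := by
  simp only [charData, initialData, sliceMap_zero, logD_initial_t hΨ, ht, logD_initial_x hΨ hD,
    h.logD_initial_y hΨ hD]

theorem xPart_initialData (D : ℝ → TangentBundle 𝓘(ℝ, E) G) (x : ℝ) :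
    xPart (initialData L D x) = logD (fun x => (D x).1) x 1 := by
  simp only [xPart, initialData, Matrix.cons_val]
  module

/-- The auxiliary map exp(yL) h(x), constant in time, is equivariant and has the same x and y
components. Its structure equations on the initial line give the constraint required by the energy
estimate. -/
theorem initialData_admissible {D : ℝ → TangentBundle 𝓘(ℝ, E) G}
    (hD : ContMDiff 𝓘(ℝ, ℝ) 𝓘(ℝ, E).tangent ∞ D) : ContDiff ℝ ∞ (initialData L D) ∧
      ∀ x, deriv (fun x => initialData L D x 2) x =
        -lieBr E G (xPart (initialData L D x)) (initialData L D x 2) := by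
  have hs : ContMDiff 𝓘(ℝ, ℝ) 𝓘(ℝ, E) ∞ fun x => (D x).1 :=
    (Bundle.contMDiff_proj (TangentSpace 𝓘(ℝ, E))).comp hD
  set h : ℝ × ℝ → G := fun q => (D q.1).1 with hh
  have hhs : ContMDiff 𝓘(ℝ, ℝ × ℝ) 𝓘(ℝ, E) ∞ h := hs.comp contDiff_fst.contMDiff
  set R : ℝ × ℝ × ℝ → G := fun m => lieExp L m.2.1 * h (m.1, m.2.2) with hR
  have hRs : ContMDiff 𝓘(ℝ, ℝ × ℝ × ℝ) 𝓘(ℝ, E) ∞ R := contMDiff_lieExp_mul hhs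
  have hRe : LeftEquivariant L R := leftEquivariant_lieExp_mul h
  have hRh : ∀ x, R (x, 0, 0) = (D x).1 := fun x => by simp [hR, hh, lieExp_zero]
  have hc : ContDiff ℝ ∞ (charData (E := E) R 0) := contDiff_charData hRs 0
  have hx : ∀ x, logD (E := E) (fun x => (D x).1) x 1 = xPart (charData R 0 (x, 0)) := fun x => by
    rw [xPart_charData, sliceMap_zero, logD_initial_x hRs hRh]
  have hy : ∀ x, logD (E := E) (fun y => lieExp L y * (D x).1) 0 1 = charData R 0 (x, 0) 2 :=
    fun x => by
      rw [← hRe.logD_initial_y hRs hRh, ← sliceMap_zero]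
      rfl
  have hp : ContDiff ℝ ∞ fun x : ℝ => ((x, 0) : ℝ × ℝ) := by fun_prop
  constructor
  · have h1 := contDiff_leftTriv hD
    have h2 : ContDiff ℝ ∞ fun x : ℝ => xPart (charData (E := E) R 0 (x, 0)) :=
      (contDiff_xPart hc).comp hp
    have h3 : ContDiff ℝ ∞ fun x : ℝ => charData (E := E) R 0 (x, 0) := hc.comp hp
    unfold initialData
    simp only [hx, hy]
    refine contDiff_pi.2 fun i => ?_
    fin_cases i <;> simp <;> fun_prop
  · intro x
    have h2 : ∀ x, initialData L D x 2 = charData (E := E) R 0 (x, 0) 2 := hy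
    have h3 : Differentiable ℝ fun q => charData (E := E) R 0 q 2 :=
      (show ContDiff ℝ ∞ fun q => charData (E := E) R 0 q 2 by fun_prop).differentiable (by simp)
    have h4 := HasFDerivAt.comp_hasDerivAt (f := fun x : ℝ => ((x, 0) : ℝ × ℝ)) x
      (h3 (x, 0)).hasFDerivAt ((hasDerivAt_id x).prodMk (hasDerivAt_const x 0))
    simp only [h2, xPart_initialData, hx]
    rw [← (hRe.structure_equations hRs 0 (x, 0)).2.2]
    exact h4.deriv

/-! ### The Cauchy problem -/

theorem IsGlobalSolution.charData_eq {g p : LinearMap.BilinForm ℝ (GroupLieAlgebra 𝓘(ℝ, E) G)}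
    {lam : ℝ} {v : Fin 3 → ℝ} {t₀ : ℝ} {D : ℝ → TangentBundle 𝓘(ℝ, E) G}
    (h : IsGlobalSolution g p lam v L t₀ D Ψ) (x : ℝ) :
    Ψ (x, 0, t₀) = (D x).1 ∧ charData Ψ t₀ (x, 0) = initialData L D x := by
  have hm : ∀ x, MDifferentiableAt 𝓘(ℝ, ℝ) 𝓘(ℝ, E) (fun t : ℝ => Ψ (x, 0, t)) t₀ := fun x =>
    (h.smooth.comp (show ContDiff ℝ ∞ fun t : ℝ => ((x, 0, t) : ℝ × ℝ × ℝ) by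
      fun_prop).contMDiff).mdifferentiableAt (by simp)
  have h1 := fun x => (tangent_eq_iff (hm x) (D x)).1 (h.initial x)
  exact ⟨(h1 x).1, h.equivariant.charData_zero h.smooth (fun x => (h1 x).1) x (h1 x).2⟩

theorem existsUnique_globalSolution (A : FrameData E) (hbr : A.br = lieBr E G)
    {g p : LinearMap.BilinForm ℝ (GroupLieAlgebra 𝓘(ℝ, E) G)}
    (hg : ∀ u w : E, A.g u w = g u w) (hp : ∀ u w : E, A.p u w = p u w) (t₀ : ℝ)
    {D : ℝ → TangentBundle 𝓘(ℝ, E) G} (hD : ContMDiff 𝓘(ℝ, ℝ) 𝓘(ℝ, E).tangent ∞ D) :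
    ∃! Ψ : ℝ × ℝ × ℝ → G, IsGlobalSolution g p A.lam A.v L t₀ D Ψ := by
  refine existsUnique_of_exists_of_unique ?_ fun Ψ Ψ' h h' => ?_
  · obtain ⟨ha, hca⟩ := initialData_admissible (L := L) hD
    obtain ⟨u, hu, hu0, hus⟩ := A.exists_reduced_solution ha (by rw [hbr]; exact hca)
    have hut : ContDiff ℝ ∞ fun q => tPart (u q) := contDiff_tPart hu
    have hux : ContDiff ℝ ∞ fun q => xPart (u q) := contDiff_xPart hu
    have huy : ContDiff ℝ ∞ fun q => u q 2 := by fun_prop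
    obtain ⟨S, hS, hS0, hSd⟩ := exists_logD_time_eq (G := G)
      (A := fun q : ℝ × ℝ => tPart (u (q.1, q.2 - t₀)))
      (hut.comp (show ContDiff ℝ ∞ fun q : ℝ × ℝ => (q.1, q.2 - t₀) by fun_prop)) t₀
    have hs : ContMDiff 𝓘(ℝ, ℝ) 𝓘(ℝ, E) ∞ fun x => (D x).1 :=
      (Bundle.contMDiff_proj (TangentSpace 𝓘(ℝ, E))).comp hD
    have hs' : ContMDiff 𝓘(ℝ, ℝ × ℝ) 𝓘(ℝ, E) ∞ fun q : ℝ × ℝ => (D q.1).1 :=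
      hs.comp contDiff_fst.contMDiff
    set Φ : ℝ × ℝ → G := fun q => (D q.1).1 * S q with hΦ
    have hΦs : ContMDiff 𝓘(ℝ, ℝ × ℝ) 𝓘(ℝ, E) ∞ Φ := hs'.mul hS
    set Ψ : ℝ × ℝ × ℝ → G := fun m => lieExp L m.2.1 * Φ (m.1, m.2.2) with hΨdef
    have hΨ : ContMDiff 𝓘(ℝ, ℝ × ℝ × ℝ) 𝓘(ℝ, E) ∞ Ψ := contMDiff_lieExp_mul hΦs
    have hΨe : LeftEquivariant L Ψ := leftEquivariant_lieExp_mul Φ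
    have hΨ0 : ∀ x t, Ψ (x, 0, t) = Φ (x, t) := fun x t => by simp [hΨdef, lieExp_zero]
    have hΨD : ∀ x, Ψ (x, 0, t₀) = (D x).1 := fun x => by simp [hΨ0, hΦ, hS0]
    have htime : ∀ x t, logD (E := E) Ψ (x, 0, t) (0, 0, 1) = tPart (u (x, t - t₀)) := fun x t => by
      rw [logD_initial_t hΨ]
      simp only [hΨ0]
      rw [logD_slice hΦs]
      refine Eq.trans ?_ (hSd x t)
      simpa using logD_mul_slice hS hs' (fun _ _ _ => rfl) x t
    have hinit : ∀ x, logD (E := E) (fun t => Ψ (x, 0, t)) t₀ 1 = leftTriv (D x) := fun x => by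
      rw [← logD_initial_t hΨ, htime, sub_self, hu0, tPart_initialData]
    have hc0 : ∀ x, charData Ψ t₀ (x, 0) = u (x, 0) := fun x => by
      rw [hu0, hΨe.charData_zero hΨ hΨD x (hinit x)]
    have hct : ∀ q, tPart (charData Ψ t₀ q) = tPart (u q) := fun q => by
      rw [tPart_charData, sliceMap, htime, add_sub_cancel_left]
    have hc := contDiff_charData (E := E) hΨ t₀
    have hcx : ContDiff ℝ ∞ fun q => xPart (charData (E := E) Ψ t₀ q) := contDiff_xPart hc
    have hcy : ContDiff ℝ ∞ fun q => charData (E := E) Ψ t₀ q 2 := by fun_prop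
    have eqs := fun q => (A.solvesAt_iff (hu.differentiable (by simp) q)).1 (hus q)
    have str := hΨe.structure_equations hΨ t₀
    -- The constructed map has the prescribed time component by design. The other two components of
    -- the map and of the reduced solution satisfy the same equations in time, linear because t is
    -- already known, with equal initial values.
    have ode : ∀ {w w' : ℝ × ℝ → E} {f : ℝ × ℝ → E}, ContDiff ℝ ∞ w → ContDiff ℝ ∞ w' →
        (∀ q, fderiv ℝ w q (0, 1) = f q - A.br (tPart (u q)) (w q)) →
        (∀ q, fderiv ℝ w' q (0, 1) = f q - A.br (tPart (u q)) (w' q)) →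
        (∀ x, w (x, 0) = w' (x, 0)) → ∀ q, w q = w' q := by
      intro w w' f hw hw' h h' h0 q
      have hB : Continuous fun t : ℝ => -A.br (tPart (u (q.1, t))) := 
        (A.br.continuous.comp (hut.continuous.comp (by fun_prop))).neg
      have := eq_zero_of_linear_ode (w := fun t => w (q.1, t) - w' (q.1, t)) hB (fun t => by
        have := (hasDerivAt_slice (hw.differentiable (by simp)) q.1 t).sub
          (hasDerivAt_slice (hw'.differentiable (by simp)) q.1 t)
        rw [h, h'] at this
        refine this.congr_deriv ?_
        rw [neg_apply, map_sub]
        abel) (t₀ := 0) (by simp [h0]) q.2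
      exact sub_eq_zero.1 this
    have hdt : ∀ q d, fderiv ℝ (fun q => tPart (charData (E := E) Ψ t₀ q)) q d =
        fderiv ℝ (fun q => tPart (u q)) q d := fun q d => by simp only [hct]
    have hcu : charData Ψ t₀ = u := by
      ext1 q
      refine charPart_ext (hct q) ?_ ?_
      · refine ode (f := fun q => fderiv ℝ (fun q => tPart (u q)) q (1, 0)) hcx hux (fun q => ?_)
          (fun q => (eqs q).2.1) (fun x => by rw [hc0]) q
        rw [(str q).1, hdt, hct, hbr]
      · refine ode (f := fun q => 0) hcy huy (fun q => ?_) (fun q => ?_) (fun x => by rw [hc0]) q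
        · rw [(str q).2.1, hct, hbr, zero_sub]
        · rw [(eqs q).2.2, zero_sub]
    refine ⟨Ψ, hΨ, hΨe, ?_, fun x => ?_⟩
    · rw [hΨe.isTorsionWaveMap_iff hΨ A hbr hg hp t₀, hcu]
      exact hus
    · exact (tangent_eq_iff ((hΨ.comp (show ContDiff ℝ ∞ fun t : ℝ => ((x, 0, t) : ℝ × ℝ × ℝ) by
        fun_prop).contMDiff).mdifferentiableAt (by simp)) (D x)).2 ⟨hΨD x, hinit x⟩
  -- Two solutions have the same frame components by uniqueness for the reduced system, hence the
  -- same time logarithmic derivative; equal initial positions then force equality on y = 0, and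
  -- equivariance does the rest.
  · have e : charData (E := E) Ψ t₀ = charData Ψ' t₀ := by
      ext1 q
      refine solution_unique abs_speed_le A.contDiff_nonlin (contDiff_charData h.smooth t₀)
        (contDiff_charData h'.smooth t₀) (fun x => by rw [(h.charData_eq x).2, (h'.charData_eq x).2])
        (fun z => ?_) (fun z => ?_)
      · exact (h.equivariant.isTorsionWaveMap_iff h.smooth A hbr hg hp t₀).1 h.waveMap _
      · exact (h'.equivariant.isTorsionWaveMap_iff h'.smooth A hbr hg hp t₀).1 h'.waveMap _
    have hsl : ContDiff ℝ ∞ fun q : ℝ × ℝ => ((q.1, 0, q.2) : ℝ × ℝ × ℝ) := by fun_prop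
    have hd : ∀ {Ψ : ℝ × ℝ × ℝ → G}, ContMDiff 𝓘(ℝ, ℝ × ℝ × ℝ) 𝓘(ℝ, E) ∞ Ψ → ∀ x t,
        logD (E := E) (fun q : ℝ × ℝ => Ψ (q.1, 0, q.2)) (x, t) (0, 1) =
          tPart (charData Ψ t₀ (x, t - t₀)) := fun {Ψ} hΨ x t => by
      rw [tPart_charData, sliceMap, add_sub_cancel, logD_initial_t hΨ,
        logD_slice (S := fun q : ℝ × ℝ => Ψ (q.1, 0, q.2)) (hΨ.comp hsl.contMDiff)]
      simp
    ext1 m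
    obtain ⟨x, y, t⟩ := m
    rw [h.equivariant.eq_mul, h'.equivariant.eq_mul]
    congr 1
    refine eq_of_logD_time_eq (E := E) (S := fun q : ℝ × ℝ => Ψ (q.1, 0, q.2))
      (S' := fun q : ℝ × ℝ => Ψ' (q.1, 0, q.2)) (h.smooth.comp hsl.contMDiff)
      (h'.smooth.comp hsl.contMDiff) isOpen_univ isPreconnected_univ (fun t _ => ?_) (t₀ := t₀)
      (mem_univ _) ?_ (mem_univ t)
    · rw [hd h.smooth, hd h'.smooth, e]
    · exact (h.charData_eq x).1.trans (h'.charData_eq x).1.symm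

theorem IsGlobalSolution.translate (A : FrameData E) (hbr : A.br = lieBr E G)
    {g p : LinearMap.BilinForm ℝ (GroupLieAlgebra 𝓘(ℝ, E) G)}
    (hg : ∀ u w : E, A.g u w = g u w) (hp : ∀ u w : E, A.p u w = p u w) {t₀ P : ℝ}
    {D : ℝ → TangentBundle 𝓘(ℝ, E) G} (hP : Function.Periodic D P)
    (h : IsGlobalSolution g p A.lam A.v L t₀ D Ψ) :
    IsGlobalSolution g p A.lam A.v L t₀ D fun m => Ψ (m + (P, 0, 0)) := by
  have hs : ContMDiff 𝓘(ℝ, ℝ × ℝ × ℝ) 𝓘(ℝ, E) ∞ fun m => Ψ (m + (P, 0, 0)) :=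
    h.smooth.comp (show ContDiff ℝ ∞ fun m : ℝ × ℝ × ℝ => m + (P, 0, 0) by fun_prop).contMDiff
  refine ⟨hs, fun x y t s => ?_, ?_, fun x => ?_⟩
  · simpa using h.equivariant (x + P) y t s
  · have h1 := (LieWaveMap.isTorsionWaveMap_iff A hbr hg hp h.smooth).1 h.waveMap
    rw [LieWaveMap.isTorsionWaveMap_iff A hbr hg hp hs]
    have e : logD (E := E) (fun m => Ψ (m + (P, 0, 0))) = fun m => logD Ψ (m + (P, 0, 0)) := by
      ext1 m
      exact logD_comp_add _ _ _
    intro m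
    rw [e, fderiv_comp_add_right]
    exact h1 _
  · have h1 := h.initial (x + P)
    rw [hP] at h1
    have e : (fun t => Ψ ((x, 0, t) + (P, 0, 0))) = fun t => Ψ (x + P, 0, t) := by simp
    change (fun f : ℝ → G => (⟨f t₀, mfderiv 𝓘(ℝ, ℝ) 𝓘(ℝ, E) f t₀ (1 : ℝ)⟩ :
      TangentBundle 𝓘(ℝ, E) G)) (fun t => Ψ ((x, 0, t) + (P, 0, 0))) = D x
    rw [e]
    exact h1

end

end LieWaveMap

end

theorem theorem3 {E : Type*} [NormedAddCommGroup E] [NormedSpace ℝ E] [FiniteDimensional ℝ E]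
    {G : Type*} [TopologicalSpace G] [ChartedSpace E G] [Group G]
    [LieGroup 𝓘(ℝ, E) ∞ G] [T2Space G]
    (g p : LinearMap.BilinForm ℝ (GroupLieAlgebra 𝓘(ℝ, E) G))
    (g_symm : ∀ u w, g u w = g w u) (g_pos : ∀ u, u ≠ 0 → 0 < g u u) (p_alt : ∀ u, p u u = 0)
    (lam : ℝ) (v : Fin 3 → ℝ)
    (lam_small : ∃ k : ℝ, 0 < k ∧ ∀ e h,
      1 / k * (g e e + g h h) ≤ g e e + g h h + 2 * lam * v 2 * p h e ∧
      g e e + g h h + 2 * lam * v 2 * p h e ≤ k * (g e e + g h h))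
    (L : GroupLieAlgebra 𝓘(ℝ, E) G) (t₀ : ℝ)
    (D : ℝ → TangentBundle 𝓘(ℝ, E) G) (D_smooth : ContMDiff 𝓘(ℝ, ℝ) 𝓘(ℝ, E).tangent ∞ D) :
    (LieWaveMap.CompactSupportData D →
      ∃! Ψ : ℝ × ℝ × ℝ → G, LieWaveMap.IsGlobalSolution g p lam v L t₀ D Ψ) ∧
    (∀ P : ℝ, 0 < P → Function.Periodic D P →
      ∃! Ψ : ℝ × ℝ × ℝ → G, (∀ x y t : ℝ, Ψ (x + P, y, t) = Ψ (x, y, t)) ∧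
        LieWaveMap.IsGlobalSolution g p lam v L t₀ D Ψ) := by
  obtain ⟨A, hbr, hg, hp, rfl, rfl⟩ := LieWaveMap.exists_frameData g p g_symm g_pos p_alt lam v
    (lam_small.imp fun k hk => ⟨hk.1, fun e h => (hk.2 e h).1⟩)
  obtain ⟨Ψ, hΨ, huniq⟩ :=
    LieWaveMap.existsUnique_globalSolution (L := L) A hbr hg hp t₀ D_smooth
  refine ⟨fun _ => ⟨Ψ, hΨ, huniq⟩, fun P _ hP => ⟨Ψ, ⟨fun x y t => ?_, hΨ⟩, fun Ψ' h => huniq Ψ' h.2⟩⟩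
  -- The translate by a period solves the same Cauchy problem on the line, so uniqueness there makes
  -- the solution periodic.
  have h := congrFun (huniq _ (hΨ.translate A hbr hg hp hP)) (x, y, t)
  simpa using h
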